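/- Let $k,m\ge 1$ be integers and let $Q=e^{\log Q}$ be a nonzero complex number with a fixed logarithm $\log Q$. **Functions.** Consider variables $q_n^\alpha$ ($n\ge0$, $1\le\alpha\le k+m$), an extra variable $x$ and a formal parameter $\epsilon$; everything below depends on $q_0^k$ and $x$ only through $q_0^k+x=\epsilon u$, and $\partial_x=\partial/\partial q_0^k=\epsilon^{-1}\partial_u$. The Fock space is the ring $F=\mathbb C[u]((\epsilon))[[\,q_n^\alpha:(n,\alpha)\neq(0,k)\,]]$ of formal functions (formal series in all variables for which the translations of $q_0^k+x$ by multiples of $\epsilon$ are defined). The shift $\Lambda=e^{\epsilon\partial_x}$ acts by $u\mapsto u+1$. Put $c_n=1+\dots+\frac1n$, $c_0=0$, and $(q)_n=\Gamma(q+1)/\Gamma(q-n+1)$ for $n\in\mathbb Z$. **Vertex operators.** For $1\le a\le k$ and $k+1\le b\le k+m$ let $\log_a\lambda=\log\lambda+2\pi i(a-1)$, $\log_b\lambda=\log\lambda+2\pi i(b-k-1)$, $\lambda_a^{s}=e^{s\log_a\lambda}$, $\lambda_b^s=e^{s\log_b\lambda}$, and $$f^a=\tfrac1k\sum_{n\ge0}\tfrac{\lambda^n}{n!}(\log_a\lambda-c_n)\,dt^k(-z)^{-n-1}+\tfrac1k\sum_{n\ge0}n!\lambda^{-n-1}dt^kz^n+\sum_{\alpha=1}^{k-1}\sum_{n\in\mathbb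 Z}\big(\tfrac\alpha k-1\big)_n\lambda_a^{\frac\alpha k-n-1}\partial_{t^\alpha}(-z)^n,$$ $$f^b=-\tfrac1m\sum_{n\ge0}\tfrac{\lambda^n}{n!}(\log_b(\lambda Q^{-m})-c_n)\,dt^k(-z)^{-n-1}-\tfrac1m\sum_{n\ge0}n!\lambda^{-n-1}dt^kz^n-\sum_{\alpha=1}^{m}\sum_{n\in\mathbb Z}\big(\tfrac\alpha m-1\big)_n\lambda_b^{\frac\alpha m-n-1}\partial_{t^{k+m-\alpha}}(-z)^n,$$ where $\log_b(\lambda Q^{-m})=\log_b\lambda-m\log Q$ and covectors and vectors are identified by the metric whose only nonzero entries are $\langle\partial_{t^\alpha},\partial_{t^{k-\alpha}}\rangle=\frac1k$ ($1\le\alpha\le k-1$) and $\langle\partial_{t^{k+\beta}},\partial_{t^{k+m-\beta}}\rangle=\frac1m$ ($0\le\beta\le m$). For $f=\sum_n (I^{(n)})^\alpha\partial_{t^\alpha}(-z)^n$ put $\hat f_+=\sum_{n\ge0}(I^{(n)})^\alpha(-1)^n\epsilon\,\partial_{q_n^\alpha}$ and $\hat f_-=-\sum_{n\ge0}(I^{(-n-1)})_\alpha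 q_n^\alpha/\epsilon$. Let $\Gamma^{\pm a},\Gamma^{\pm b}$ be $e^{\hat f_-}e^{\hat f_+}$ for $f=\pm f^a,\pm f^b$, and let $$\Gamma^{\delta\#}=e^{x\partial_{q_0^k}}e^{\sum_{n>0}\frac{\lambda^n}{n!}q_n^k\partial_x},\qquad \Gamma^{\delta}=e^{-\sum_{n>0}\frac{\lambda^n}{n!}q_n^k\partial_x}e^{x\partial_{q_0^k}},$$ with values in differential operators in $x$ (that is, $e^{x\partial_{q_0^k}}$ replaces $q_0^k$ by $q_0^k+x$ in functions, while $\partial_x$ remains an operator). **Hirota quadratic equation (HQE).** $\tau\in F$ satisfies the HQE if for every $r\in\mathbb Z$ the $1$-form $$(\Gamma^{\delta\#}\otimes\Gamma^{\delta})\Big(\tfrac1k\sum_{a=1}^k\lambda_a^{\frac{1-k}k}\Gamma^a\otimes\Gamma^{-a}-\tfrac Qm\sum_{b=k+1}^{k+m}\lambda_b^{-\frac{1+m}m}\Gamma^b\otimes\Gamma^{-b}\Big)\tau(q')\,\tau(q'')\,d\lambda$$ at $(q_0^k)''-(q_0^k)'=\epsilon r$, expanded as a formal power series in the remaining variables $q',q''$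 with coefficients Laurent series in descending powers of $\lambda$ whose coefficients are differential operators in $x$ (the tensor product of the two factors being the composition of operators in $x$), is regular in $\lambda$: all coefficients of strictly negative powers of $\lambda$ vanish. **Dressing operators.** For an invertible $\tau\in F$ define $$\mathcal P_1(\zeta)=\tfrac1\tau\exp\Big(\tfrac mk\epsilon\sum_{n\ge0}n!\,\zeta^{-nk-k}\partial_{q_n^{k+m}}+\epsilon\sum_{n\ge0}\sum_{\alpha=1}^{k-1}\big(n-\tfrac\alpha k\big)_n\zeta^{\alpha-nk-k}\partial_{q_n^\alpha}\Big)\tau,$$ $$\mathcal P_2(\zeta)=\tfrac1\tau\exp\Big(-\epsilon\sum_{n\ge0}n!\,\zeta^{-nm-m}\partial_{q_n^{k+m}}-\epsilon\sum_{n\ge0}\sum_{\alpha=1}^{m}\big(n-\tfrac\alpha m\big)_n\zeta^{\alpha-nm-m}\partial_{q_n^{k+m-\alpha}}\Big)\tau,$$ and write $\mathcal P_1(\zeta)=\sum_{j\ge0}p_{1,j}\zeta^{-j}$, $\mathcal P_2(\zeta)=\sum_{j\ge0}p_{2,j}\zeta^{-j}$, $P_1=\sum_{j\ge0}p_{1,j}\Lambda^j$,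 $P_2=\sum_{j\ge0}p_{2,j}(Q\Lambda)^{-j}$. **Proposition.** Let $\tau\in F$ be invertible and satisfy the HQE. Then $P_1$ and $P_2$ are invertible (as series in $\Lambda$, resp. $\Lambda^{-1}$), $$P_1\Lambda^{-k}P_1^{-1}=P_2(Q\Lambda)^mP_2^{-1}=:L,$$ and $L=\Lambda^{-k}+u_{-k+1}\Lambda^{-k+1}+\dots+u_m\Lambda^m$ with $u_j\in F$. Moreover, set $L^{1/k}=P_1\Lambda^{-1}P_1^{-1}$, $L^{1/m}=P_2(Q\Lambda)P_2^{-1}$, $\log_-L=-kP_1\epsilon\partial_xP_1^{-1}$, $\log_+L=mP_2\epsilon\partial_xP_2^{-1}+m\log Q$, $\log L=\frac1{2m}\log_+L+\frac1{2k}\log_-L$, and $$B_n^\beta=\tfrac1{\epsilon k}\big(-\tfrac\beta k\big)_{-n-1}(L^{1/k})^{nk+k-\beta}\ (1\le\beta\le k-1),\qquad B_n^\beta=\tfrac1{\epsilon m}\big(\tfrac{\beta-k}m-1\big)_{-n-1}(L^{1/m})^{\beta-k+nm}\ (k+1\le\beta\le k+m),$$ $$B_n^k=\tfrac2{\epsilon\,n!}L^n\Big(\log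 L-\tfrac{c_n}2\big(\tfrac1k+\tfrac1m\big)-\tfrac12\log Q\Big).$$ Then $L$ satisfies the Lax equations of the $(k,m)$-extended bigraded Toda hierarchy: for all $n\ge0$ and $1\le\beta\le k+m$ (including the logarithmic flows $\beta=k$), $$\frac{\partial L}{\partial q_n^\beta}=-\big[(B_n^\beta)_{\le0},L\big]=\big[(B_n^\beta)_{>0},L\big],$$ where $(\cdot)_{>0}$ and $(\cdot)_{\le0}$ are the parts of positive and non-positive degree in $\Lambda$. -/

import Mathlib

open Polynomial

noncomputable section

namespace EBTH

/-! ## Functions of the shifted variable `q_0^k + x` -/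

/-- Laurent series in the dispersive parameter `ε` with coefficients in `M`. -/
def Eps (M : Type) [CommRing M] : Type := HahnSeries ℤ M

namespace Eps

variable {M : Type} [CommRing M]

instance instCommRing : CommRing (Eps M) := inferInstanceAs (CommRing (HahnSeries ℤ M))

/-- The embedding of the coefficients (series which do not depend on `ε`). -/
def const : M →+* Eps M := (HahnSeries.C : M →+* HahnSeries ℤ M)

/-- Scalars act coefficientwise. -/
instance instAlgebra [Algebra ℂ M] : Algebra ℂ (Eps M) := (const.comp (algebraMap ℂ M)).toAlgebra

/-- The coefficient of `ε ^ n`. -/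
def coeff (f : Eps M) (n : ℤ) : M := HahnSeries.coeff f n

/-- The element `ε`. -/
def eps : Eps M := HahnSeries.single (1 : ℤ) (1 : M)

/-- The element `ε⁻¹`. -/
def epsInv : Eps M := HahnSeries.single (-1 : ℤ) (1 : M)

theorem coeff_add (f g : Eps M) (n : ℤ) : (f + g).coeff n = f.coeff n + g.coeff n := rfl

theorem coeff_smul [Algebra ℂ M] (c : ℂ) (f : Eps M) (n : ℤ) :
    (c • f).coeff n = c • f.coeff n := by
  rw [Algebra.smul_def, Algebra.smul_def]
  exact HahnSeries.coeff_single_zero_mul (Γ := ℤ) (x := f)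

theorem eps_mul_epsInv : (eps * epsInv : Eps M) = 1 := by
  change (HahnSeries.single (1 : ℤ) (1 : M)) * (HahnSeries.single (-1 : ℤ) (1 : M)) = 1
  rw [HahnSeries.single_mul_single]
  simp

theorem ext {f g : Eps M} (h : ∀ n, f.coeff n = g.coeff n) : f = g :=
  HahnSeries.ext (_root_.funext h)

/-- Apply an additive map to every coefficient of a Laurent series in `ε`. -/
def map {N : Type} [CommRing N] (φ : M →+ N) (f : Eps M) : Eps N :=
  HahnSeries.map (Γ := ℤ) (R := M) f φ

theorem coeff_map {N : Type} [CommRing N] (φ : M →+ N) (f : Eps M) (n : ℤ) :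
    (f.map φ).coeff n = φ (f.coeff n) := rfl

/-- Apply a linear map to every coefficient of a Laurent series in `ε`. -/
def mapCoeff [Algebra ℂ M] (φ : M →ₗ[ℂ] M) : Module.End ℂ (Eps M) where
  toFun f := f.map φ.toAddMonoidHom
  map_add' f g := by
    refine Eps.ext fun n => ?_
    rw [coeff_add, coeff_map, coeff_map, coeff_map, coeff_add, map_add]
  map_smul' c f := by
    refine Eps.ext fun n => ?_
    rw [RingHom.id_apply, coeff_smul, coeff_map, coeff_map, coeff_smul]
    exact φ.map_smul c (f.coeff n)

end Eps

/-- Formal functions of the single variable `q_0^k + x`.  With `u = (q_0^k + x) / ε` this is the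
ring `ℂ[u]((ε))`, i.e. the ring of formal power series `∑ aₙ(ε) (q_0^k + x) ^ n` over `ℂ((ε))` on
which the translations of `q_0^k + x` by multiples of `ε` are defined coefficientwise
(`ord aₙ + n → ∞`). -/
abbrev FunX : Type := Eps ℂ[X]

/-- The translation `q_0^k + x ↦ q_0^k + x + ε c`, i.e. `u ↦ u + c`. -/
def shiftX (c : ℂ) : Module.End ℂ FunX := Eps.mapCoeff (Polynomial.taylor c)

/-- The derivation `∂_x = ∂ / ∂ q_0^k = ε⁻¹ d/du`. -/
def derivX : Module.End ℂ FunX :=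
  LinearMap.mulLeft ℂ Eps.epsInv * Eps.mapCoeff Polynomial.derivative

/-- The ring `ℂ[ℓ][[u]]` of formal power series in `u` with coefficients in `ℂ[ℓ]`. -/
def LogU : Type := PowerSeries ℂ[X]

instance LogU.instCommRing : CommRing LogU := inferInstanceAs (CommRing (PowerSeries ℂ[X]))

/-- The inclusion of the polynomials in `ℓ`. -/
def LogU.const : ℂ[X] →+* LogU := (PowerSeries.C : ℂ[X] →+* PowerSeries ℂ[X])

/-- The inclusion of the polynomials in `u` with complex coefficients. -/
def LogU.ofPoly : ℂ[X] →+* LogU :=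
  ((Polynomial.coeToPowerSeries.ringHom (R := ℂ[X])).comp
    (Polynomial.mapRingHom (Polynomial.C : ℂ →+* ℂ[X])) : ℂ[X] →+* PowerSeries ℂ[X])

/-- The power series `exp (ρ u)`. -/
def LogU.exp (ρ : ℂ[X]) : LogU :=
  (PowerSeries.mk fun n => C (n.factorial : ℂ)⁻¹ * ρ ^ n : PowerSeries ℂ[X])

instance LogU.instAlgebra : Algebra ℂ LogU := (LogU.const.comp Polynomial.C).toAlgebra

/-- The derivation `d/du` of `ℂ[ℓ][[u]]`. -/
def derivU : LogU →ₗ[ℂ] LogU where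
  toFun f := PowerSeries.derivative ℂ[X] f
  map_add' f g := map_add (PowerSeries.derivative ℂ[X]) f g
  map_smul' c f := by
    have h : ∀ g : PowerSeries ℂ[X], PowerSeries.derivative ℂ[X] (PowerSeries.C (C c) * g) =
        PowerSeries.C (C c) * PowerSeries.derivative ℂ[X] g := by
      intro g
      ext1 n
      rw [PowerSeries.coeff_derivative, PowerSeries.coeff_C_mul, PowerSeries.coeff_C_mul,
        PowerSeries.coeff_derivative, mul_assoc]
    exact h f

/-- Functions of `q_0^k + x` which may depend on `ℓ = log λ`: the ring `ℂ[ℓ][[u]]((ε))`.  It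
contains `FunX` and the powers `λ ^ (c (q_0^k + x) / ε) = exp (c ℓ u)`. -/
abbrev FunXLog : Type := Eps LogU

/-- The operator `∂_x = ε⁻¹ d/du` on functions that may depend on `log λ`. -/
def derivXLog : Module.End ℂ FunXLog :=
  LinearMap.mulLeft ℂ Eps.epsInv * Eps.mapCoeff derivU

/-- The inclusion `ℂ[u]((ε)) → ℂ[ℓ][[u]]((ε))`. -/
def toLog (f : FunX) : FunXLog :=
  f.map LogU.ofPoly.toAddMonoidHom

/-! ## The Fock space -/

/-- The variables `q_n^α`, `n ≥ 0`, `1 ≤ α ≤ k + m`, other than `q_0^k`; the pair is `(n, α)`. -/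
def Idx (k m : ℕ) : Type := {p : ℕ × ℕ // 1 ≤ p.2 ∧ p.2 ≤ k + m ∧ p ≠ (0, k)}

/-- Formal functions of all the variables `q_n^α` (and of `x`, on which everything depends only
through `q_0^k + x`): formal power series in the `q_n^α`, `(n, α) ≠ (0, k)`, whose coefficients are
formal functions of `q_0^k + x`. -/
abbrev Fock (k m : ℕ) : Type := MvPowerSeries (Idx k m) FunX

/-- The ring of operators acting on formal functions. -/
abbrev FockOp (k m : ℕ) : Type := Module.End ℂ (Fock k m)

variable {k m : ℕ}

/-- The operator of multiplication by a function. -/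
def mulOp (f : Fock k m) : FockOp k m := LinearMap.mulLeft ℂ f

/-- An operator in the variable `q_0^k + x`, acting on formal functions of all the variables. -/
def liftX (φ : Module.End ℂ FunX) : FockOp k m where
  toFun f := fun d => φ (MvPowerSeries.coeff d f)
  map_add' f g := funext fun d => φ.map_add (MvPowerSeries.coeff d f) (MvPowerSeries.coeff d g)
  map_smul' c f := funext fun d => φ.map_smul c (MvPowerSeries.coeff d f)

/-- `shift c = e ^ (c ε ∂_x)` is the translation `q_0^k + x ↦ q_0^k + x + ε c`; in particular
`shift s` is the shift operator `Λ ^ s`. -/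
def shift (c : ℂ) : FockOp k m := liftX (shiftX c)

/-- The derivation `∂_x`. -/
def dx : FockOp k m := liftX derivX

/-- The derivation `∂ / ∂ q_n^α`. -/
def dq (n α : ℕ) : FockOp k m :=
  if h : 1 ≤ α ∧ α ≤ k + m ∧ (n, α) ≠ (0, k) then
    (MvPowerSeries.pderiv FunX (⟨(n, α), h⟩ : Idx k m)).toLinearMap.restrictScalars ℂ
  else if (n, α) = (0, k) then dx
  else 0

/-- Multiplication by `ε`. -/
def epsOp : FockOp k m := mulOp (MvPowerSeries.C Eps.eps)

/-- Multiplication by `ε⁻¹`. -/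
def epsInvOp : FockOp k m := mulOp (MvPowerSeries.C Eps.epsInv)

/-! ## Exponentials and special numbers -/

/-- The exponential of a power series in one variable without constant term. -/
def expPS {R : Type} [Ring R] [Algebra ℂ R] (Y : PowerSeries R) : PowerSeries R :=
  PowerSeries.mk fun j =>
    ∑ n ∈ Finset.range (j + 1), ((n.factorial : ℂ)⁻¹) • PowerSeries.coeff j (Y ^ n)

/-- The exponential of a power series in several variables without constant term. -/
def expMv {σ R : Type} [Ring R] [Module ℂ R] (Y : MvPowerSeries σ R) : MvPowerSeries σ R :=
  fun d => ∑ n ∈ Finset.range (d.degree + 1), ((n.factorial : ℂ)⁻¹) • MvPowerSeries.coeff d (Y ^ n)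

/-- `(q)_n = Γ(q + 1) / Γ(q - n + 1)` for an integer `n`: the falling factorial for `n ≥ 0` and
`1 / ((q + 1) ⋯ (q + p))` for `n = -p < 0`. -/
def fall (q : ℂ) : ℤ → ℂ
  | Int.ofNat n => ∏ l ∈ Finset.Icc 1 n, (q - l + 1)
  | Int.negSucc p => (∏ l ∈ Finset.Icc 1 (p + 1), (q + l))⁻¹

/-- The harmonic number `c_n = 1 + 1/2 + ⋯ + 1/n`, with `c_0 = 0`. -/
def harm (n : ℕ) : ℂ := ((harmonic n : ℚ) : ℂ)

/-! ## The vectors `f_∞^a` and `f_∞^b`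

Fractional powers of `λ` are expressed through `w = λ ^ (-1/(km))`: a Laurent series in `w` is a
series in descending powers of `λ ^ (1/(km))`, and `HahnSeries.single (-p) c` is `c λ ^ (p/(km))`.
The variable of the polynomial ring `ℂ[X]` is `ℓ = log λ`. The branches are numbered by
`i = a - 1 = 0, …, k - 1` and `i = b - k - 1 = 0, …, m - 1`. -/

/-- The factor `e ^ (2 π i · i p / (km))` by which the `i`-th branch of `λ ^ (p/(km))` differs from
the branch number `0`. -/
def branch (k m i : ℕ) (p : ℤ) : ℂ :=
  Complex.exp (2 * Real.pi * Complex.I * i * p / (k * m))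

/-- The `i`-th branch `log λ + 2 π i · i` of the logarithm. -/
def logLam (i : ℕ) : ℂ[X] := X + C (2 * Real.pi * Complex.I * i)

/-- A vector `f = ∑_n ∑_α (I^{(n)})^α (∂/∂t^α) (-z)^n`, given by the components `(I^{(n)})^α`. -/
abbrev LoopVec : Type := ℤ → ℕ → LaurentSeries ℂ[X]

/-- The components of `f_∞^a`, `a = i + 1`, in the basis `∂/∂t^α`; recall that the covector `dt^k`
is identified by the metric with `m ∂/∂t^{k+m}`. -/
def fInfA (k m i : ℕ) : LoopVec := fun n α =>
  if 1 ≤ α ∧ α < k then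
    HahnSeries.single (-(m * (α - (n + 1) * k) : ℤ))
      (C (fall ((α : ℂ) / k - 1) n * branch k m i (m * (α - (n + 1) * k))))
  else if α = k + m then
    match n with
    | Int.ofNat n =>
        HahnSeries.single ((k * m * (n + 1) : ℕ) : ℤ)
          (C ((-1) ^ n * ((m : ℂ) / k) * n.factorial))
    | Int.negSucc n =>
        HahnSeries.single (-((k * m * n : ℕ) : ℤ))
          (C (((m : ℂ) / k) * (n.factorial : ℂ)⁻¹) * (logLam i - C (harm n)))
  else 0

/-- The components of `f_∞^b`, `b = k + i + 1`, in the basis `∂/∂t^α`; `logQ` is `log Q`. -/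
def fInfB (k m : ℕ) (logQ : ℂ) (i : ℕ) : LoopVec := fun n α =>
  if k ≤ α ∧ α < k + m then
    -- here `α = k + m - α'` with `1 ≤ α' ≤ m`
    HahnSeries.single (-(k * (((k + m - α : ℕ) : ℤ) - (n + 1) * m) : ℤ))
      (-C (fall (((k + m - α : ℕ) : ℂ) / m - 1) n *
        branch k m i (k * (((k + m - α : ℕ) : ℤ) - (n + 1) * m))))
  else if α = k + m then
    match n with
    | Int.ofNat n =>
        HahnSeries.single ((k * m * (n + 1) : ℕ) : ℤ)
          (-C ((-1) ^ n * ((m : ℂ) / m) * n.factorial))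
    | Int.negSucc n =>
        HahnSeries.single (-((k * m * n : ℕ) : ℤ))
          (-(C (((m : ℂ) / m) * (n.factorial : ℂ)⁻¹) * (logLam i - C (m * logQ) - C (harm n))))
  else 0

/-- The flat metric `⟨∂/∂t^α, ∂/∂t^β⟩`. -/
def eta (k m α β : ℕ) : ℂ :=
  if 1 ≤ α ∧ α < k ∧ α + β = k then 1 / k
  else if k ≤ α ∧ α ≤ k + m ∧ α + β = 2 * k + m then 1 / m
  else 0

/-- The covariant components `(I^{(n)})_α`. -/
def lower (k m : ℕ) (f : LoopVec) (n : ℤ) (α : ℕ) : LaurentSeries ℂ[X] :=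
  ∑ β ∈ Finset.Icc 1 (k + m), HahnSeries.C (C (eta k m α β)) * f n β

/-! ## Quantization and vertex operators -/

/-- The part of `f̂₊ = ∑_{n ≥ 0} (I^{(n)})^α (-1)^n ε ∂/∂q_n^α` with `(n, α) ≠ (0, k)`, as a power
series in `w = λ ^ (-1/(km))`. (The components with `n ≥ 0` do not involve `log λ`.) -/
def quantPlus (f : LoopVec) : PowerSeries (FockOp k m) :=
  PowerSeries.mk fun j =>
    ∑ᶠ p : Idx k m,
      ((-1) ^ p.1.1 * ((f p.1.1 p.1.2).coeff j).coeff 0) • (epsOp * dq p.1.1 p.1.2)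

/-- The coefficient of `w ^ j` in `e ^ f̂₊`. The `(0, k)` term of `f̂₊` is a number times
`ε ∂/∂q_0^k`; its exponential is a translation. -/
def expPlus (f : LoopVec) (j : ℕ) : FockOp k m :=
  PowerSeries.coeff j (expPS (quantPlus f)) * shift (((f 0 k).coeff 0).coeff 0)

/-- Laurent series in `w = λ ^ (-1/(km))` whose coefficients are operators acting on functions of
`q_0^k + x` (and of `log λ`). -/
abbrev LamOp : Type := HahnSeries ℤ (Module.End ℂ FunXLog)

/-- Functions of `q_0^k + x` act by multiplication. -/
def mulLog (g : FunXLog) : Module.End ℂ FunXLog := LinearMap.mulLeft ℂ g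

/-- Polynomials in `log λ`, as multiplication operators. -/
def logOp : ℂ[X] →+* Module.End ℂ FunXLog :=
  (Algebra.lmul ℂ FunXLog).toRingHom.comp
    ((Eps.const (M := LogU)).comp LogU.const)

/-- Series in `λ` and `log λ`, as multiplication operators. -/
def scalarOp (g : LaurentSeries ℂ[X]) : LamOp := HahnSeries.map g logOp

open Classical in
/-- The linear form `∑ c_n^α q_n^α` in the variables other than `q_0^k`. -/
def linForm (c : Idx k m → LamOp) : MvPowerSeries (Idx k m) LamOp :=
  fun d => ∑ᶠ p : Idx k m, if d = Finsupp.single p 1 then c p else 0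

/-- The part of `f̂₋ = - ∑_{n ≥ 0} (I^{(-n-1)})_α q_n^α / ε` with `(n, α) ≠ (0, k)`. -/
def quantMinus (f : LoopVec) : MvPowerSeries (Idx k m) LamOp :=
  linForm fun p =>
    -(scalarOp (lower k m f (-(p.1.1 : ℤ) - 1) p.1.2) * HahnSeries.C (mulLog Eps.epsInv))

/-- The coefficient `(I^{(-1)})_k` of `- q_0^k / ε` in `f̂₋`: a polynomial in `log λ`. -/
def rho (k m : ℕ) (f : LoopVec) : ℂ[X] := (lower k m f (-1) k).coeff 0

/-- Multiplication by `exp (ρ (q_0^k + x) / ε) = exp (ρ u)` for a polynomial `ρ` in `log λ`. -/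
def expLog (ρ : ℂ[X]) : LamOp :=
  HahnSeries.C (mulLog (Eps.const (LogU.exp ρ)))

/-- A sequence of formal functions `G j`, read as the operator of multiplication by
`∑_j (G j) w ^ j`. -/
def seriesOf (G : ℕ → Fock k m) : MvPowerSeries (Idx k m) LamOp :=
  fun d => HahnSeries.ofPowerSeries ℤ _
    (PowerSeries.mk fun j => mulLog (toLog (MvPowerSeries.coeff d (G j))))

/-- The function `Γ^f τ = e ^ f̂₋ e ^ f̂₊ τ`, with `q_0^k` replaced by `q_0^k + x + ε r`. The factor
`exp (-ρ (q_0^k + x + ε r) / ε)`, `ρ = (I^{(-1)})_k`, is written as `expLog (-ρ)` times the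
number `exp (-ρ r)` (a power of `λ` and of `Q`), which is the argument `g`. -/
def vertex (f : LoopVec) (r : ℤ) (g : LamOp) (τ : Fock k m) : MvPowerSeries (Idx k m) LamOp :=
  MvPowerSeries.C (expLog (-rho k m f)) * MvPowerSeries.C g * expMv (quantMinus f) *
    seriesOf (fun j => shift (r : ℂ) (expPlus f j τ))

/-- The operator `∑_{n > 0} (λ^n / n!) q_n^k ∂_x`. -/
def phiX : MvPowerSeries (Idx k m) LamOp :=
  linForm fun p =>
    if p.1.2 = k then
      HahnSeries.single (-((k * m * p.1.1 : ℕ) : ℤ)) (((p.1.1.factorial : ℂ)⁻¹) • derivXLog)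
    else 0

/-- `Γ^{δ#} Γ^f τ`, where `Γ^{δ#} = e ^ (x ∂/∂q_0^k) e ^ (∑_{n > 0} (λ^n / n!) q_n^k ∂_x)`: an
operator in `x`, obtained from the function `Γ^f τ` by replacing `q_0^k` by `q_0^k + x` and
composing on the right with the exponential of `∂_x`. -/
def vertexSharp (f : LoopVec) (τ : Fock k m) : MvPowerSeries (Idx k m) LamOp :=
  vertex f 0 1 τ * expMv phiX

/-- `Γ^δ Γ^f τ`, where `Γ^δ = e ^ (-∑_{n > 0} (λ^n / n!) q_n^k ∂_x) e ^ (x ∂/∂q_0^k)`, with `q_0^k`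
further translated by `ε r`; `g` is as in `vertex`. -/
def vertexDelta (f : LoopVec) (r : ℤ) (g : LamOp) (τ : Fock k m) :
    MvPowerSeries (Idx k m) LamOp :=
  expMv (-phiX) * vertex f r g τ

/-- The number `c` times `λ ^ (p/(km))`. -/
def lamPow (c : ℂ) (p : ℤ) : LamOp :=
  HahnSeries.single (-p) (algebraMap ℂ (Module.End ℂ FunXLog) c)

/-- The coefficient of `dλ` in
`(Γ^{δ#} ⊗ Γ^δ) ((1/k) ∑_a λ_a^{(1-k)/k} Γ^a ⊗ Γ^{-a} - (Q/m) ∑_b λ_b^{-(1+m)/m} Γ^b ⊗ Γ^{-b}) τ ⊗ τ`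
at `(q_0^k)'' - (q_0^k)' = ε r`. It is a formal power series in the variables `q'` and `q''`; what
is returned is the coefficient of the monomial `(q')^{d'} (q'')^{d''}`. For the factor evaluated
at `q''`, `exp (-ρ r)` is `λ_a^{r/k}` and `(λ_b Q^{-m})^{-r/m}` respectively. -/
def hirotaForm (logQ : ℂ) (τ : Fock k m) (r : ℤ) (d' d'' : Idx k m →₀ ℕ) : LamOp :=
  (∑ i ∈ Finset.range k,
    lamPow ((k : ℂ)⁻¹ * branch k m i (m * (1 - k))) (m * (1 - k)) *
      (MvPowerSeries.coeff d' (vertexSharp (fInfA k m i) τ) *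
        MvPowerSeries.coeff d'' (vertexDelta (-fInfA k m i) r
          (lamPow (branch k m i (m * r)) (m * r)) τ))) -
  ∑ i ∈ Finset.range m,
    lamPow (Complex.exp logQ * (m : ℂ)⁻¹ * branch k m i (-(k * (1 + m)))) (-(k * (1 + m))) *
      (MvPowerSeries.coeff d' (vertexSharp (fInfB k m logQ i) τ) *
        MvPowerSeries.coeff d'' (vertexDelta (-fInfB k m logQ i) r
          (lamPow (branch k m i (-(k * r)) * Complex.exp (r * logQ)) (-(k * r))) τ))

/-- The Hirota quadratic equation: for every `r` the 1-form is regular in `λ`, i.e. none of its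
coefficients contains a strictly negative power of `λ`. -/
def SatisfiesHQE (k m : ℕ) (logQ : ℂ) (τ : Fock k m) : Prop :=
  ∀ (r : ℤ) (d' d'' : Idx k m →₀ ℕ) (j : ℤ), 0 < j → (hirotaForm logQ τ r d' d'').coeff j = 0

/-! ## Dressing operators -/

/-- The coefficients of the powers of `ζ⁻¹` in
`(m/k) ε ∑_n n! ζ^{-nk-k} ∂/∂q_n^{k+m} + ε ∑_n ∑_{α=1}^{k-1} (n - α/k)_n ζ^{α-nk-k} ∂/∂q_n^α`. -/
def dressExp₁ (k m : ℕ) : PowerSeries (FockOp k m) :=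
  PowerSeries.mk fun j =>
    (∑ n ∈ Finset.range (j + 1),
      if n * k + k = j then
        (((m : ℂ) / k) * n.factorial) • (epsOp * dq n (k + m) : FockOp k m) else 0) +
    ∑ n ∈ Finset.range (j + 1), ∑ α ∈ Finset.Ico 1 k,
      if n * k + k = j + α then
        fall ((n : ℂ) - (α : ℂ) / k) n • (epsOp * dq n α : FockOp k m) else 0

/-- The coefficients of the powers of `ζ⁻¹` in
`-ε ∑_n n! ζ^{-nm-m} ∂/∂q_n^{k+m} - ε ∑_n ∑_{α=1}^{m} (n - α/m)_n ζ^{α-nm-m} ∂/∂q_n^{k+m-α}`,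
without the constant term `-ε ∂/∂q_0^k` (which is the term `n = 0`, `α = m`). -/
def dressExp₂ (k m : ℕ) : PowerSeries (FockOp k m) :=
  PowerSeries.mk fun j =>
    if j = 0 then 0 else
    -(∑ n ∈ Finset.range (j + 1),
      if n * m + m = j then (n.factorial : ℂ) • (epsOp * dq n (k + m) : FockOp k m) else 0) -
    ∑ n ∈ Finset.range (j + 1), ∑ α ∈ Finset.Icc 1 m,
      if n * m + m = j + α then
        fall ((n : ℂ) - (α : ℂ) / m) n • (epsOp * dq n (k + m - α) : FockOp k m) else 0

/-- The coefficient of `ζ^{-j}` in `𝒫₁(ζ)`. -/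
def symbol₁ (τ : Fock k m) (j : ℕ) : Fock k m :=
  Ring.inverse τ * PowerSeries.coeff j (expPS (dressExp₁ k m)) τ

/-- The coefficient of `ζ^{-j}` in `𝒫₂(ζ)`; `shift (-1)` is the exponential of `-ε ∂/∂q_0^k`. -/
def symbol₂ (τ : Fock k m) (j : ℕ) : Fock k m :=
  Ring.inverse τ * PowerSeries.coeff j (expPS (dressExp₂ k m)) (shift (-1) τ)

/-- The ring of one-sided difference operators: the component of degree `j` of a series stands for
the term of degree `j` (in `Λ`, or in `Λ⁻¹`), as an operator on functions; thus the term
`a Λ ^ j` is the composition of the translation `shift j` with the multiplication by `a`. Terms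
that involve `∂_x` are allowed. -/
abbrev OneSided (k m : ℕ) : Type := HahnSeries ℤ (FockOp k m)

/-- `P₁`, with left symbol `𝒫₁(ζ⁻¹)`, as a series in ascending powers of `Λ`. -/
def P₁ (τ : Fock k m) : OneSided k m :=
  HahnSeries.ofPowerSeries ℤ _ (PowerSeries.mk fun j => mulOp (symbol₁ τ j) * shift (j : ℂ))

/-- `P₂`, with left symbol `𝒫₂(Q ζ)`, as a series in powers of `Λ⁻¹`. -/
def P₂ (logQ : ℂ) (τ : Fock k m) : OneSided k m :=
  HahnSeries.ofPowerSeries ℤ _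
    (PowerSeries.mk fun j =>
      Complex.exp (-(j * logQ)) • (mulOp (symbol₂ τ j) * shift (-(j : ℂ))))

/-- `P₁ X P₁⁻¹` in the ring of series in ascending powers of `Λ`. -/
def conj₁ (τ : Fock k m) (X : OneSided k m) : OneSided k m := P₁ τ * X * Ring.inverse (P₁ τ)

/-- `P₂ X P₂⁻¹` in the ring of series in ascending powers of `Λ⁻¹`. -/
def conj₂ (logQ : ℂ) (τ : Fock k m) (X : OneSided k m) : OneSided k m :=
  P₂ logQ τ * X * Ring.inverse (P₂ logQ τ)

/-- `Λ ^ (-j)` as a series in powers of `Λ`. -/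
def lamNeg (j : ℕ) : OneSided k m := HahnSeries.single (-(j : ℤ)) (shift (-(j : ℂ)))

/-- `(Q Λ) ^ j` as a series in powers of `Λ⁻¹`. -/
def lamQ (logQ : ℂ) (j : ℕ) : OneSided k m :=
  HahnSeries.single (-(j : ℤ)) (Complex.exp (j * logQ) • shift (j : ℂ))

/-! ## Two-sided difference operators and the Lax equations -/

/-- Difference operators which may be infinite in both directions: the value at `j` is the term of
degree `j` in `Λ`. -/
abbrev TwoSided (k m : ℕ) : Type := ℤ → FockOp k m

/-- A series in powers of `Λ`, as a two-sided difference operator. -/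
def ofUp (A : OneSided k m) : TwoSided k m := fun j => A.coeff j

/-- A series in powers of `Λ⁻¹`, as a two-sided difference operator. -/
def ofDown (A : OneSided k m) : TwoSided k m := fun j => A.coeff (-j)

/-- The product of two-sided difference operators; it is used only when one of the factors has
finitely many terms. -/
def mulT (A B : TwoSided k m) : TwoSided k m := fun j => ∑ᶠ i : ℤ, A i * B (j - i)

/-- The commutator. -/
def bracket (A B : TwoSided k m) : TwoSided k m := mulT A B - mulT B A

/-- The identity operator. -/
def oneT : TwoSided k m := fun j => if j = 0 then 1 else 0

/-- Multiplication by `ε⁻¹`. -/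
def epsInvT (A : TwoSided k m) : TwoSided k m := fun j => epsInvOp * A j

/-- The part of positive degree. -/
def pos (A : TwoSided k m) : TwoSided k m := fun j => if 0 < j then A j else 0

/-- The part of non-positive degree. -/
def nonpos (A : TwoSided k m) : TwoSided k m := fun j => if j ≤ 0 then A j else 0

/-- The derivative `∂A/∂q_n^β` of the coefficients of a difference operator; for a term `a Λ ^ j`
the commutator with `∂/∂q_n^β` is `(∂a/∂q_n^β) Λ ^ j`. -/
def dqT (n β : ℕ) (A : TwoSided k m) : TwoSided k m := fun j => dq n β * A j - A j * dq n β

/-- The Lax operator `L = P₁ Λ^{-k} P₁⁻¹`. -/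
def lax (τ : Fock k m) : TwoSided k m := ofUp (conj₁ τ (lamNeg k))

/-- The expression `P₂ (Q Λ)^m P₂⁻¹`. -/
def lax' (logQ : ℂ) (τ : Fock k m) : TwoSided k m := ofDown (conj₂ logQ τ (lamQ logQ m))

/-- The power `L ^ n`. -/
def laxPow (τ : Fock k m) (n : ℕ) : TwoSided k m := ofUp (conj₁ τ (lamNeg k) ^ n)

/-- `L ^ (j/k)`, where `L ^ (1/k) = P₁ Λ⁻¹ P₁⁻¹`. -/
def rootK (τ : Fock k m) (j : ℕ) : TwoSided k m := ofUp (conj₁ τ (lamNeg 1) ^ j)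

/-- `L ^ (j/m)`, where `L ^ (1/m) = P₂ (Q Λ) P₂⁻¹`. -/
def rootM (logQ : ℂ) (τ : Fock k m) (j : ℕ) : TwoSided k m :=
  ofDown (conj₂ logQ τ (lamQ logQ 1) ^ j)

/-- The operator `ε ∂_x`, of degree `0`. -/
def epsDx : OneSided k m := HahnSeries.C (epsOp * dx)

/-- `log₋ L = -k P₁ ε∂_x P₁⁻¹`. -/
def logMinus (τ : Fock k m) : OneSided k m := -((k : ℂ) • conj₁ τ epsDx)

/-- `log₊ L = m P₂ ε∂_x P₂⁻¹ + m log Q`. -/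
def logPlus (logQ : ℂ) (τ : Fock k m) : OneSided k m :=
  (m : ℂ) • conj₂ logQ τ epsDx + ((m : ℂ) * logQ) • (1 : OneSided k m)

/-- `log L = (1/2m) log₊ L + (1/2k) log₋ L`. -/
def laxLog (logQ : ℂ) (τ : Fock k m) : TwoSided k m :=
  (1 / (2 * (m : ℂ))) • ofDown (logPlus logQ τ) + (1 / (2 * (k : ℂ))) • ofUp (logMinus τ)

/-- The operators `B_n^β`, `1 ≤ β ≤ k + m`. -/
def laxB (logQ : ℂ) (τ : Fock k m) (n β : ℕ) : TwoSided k m :=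
  if β < k then
    epsInvT ((1 / (k : ℂ) * fall (-((β : ℂ) / k)) (-(n : ℤ) - 1)) • rootK τ (n * k + k - β))
  else if β = k then
    epsInvT ((2 / (n.factorial : ℂ)) •
      mulT (laxPow τ n)
        (laxLog logQ τ - (harm n / 2 * (1 / (k : ℂ) + 1 / (m : ℂ)) + logQ / 2) • oneT))
  else
    epsInvT ((1 / (m : ℂ) * fall (((β : ℂ) - k) / m - 1) (-(n : ℤ) - 1)) •
      rootM logQ τ (β - k + n * m))

end EBTH

end

/-! Put A = τP₁ and B = τP₂. Up to the choice of a branch of λ, the coefficients of e^{f̂₊}τ are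
those of A when f = f^a and those of B when f = f^b, while e^{-f̂₊}τ supplies two dual series Ã and
B̃. Setting q' = q'' in the HQE makes the exponentials e^{f̂₋} and the exponentials of ∂_x cancel
(`vertex_product`), and at an integral power of λ all branches contribute equally. Collected over
all r, the coefficients of λ^{-M-1} say that A Λ^{-kM} Ã = B (QΛ)^{mM} B̃ (`SatisfiesHQE.coeff_eq`).

For M = 0 the left side has only non-negative and the right side only non-positive powers of Λ, so
both are the function τ·Λ⁻¹(τ) (`SatisfiesHQE.upSeries_mul_upDual`). Thus Ã and B̃ are P₁⁻¹ and P₂⁻¹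
times the function Λ⁻¹(τ), and every A X Ã is P₁XP₁⁻¹ between two invertible functions. Now M = 1
identifies the two expressions for L, and general M those for L^M.

For the flows, the HQE is differentiated in one variable of q' before q' = q'' is imposed. The
exponential in Γ^{δ#} brings down (λ^n/n!)∂_x; moving it past exp(ρu) produces exactly the multiple
of log λ that cancels the one brought down by f̂₋ (`flowCoeff_of_eq`). What remains is the
Sato–Wilson type identity ∂P₁·P₁⁻¹ + P₁F₁P₁⁻¹ = ∂P₂·P₂⁻¹ + P₂F₂P₂⁻¹ (`SatisfiesHQE.coeff_flow_all`),
with F₁ and F₂ of the form (a∂_x + bε⁻¹) times a power of Λ, respectively of QΛ.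

A direct computation gives B_n^β = P₂F₂P₂⁻¹ - P₁F₁P₁⁻¹ (`SatisfiesHQE.laxB_eq`), hence B_n^β =
∂P₁·P₁⁻¹ - ∂P₂·P₂⁻¹. Since P₁ begins with 1, the first term has only positive degrees, and the
second has only non-positive ones: this is the splitting of B_n^β. Differentiating L = P₁Λ^{-k}P₁⁻¹
and L = P₂(QΛ)^mP₂⁻¹ yields the two forms of the Lax equation. -/

noncomputable section

namespace EBTH

/-! ## Power series in several variables with noncommuting coefficients -/

section MvCalculus

variable {σ R : Type} [Ring R]

/-- The partial derivative of a power series whose coefficients need not commute. -/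
def pd (p : σ) : MvPowerSeries σ R →+ MvPowerSeries σ R where
  toFun X := fun d => (d p + 1) • MvPowerSeries.coeff (d + Finsupp.single p 1) X
  map_zero' := by
    refine MvPowerSeries.ext fun d => ?_
    change (d p + 1) • MvPowerSeries.coeff (d + Finsupp.single p 1) (0 : MvPowerSeries σ R) = 0
    rw [map_zero, smul_zero]
  map_add' X Y := by
    refine MvPowerSeries.ext fun d => ?_
    change (d p + 1) • MvPowerSeries.coeff (d + Finsupp.single p 1) (X + Y) =
      (d p + 1) • MvPowerSeries.coeff (d + Finsupp.single p 1) X +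
      (d p + 1) • MvPowerSeries.coeff (d + Finsupp.single p 1) Y
    rw [map_add, smul_add]

theorem coeff_pd (p : σ) (X : MvPowerSeries σ R) (d : σ →₀ ℕ) :
    MvPowerSeries.coeff d (pd p X) =
      (d p + 1) • MvPowerSeries.coeff (d + Finsupp.single p 1) X := rfl

-- Pairs with `x.1 p = 0` drop out on the left, and the others are exactly the pairs `(a + e_p, b)`
-- with `(a, b)` on the smaller antidiagonal. Together with its mirror image this is Leibniz's rule.
open Classical in
theorem sum_antidiagonal_shift_left {V : Type} [AddCommMonoid V] (p : σ) (d : σ →₀ ℕ)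
    (F : (σ →₀ ℕ) → (σ →₀ ℕ) → V) :
    ∑ x ∈ Finset.HasAntidiagonal.antidiagonal (d + Finsupp.single p (1 : ℕ)), x.1 p • F x.1 x.2 =
      ∑ x ∈ Finset.HasAntidiagonal.antidiagonal d, (x.1 p + 1) • F (x.1 + Finsupp.single p 1) x.2 := by
  symm
  refine Finset.sum_of_injOn (fun x => (x.1 + Finsupp.single p 1, x.2)) ?_ ?_ ?_ ?_
  · rintro ⟨a, b⟩ _ ⟨a', b'⟩ _ h
    simpa using h
  · rintro ⟨a, b⟩ h
    simp only [Finset.mem_coe, Finset.HasAntidiagonal.mem_antidiagonal] at h ⊢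
    rw [← h]; abel
  · rintro ⟨a, b⟩ h h'
    simp only [Finset.HasAntidiagonal.mem_antidiagonal, Set.mem_image, Finset.mem_coe, Prod.mk.injEq,
      Prod.exists, not_exists, not_and] at h h' ⊢
    by_cases hp : a p = 0
    · rw [hp, zero_smul]
    · have ha : a - Finsupp.single p 1 + Finsupp.single p 1 = a := by
        ext q
        by_cases hq : p = q
        · subst hq; simp; omega
        · simp [hq]
      refine absurd rfl (h' (a - Finsupp.single p 1) b ?_ ha)
      refine add_right_cancel (b := Finsupp.single p 1) ?_
      rw [← h, add_right_comm, ha]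
  · rintro ⟨a, b⟩ _
    simp

open Classical in
theorem sum_antidiagonal_shift_right {V : Type} [AddCommMonoid V] (p : σ) (d : σ →₀ ℕ)
    (F : (σ →₀ ℕ) → (σ →₀ ℕ) → V) :
    ∑ x ∈ Finset.HasAntidiagonal.antidiagonal (d + Finsupp.single p (1 : ℕ)), x.2 p • F x.1 x.2 =
      ∑ x ∈ Finset.HasAntidiagonal.antidiagonal d, (x.2 p + 1) • F x.1 (x.2 + Finsupp.single p 1) := by
  have h := sum_antidiagonal_shift_left p d (fun a b => F b a)
  rw [← Finset.HasAntidiagonal.map_swap_antidiagonal, Finset.sum_map,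
    ← Finset.HasAntidiagonal.map_swap_antidiagonal (n := d), Finset.sum_map]
  exact h

theorem pd_mul (p : σ) (X Y : MvPowerSeries σ R) : pd p (X * Y) = pd p X * Y + X * pd p Y := by
  classical
  refine MvPowerSeries.ext fun d => ?_
  rw [map_add, coeff_pd, MvPowerSeries.coeff_mul, MvPowerSeries.coeff_mul,
    MvPowerSeries.coeff_mul, Finset.smul_sum]
  simp only [coeff_pd, smul_mul_assoc, mul_smul_comm]
  rw [← sum_antidiagonal_shift_left p d
      (fun a b => MvPowerSeries.coeff a X * MvPowerSeries.coeff b Y),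
    ← sum_antidiagonal_shift_right p d
      (fun a b => MvPowerSeries.coeff a X * MvPowerSeries.coeff b Y), ← Finset.sum_add_distrib]
  refine Finset.sum_congr rfl fun x hx => ?_
  -- On the antidiagonal of `d + e_p` the two exponents of `p` add up to `d p + 1`, the factor in
  -- the derivative.
  rw [← add_smul]
  congr 1
  have := DFunLike.congr_fun (Finset.HasAntidiagonal.mem_antidiagonal.1 hx) p
  simpa using this.symm

theorem pd_C (p : σ) (r : R) : pd p (MvPowerSeries.C r : MvPowerSeries σ R) = 0 := by
  classical
  refine MvPowerSeries.ext fun d => ?_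
  rw [coeff_pd, MvPowerSeries.coeff_C, if_neg, smul_zero, map_zero]
  intro h
  have := DFunLike.congr_fun h p
  simp at this

theorem pd_pow (p : σ) (Y : MvPowerSeries σ R) (h : Commute (pd p Y) Y) (n : ℕ) :
    pd p (Y ^ (n + 1)) = (n + 1) • (pd p Y * Y ^ n) := by
  induction n with
  | zero => simp
  | succ n ih =>
    rw [pow_succ, pd_mul, ih, smul_mul_assoc, mul_assoc, ← pow_succ, ← (h.pow_right (n + 1)).eq,
      ← succ_nsmul]

theorem coeff_mul_eq_zero {X Y : MvPowerSeries σ R} {N M : ℕ}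
    (hX : ∀ d : σ →₀ ℕ, d.degree < N → MvPowerSeries.coeff d X = 0)
    (hY : ∀ d : σ →₀ ℕ, d.degree < M → MvPowerSeries.coeff d Y = 0) (d : σ →₀ ℕ)
    (hd : d.degree < N + M) : MvPowerSeries.coeff d (X * Y) = 0 := by
  classical
  rw [MvPowerSeries.coeff_mul]
  refine Finset.sum_eq_zero fun x hx => ?_
  have h := congrArg Finsupp.degree (Finset.HasAntidiagonal.mem_antidiagonal.1 hx)
  rw [map_add] at h
  rcases lt_or_ge x.1.degree N with h1 | h1
  · rw [hX _ h1, zero_mul]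
  · rw [hY _ (by omega), mul_zero]

theorem coeff_pow_eq_zero {Y : MvPowerSeries σ R} (hY : MvPowerSeries.constantCoeff Y = 0) (n : ℕ)
    (d : σ →₀ ℕ) (hd : d.degree < n) : MvPowerSeries.coeff d (Y ^ n) = 0 := by
  induction n generalizing d with
  | zero => omega
  | succ n ih =>
    rw [pow_succ]
    refine coeff_mul_eq_zero (M := 1) ih (fun e he => ?_) d hd
    have : e = 0 := (Finsupp.degree_eq_zero_iff e).1 (by omega)
    rw [this]; exact hY

variable [Algebra ℂ R]

/-- `Y ^ n` starts in degree `n`, so any cutoff beyond the degree of `d` gives the same sum; this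
lets both factors of a product share one cutoff. -/
theorem coeff_expMv (Y : MvPowerSeries σ R) (hY : MvPowerSeries.constantCoeff Y = 0)
    (d : σ →₀ ℕ) {N : ℕ} (hN : d.degree < N) :
    MvPowerSeries.coeff d (expMv Y) =
      ∑ n ∈ Finset.range N, ((n.factorial : ℂ)⁻¹) • MvPowerSeries.coeff d (Y ^ n) := by
  change ∑ n ∈ Finset.range (d.degree + 1), _ = _
  refine Finset.sum_subset (Finset.range_mono hN) fun n _ hn => ?_
  rw [coeff_pow_eq_zero hY n d (by simpa using hn), smul_zero]

theorem constantCoeff_expMv (Y : MvPowerSeries σ R) :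
    MvPowerSeries.coeff 0 (expMv Y) = 1 := by
  change ∑ n ∈ Finset.range ((0 : σ →₀ ℕ).degree + 1), _ = _
  simp

theorem coeff_mul_expMv {X Y : MvPowerSeries σ R} (hY : MvPowerSeries.constantCoeff Y = 0)
    (d : σ →₀ ℕ) : MvPowerSeries.coeff d (X * expMv Y) =
      ∑ n ∈ Finset.range (d.degree + 1), ((n.factorial : ℂ)⁻¹) • MvPowerSeries.coeff d (X * Y ^ n) := by
  classical
  simp only [MvPowerSeries.coeff_mul, Finset.smul_sum]
  rw [Finset.sum_comm]
  refine Finset.sum_congr rfl fun x hx => ?_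
  have h := congrArg Finsupp.degree (Finset.HasAntidiagonal.mem_antidiagonal.1 hx)
  rw [map_add] at h
  rw [coeff_expMv Y hY x.2 (N := d.degree + 1) (by omega), Finset.mul_sum]
  exact Finset.sum_congr rfl fun n _ => mul_smul_comm _ _ _

theorem coeff_expMv_mul {X Y : MvPowerSeries σ R} (hY : MvPowerSeries.constantCoeff Y = 0)
    (d : σ →₀ ℕ) : MvPowerSeries.coeff d (expMv Y * X) =
      ∑ n ∈ Finset.range (d.degree + 1), ((n.factorial : ℂ)⁻¹) • MvPowerSeries.coeff d (Y ^ n * X) := by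
  classical
  simp only [MvPowerSeries.coeff_mul, Finset.smul_sum]
  rw [Finset.sum_comm]
  refine Finset.sum_congr rfl fun x hx => ?_
  have h := congrArg Finsupp.degree (Finset.HasAntidiagonal.mem_antidiagonal.1 hx)
  rw [map_add] at h
  rw [coeff_expMv Y hY x.1 (N := d.degree + 1) (by omega), Finset.sum_mul]
  exact Finset.sum_congr rfl fun n _ => smul_mul_assoc _ _ _

theorem commute_expMv {X Y : MvPowerSeries σ R} (hY : MvPowerSeries.constantCoeff Y = 0)
    (h : Commute X Y) : Commute X (expMv Y) := by
  refine MvPowerSeries.ext fun d => ?_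
  rw [coeff_mul_expMv hY, coeff_expMv_mul hY]
  exact Finset.sum_congr rfl fun n _ => by rw [(h.pow_right n).eq]

/-- With noncommuting coefficients, the rule d(e^Y) = dY·e^Y rests on `pd p Y` commuting with `Y`;
then the derivative of `Y ^ (n + 1) / (n + 1)!` is `pd p Y * Y ^ n / n!`. -/
theorem pd_expMv (p : σ) {Y : MvPowerSeries σ R} (hY : MvPowerSeries.constantCoeff Y = 0)
    (h : Commute (pd p Y) Y) : pd p (expMv Y) = pd p Y * expMv Y := by
  classical
  refine MvPowerSeries.ext fun d => ?_
  rw [coeff_pd, coeff_expMv Y hY _ (N := d.degree + 1 + 1) (by simp), coeff_mul_expMv hY,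
    Finset.sum_range_succ', smul_add, Finset.smul_sum]
  have h0 : MvPowerSeries.coeff (d + Finsupp.single p 1) (Y ^ 0) = 0 := by
    rw [pow_zero, MvPowerSeries.coeff_one, if_neg]
    intro h
    have := DFunLike.congr_fun h p
    simp at this
  rw [h0, smul_zero, smul_zero, add_zero]
  refine Finset.sum_congr rfl fun n _ => ?_
  rw [smul_comm, ← coeff_pd, pd_pow p Y h,
    map_nsmul, ← Nat.cast_smul_eq_nsmul ℂ, smul_smul, Nat.factorial_succ]
  congr 1
  have := Nat.cast_ne_zero (R := ℂ).2 n.factorial_ne_zero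
  have := Nat.cast_ne_zero (R := ℂ).2 n.succ_ne_zero
  push_cast at *
  field_simp

theorem eq_C_of_pd_eq_zero {X : MvPowerSeries σ R} (h : ∀ p, pd p X = 0) :
    X = MvPowerSeries.C (MvPowerSeries.coeff 0 X) := by
  classical
  refine MvPowerSeries.ext fun d => ?_
  rw [MvPowerSeries.coeff_C]
  split_ifs with hd
  · rw [hd]
  · obtain ⟨p, hp⟩ := Finsupp.ne_iff.1 hd
    have h1 : d - Finsupp.single p 1 + Finsupp.single p 1 = d := by
      ext q
      by_cases hq : p = q
      · subst hq; simp at *; omega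
      · simp [hq]
    have h2 := congrArg (MvPowerSeries.coeff (d - Finsupp.single p 1)) (h p)
    rw [coeff_pd, h1, map_zero, ← Nat.cast_smul_eq_nsmul ℂ] at h2
    exact (smul_eq_zero_iff_right (Nat.cast_ne_zero.2 (Nat.succ_ne_zero _))).1 h2

/-- All partial derivatives of the product vanish, so it equals its constant term. -/
theorem expMv_mul_expMv_neg {Y : MvPowerSeries σ R} (hY : MvPowerSeries.constantCoeff Y = 0)
    (h : ∀ p, Commute (pd p Y) Y) : expMv Y * expMv (-Y) = 1 := by
  have hY' : MvPowerSeries.constantCoeff (-Y) = 0 := by rw [map_neg, hY, neg_zero]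
  rw [eq_C_of_pd_eq_zero (X := expMv Y * expMv (-Y))]
  · rw [MvPowerSeries.coeff_zero_eq_constantCoeff_apply, map_mul,
      ← MvPowerSeries.coeff_zero_eq_constantCoeff_apply,
      ← MvPowerSeries.coeff_zero_eq_constantCoeff_apply, constantCoeff_expMv,
      constantCoeff_expMv, mul_one, map_one]
  · intro p
    rw [pd_mul, pd_expMv p hY (h p), pd_expMv p hY' (by rw [map_neg]; exact (h p).neg_left.neg_right),
      map_neg, neg_mul, mul_neg, ← mul_assoc (expMv Y), ← (commute_expMv hY (h p)).eq,
      add_neg_cancel]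

end MvCalculus

/-! ### From series in `q` and `λ` to operators on the Fock space. -/

section

/-! ## Convolutions and Laurent series -/

section Conv

/-- The sum of `F i j` over all natural numbers `i`, `j` with `i + j = z`. -/
def conv {V : Type} [AddCommMonoid V] (F : ℕ → ℕ → V) (z : ℤ) : V :=
  if 0 ≤ z then ∑ x ∈ Finset.HasAntidiagonal.antidiagonal z.toNat, F x.1 x.2 else 0

theorem map_conv {V W : Type} [AddCommMonoid V] [AddCommMonoid W] (φ : V →+ W) (F : ℕ → ℕ → V)
    (z : ℤ) : φ (conv F z) = conv (fun i j => φ (F i j)) z := by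
  unfold conv
  split_ifs
  · rw [map_sum]
  · rw [map_zero]

theorem conv_sum {V ι : Type} [AddCommMonoid V] (s : Finset ι) (F : ι → ℕ → ℕ → V) (z : ℤ) :
    conv (fun i j => ∑ x ∈ s, F x i j) z = ∑ x ∈ s, conv (F x) z := by
  unfold conv
  split_ifs
  · rw [Finset.sum_comm]
  · rw [Finset.sum_const_zero]

theorem conv_congr {V : Type} [AddCommMonoid V] {F G : ℕ → ℕ → V} {z : ℤ}
    (h : ∀ i j : ℕ, (i : ℤ) + j = z → F i j = G i j) : conv F z = conv G z := by
  unfold conv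
  split_ifs with hz
  · refine Finset.sum_congr rfl fun x hx => h _ _ ?_
    have := Finset.HasAntidiagonal.mem_antidiagonal.1 hx
    omega
  · rfl

theorem conv_zero {V : Type} [AddCommMonoid V] (F : ℕ → ℕ → V) : conv F 0 = F 0 0 := by
  simp [conv]

theorem conv_of_neg {V : Type} [AddCommMonoid V] (F : ℕ → ℕ → V) {z : ℤ} (hz : z < 0) :
    conv F z = 0 := if_neg (by omega)

/-- A convolution supported on multiples of `c`. -/
theorem conv_mul {V : Type} [AddCommMonoid V] {c : ℕ} (hc : 1 ≤ c) {F : ℕ → ℕ → V}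
    (h1 : ∀ i j : ℕ, ¬ c ∣ i → F i j = 0) (z : ℤ) :
    conv F (c * z) = conv (fun i j => F (c * i) (c * j)) z := by
  by_cases hz : 0 ≤ z
  swap
  · rw [conv_of_neg _ (not_le.1 hz),
      conv_of_neg _ (mul_neg_of_pos_of_neg (by exact_mod_cast hc) (not_le.1 hz))]
  obtain ⟨n, rfl⟩ := Int.eq_ofNat_of_zero_le hz
  unfold conv
  rw [if_pos (by positivity), if_pos hz]
  norm_cast
  symm
  refine Finset.sum_of_injOn (fun x => (c * x.1, c * x.2)) ?_ ?_ ?_ ?_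
  · rintro ⟨a, b⟩ _ ⟨a', b'⟩ _ h
    simp only [Prod.mk.injEq] at h ⊢
    exact ⟨Nat.eq_of_mul_eq_mul_left hc h.1, Nat.eq_of_mul_eq_mul_left hc h.2⟩
  · rintro ⟨a, b⟩ h
    simp only [Finset.mem_coe, Finset.HasAntidiagonal.mem_antidiagonal] at h ⊢
    rw [← h, mul_add]
  · rintro ⟨a, b⟩ h h'
    refine h1 a b fun ⟨a', ha⟩ => h' ?_
    have h2 : a + b = c * n := Finset.HasAntidiagonal.mem_antidiagonal.1 h
    obtain ⟨b', hb⟩ : c ∣ b := (Nat.dvd_add_right ⟨a', ha⟩).1 ⟨n, h2⟩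
    refine ⟨(a', b'), ?_, by simp [ha, hb]⟩
    simp only [Finset.mem_coe, Finset.HasAntidiagonal.mem_antidiagonal]
    rw [ha, hb, ← mul_add] at h2
    exact Nat.eq_of_mul_eq_mul_left hc h2
  · rintro ⟨a, b⟩ _
    rfl

variable {R : Type} [Ring R]

theorem coeff_ofPowerSeries (x : PowerSeries R) (z : ℤ) :
    (HahnSeries.ofPowerSeries ℤ R x).coeff z =
      if 0 ≤ z then PowerSeries.coeff z.toNat x else 0 := by
  split_ifs with hz
  · obtain ⟨n, rfl⟩ := Int.eq_ofNat_of_zero_le hz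
    exact HahnSeries.ofPowerSeries_apply_coeff x n
  · rw [HahnSeries.ofPowerSeries_apply]
    refine HahnSeries.embDomain_of_notMem_range ?_
    rintro ⟨n, hn⟩
    have : (n : ℤ) = z := hn
    omega

theorem coeff_ofPowerSeries_mul (a b : ℕ → R) (e : ℤ) (t : R) (z : ℤ) :
    (HahnSeries.ofPowerSeries ℤ R (PowerSeries.mk a) * HahnSeries.single e t *
      HahnSeries.ofPowerSeries ℤ R (PowerSeries.mk b)).coeff z =
      conv (fun i j => a i * t * b j) (z - e) := by
  have h1 : HahnSeries.ofPowerSeries ℤ R (PowerSeries.mk a) * HahnSeries.single e t =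
      HahnSeries.single e 1 *
        HahnSeries.ofPowerSeries ℤ R (PowerSeries.mk a * PowerSeries.C t) := by
    ext w
    rw [map_mul, HahnSeries.coeff_single_mul, HahnSeries.coeff_mul_single,
      HahnSeries.ofPowerSeries_C, one_mul]
    exact HahnSeries.coeff_mul_single_zero.symm
  rw [h1, mul_assoc, ← map_mul, HahnSeries.coeff_single_mul, one_mul, coeff_ofPowerSeries]
  unfold conv
  split_ifs
  · rw [PowerSeries.coeff_mul]
    refine Finset.sum_congr rfl fun x _ => ?_
    rw [PowerSeries.coeff_mul_C, PowerSeries.coeff_mk, PowerSeries.coeff_mk]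
  · rfl

end Conv

/-! ## The inclusion of functions without logarithms -/

/-- `toLog` as a ring homomorphism. -/
def toLogHom : FunX →+* FunXLog where
  toFun := toLog
  map_one' := HahnSeries.map_one LogU.ofPoly.toMonoidWithZeroHom
  map_mul' _ _ := HahnSeries.map_mul LogU.ofPoly.toNonUnitalRingHom
  map_zero' := by
    refine Eps.ext fun n => ?_
    exact map_zero LogU.ofPoly
  map_add' f g := by
    refine Eps.ext fun n => ?_
    exact map_add LogU.ofPoly _ _

theorem LogU.ofPoly_injective : Function.Injective LogU.ofPoly := by
  intro f g h
  exact Polynomial.map_injective C C_injective (Polynomial.coe_injective ℂ[X] h)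

theorem toLogHom_injective : Function.Injective toLogHom := by
  intro f g h
  refine Eps.ext fun n => LogU.ofPoly_injective ?_
  exact congrArg (fun f => Eps.coeff f n) h

theorem Eps.coeff_epsInv_mul {M : Type} [CommRing M] (f : Eps M) (n : ℤ) :
    (Eps.epsInv * f).coeff n = f.coeff (n + 1) := by
  refine (HahnSeries.coeff_single_mul (Γ' := ℤ) (R := M)).trans ?_
  rw [one_mul, sub_neg_eq_add]
  rfl

theorem toLog_epsInv : toLog Eps.epsInv = Eps.epsInv := by
  refine Eps.ext fun n => ?_
  change LogU.ofPoly ((HahnSeries.single (-1 : ℤ) (1 : ℂ[X])).coeff n) =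
    (HahnSeries.single (-1 : ℤ) (1 : LogU)).coeff n
  rw [HahnSeries.coeff_single, HahnSeries.coeff_single]
  split_ifs
  · rw [map_one]
  · rw [map_zero]

theorem derivXLog_toLog (f : FunX) : derivXLog (toLog f) = toLog (derivX f) := by
  refine Eps.ext fun n => ?_
  change (Eps.epsInv * _ : FunXLog).coeff n = LogU.ofPoly ((Eps.epsInv * _ : FunX).coeff n)
  rw [Eps.coeff_epsInv_mul, Eps.coeff_epsInv_mul]
  change PowerSeries.derivative ℂ[X] (((f.coeff (n + 1)).map C : ℂ[X][X]) : PowerSeries ℂ[X]) =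
    ((((derivative (f.coeff (n + 1))).map C : ℂ[X][X])) : PowerSeries ℂ[X])
  rw [PowerSeries.derivative_coe, Polynomial.derivative_map]

theorem toLog_algebraMap (c : ℂ) : toLog (algebraMap ℂ FunX c) = algebraMap ℂ FunXLog c := by
  refine Eps.ext fun n => ?_
  change LogU.ofPoly ((HahnSeries.single (0 : ℤ) (C c : ℂ[X])).coeff n) =
    (HahnSeries.single (0 : ℤ) (LogU.const (C c) : LogU)).coeff n
  rw [HahnSeries.coeff_single, HahnSeries.coeff_single]
  split_ifs
  · change (((C c : ℂ[X]).map C : ℂ[X][X]) : PowerSeries ℂ[X]) = PowerSeries.C (C c)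
    simp
  · rw [map_zero]

theorem toLog_smul (c : ℂ) (f : FunX) : toLog (c • f) = c • toLog f := by
  rw [Algebra.smul_def, Algebra.smul_def, ← toLog_algebraMap]
  exact map_mul toLogHom _ _

/-! ## Representing operators on functions of all variables by their coefficients -/

variable {k m : ℕ}

open Classical in
/-- The series `X` of operators in `x` acts on formal functions as the operator `O`. -/
def Represents (X : MvPowerSeries (Idx k m) (Module.End ℂ FunXLog)) (O : FockOp k m) : Prop :=
  ∀ (h : Fock k m) (d : Idx k m →₀ ℕ),
    ∑ x ∈ Finset.HasAntidiagonal.antidiagonal d,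
      (MvPowerSeries.coeff x.1 X) (toLog (MvPowerSeries.coeff x.2 h)) =
    toLog (MvPowerSeries.coeff d (O h))

namespace Represents

variable {X Y : MvPowerSeries (Idx k m) (Module.End ℂ FunXLog)} {O P : FockOp k m}

theorem add (hX : Represents X O) (hY : Represents Y P) : Represents (X + Y) (O + P) := by
  intro h d
  simp only [map_add, LinearMap.add_apply, Finset.sum_add_distrib]
  rw [hX, hY]
  exact (map_add toLogHom _ _).symm

theorem zero : Represents (0 : MvPowerSeries (Idx k m) (Module.End ℂ FunXLog)) 0 := by
  intro h d
  simp only [map_zero, LinearMap.zero_apply, Finset.sum_const_zero]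
  exact (map_zero toLogHom).symm

theorem sum {ι : Type} (s : Finset ι)
    {X : ι → MvPowerSeries (Idx k m) (Module.End ℂ FunXLog)} {O : ι → FockOp k m}
    (h : ∀ i ∈ s, Represents (X i) (O i)) : Represents (∑ i ∈ s, X i) (∑ i ∈ s, O i) := by
  classical
  induction s using Finset.induction_on with
  | empty => simpa using zero
  | insert a s ha ih =>
    rw [Finset.sum_insert ha, Finset.sum_insert ha]
    exact (h a (Finset.mem_insert_self a s)).add (ih fun i hi => h i (Finset.mem_insert_of_mem hi))

theorem conv {F : ℕ → ℕ → MvPowerSeries (Idx k m) (Module.End ℂ FunXLog)}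
    {G : ℕ → ℕ → FockOp k m} (h : ∀ i j, Represents (F i j) (G i j)) (z : ℤ) :
    Represents (conv F z) (conv G z) := by
  unfold EBTH.conv
  split_ifs
  · exact sum _ fun x _ => h _ _
  · exact zero

/-- The coefficients of `P h` again contain no logarithm, so the condition on `X` may be applied to
`P h`. What remains is the reassociation of a sum over triples. -/
theorem mul (hX : Represents X O) (hY : Represents Y P) : Represents (X * Y) (O * P) := by
  classical
  unfold Represents at hX hY ⊢
  intro h d
  rw [Module.End.mul_apply, ← hX]
  simp only [← hY h, map_sum, MvPowerSeries.coeff_mul, LinearMap.sum_apply, Module.End.mul_apply,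
    Finset.sum_sigma']
  refine Finset.sum_nbij' (fun x => ⟨(x.2.1, x.2.2 + x.1.2), (x.2.2, x.1.2)⟩)
    (fun x => ⟨(x.1.1 + x.2.1, x.2.2), (x.1.1, x.2.1)⟩) ?_ ?_ ?_ ?_ ?_
  · rintro ⟨⟨i, j⟩, ⟨k, l⟩⟩ h
    simp only [Finset.mem_sigma, Finset.HasAntidiagonal.mem_antidiagonal] at h ⊢
    rw [← h.1, ← h.2, add_assoc]; exact ⟨rfl, trivial⟩
  · rintro ⟨⟨i, j⟩, ⟨k, l⟩⟩ h
    simp only [Finset.mem_sigma, Finset.HasAntidiagonal.mem_antidiagonal] at h ⊢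
    rw [← h.1, ← h.2, add_assoc]; exact ⟨rfl, trivial⟩
  · rintro ⟨⟨i, j⟩, ⟨k, l⟩⟩ h
    simp only [Finset.mem_sigma, Finset.HasAntidiagonal.mem_antidiagonal] at h
    obtain ⟨-, rfl⟩ := h
    rfl
  · rintro ⟨⟨i, j⟩, ⟨k, l⟩⟩ h
    simp only [Finset.mem_sigma, Finset.HasAntidiagonal.mem_antidiagonal] at h
    obtain ⟨-, rfl⟩ := h
    rfl
  · rintro ⟨⟨i, j⟩, ⟨k, l⟩⟩ h
    rfl

theorem liftX {T : Module.End ℂ FunXLog} {T₀ : Module.End ℂ FunX}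
    (h : ∀ f, T (toLog f) = toLog (T₀ f)) : Represents (MvPowerSeries.C T : MvPowerSeries (Idx k m) (Module.End ℂ FunXLog))
      (EBTH.liftX T₀) := by
  classical
  intro f d
  rw [Finset.sum_eq_single (0, d)]
  · rw [MvPowerSeries.coeff_C, if_pos rfl, h]; rfl
  · rintro ⟨a, b⟩ hx hne
    rw [MvPowerSeries.coeff_C, if_neg]
    · rfl
    · rintro rfl
      have := Finset.HasAntidiagonal.mem_antidiagonal.1 hx
      simp only [zero_add] at this
      exact hne (by rw [this])
  · intro h
    exact absurd (Finset.HasAntidiagonal.mem_antidiagonal.2 (zero_add d)) h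

end Represents

/-- A formal function, as a series of multiplication operators. -/
def mulSeries (a : Fock k m) : MvPowerSeries (Idx k m) (Module.End ℂ FunXLog) :=
  fun d => mulLog (toLog (MvPowerSeries.coeff d a))

theorem represents_mulOp (a : Fock k m) : Represents (mulSeries a) (mulOp a) := by
  classical
  intro h d
  change _ = toLogHom (MvPowerSeries.coeff d (a * h))
  rw [MvPowerSeries.coeff_mul, map_sum]
  exact Finset.sum_congr rfl fun x _ => (map_mul toLogHom _ _).symm

/-- The coefficient of `w ^ J` of a series in the variables `q` and in `w`. -/
def coeffLam (J : ℤ) : MvPowerSeries (Idx k m) LamOp →+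
    MvPowerSeries (Idx k m) (Module.End ℂ FunXLog) where
  toFun X := fun d => (MvPowerSeries.coeff d X).coeff J
  map_zero' := by
    refine MvPowerSeries.ext fun d => ?_
    change (MvPowerSeries.coeff d (0 : MvPowerSeries (Idx k m) LamOp)).coeff J = 0
    rw [map_zero]; rfl
  map_add' X Y := by
    refine MvPowerSeries.ext fun d => ?_
    change (MvPowerSeries.coeff d (X + Y)).coeff J =
      (MvPowerSeries.coeff d X).coeff J + (MvPowerSeries.coeff d Y).coeff J
    rw [map_add]; rfl

theorem coeffLam_seriesOf_mul (G G' : ℕ → Fock k m) (e : ℤ) (T : Module.End ℂ FunXLog) (J : ℤ) :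
    coeffLam J (seriesOf G * MvPowerSeries.C (HahnSeries.single e T : LamOp) * seriesOf G') =
      conv (fun i j => mulSeries (G i) * MvPowerSeries.C T * mulSeries (G' j)) (J - e) := by
  classical
  refine MvPowerSeries.ext fun d => ?_
  have h := map_conv (MvPowerSeries.coeff d (R := Module.End ℂ FunXLog)).toAddMonoidHom
    (fun i j => mulSeries (G i) * MvPowerSeries.C T * mulSeries (G' j)) (J - e)
  simp only [LinearMap.toAddMonoidHom_coe] at h
  rw [h]
  change (MvPowerSeries.coeff d (seriesOf G * MvPowerSeries.C (HahnSeries.single e T : LamOp) *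
    seriesOf G')).coeff J = _
  simp only [MvPowerSeries.coeff_mul _ (_ * _), MvPowerSeries.coeff_mul_C, conv_sum]
  rw [HahnSeries.coeff_sum]
  refine Finset.sum_congr rfl fun x _ => ?_
  exact coeff_ofPowerSeries_mul _ _ e T J

/-- The form of the HQE after the exponentials have cancelled: functions without logarithms around
one operator `T`. Each coefficient in `w` is then a genuine operator on the Fock space. -/
theorem represents_coeffLam (G G' : ℕ → Fock k m) (e : ℤ) {T : Module.End ℂ FunXLog}
    {O : FockOp k m} (h : Represents (MvPowerSeries.C T) O) (J : ℤ) :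
    Represents
      (coeffLam J (seriesOf G * MvPowerSeries.C (HahnSeries.single e T : LamOp) * seriesOf G'))
      (conv (fun i j => mulOp (G i) * O * mulOp (G' j)) (J - e)) := by
  rw [coeffLam_seriesOf_mul]
  exact Represents.conv (fun i j => ((represents_mulOp _).mul h).mul (represents_mulOp _)) _

end

/-! ## Commutation of series -/

section Commute

variable {R : Type} [Ring R]

theorem commute_of_coeff {X Y : HahnSeries ℤ R}
    (h : ∀ i j, Commute (X.coeff i) (Y.coeff j)) : Commute X Y := by
  ext n
  rw [HahnSeries.coeff_mul, HahnSeries.coeff_mul]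
  refine Finset.sum_nbij' Prod.swap Prod.swap ?_ ?_ (fun _ _ => rfl) (fun _ _ => rfl)
    fun x _ => h _ _
  all_goals
    rintro ⟨i, j⟩ hx
    simp only [Finset.mem_antidiagonal, Prod.swap] at hx ⊢
    exact ⟨hx.2.1, hx.1, by rw [add_comm]; exact hx.2.2⟩

theorem commute_of_mvCoeff {σ : Type} {X Y : MvPowerSeries σ R}
    (h : ∀ d e, Commute (MvPowerSeries.coeff d X) (MvPowerSeries.coeff e Y)) : Commute X Y := by
  classical
  refine MvPowerSeries.ext fun n => ?_
  rw [MvPowerSeries.coeff_mul, MvPowerSeries.coeff_mul,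
    ← Finset.HasAntidiagonal.map_swap_antidiagonal, Finset.sum_map,
    Finset.HasAntidiagonal.map_swap_antidiagonal]
  exact Finset.sum_congr rfl fun x _ => h _ _

theorem commute_C_left {σ : Type} {r : R} {X : MvPowerSeries σ R}
    (h : ∀ d, Commute r (MvPowerSeries.coeff d X)) : Commute (MvPowerSeries.C r) X := by
  refine MvPowerSeries.ext fun n => ?_
  rw [MvPowerSeries.coeff_C_mul, MvPowerSeries.coeff_mul_C, (h n).eq]

theorem commute_C_C {σ : Type} {r s : R} (h : Commute r s) :
    Commute (MvPowerSeries.C r : MvPowerSeries σ R) (MvPowerSeries.C s) := by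
  rw [Commute, SemiconjBy, ← map_mul, ← map_mul, h.eq]

end Commute

/-! ## Linear forms -/

section LinearForm

variable {σ R : Type} [Ring R]

open Classical in
/-- The linear form `∑ c_p q_p`. -/
def linearForm (c : σ → R) : MvPowerSeries σ R :=
  fun d => ∑ᶠ p : σ, if d = Finsupp.single p 1 then c p else 0

open Classical in
theorem coeff_linearForm (c : σ → R) (d : σ →₀ ℕ) :
    MvPowerSeries.coeff d (linearForm c) =
      ∑ᶠ p, if d = Finsupp.single p 1 then c p else 0 := rfl

theorem coeff_linearForm_single (c : σ → R) (p : σ) :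
    MvPowerSeries.coeff (Finsupp.single p 1) (linearForm c) = c p := by
  classical
  rw [coeff_linearForm, finsum_eq_single _ p, if_pos rfl]
  intro q hq
  rw [if_neg]
  intro h
  exact hq ((Finsupp.single_left_injective one_ne_zero h).symm)

theorem coeff_linearForm_of_ne (c : σ → R) (d : σ →₀ ℕ)
    (h : ∀ p, d ≠ Finsupp.single p 1) : MvPowerSeries.coeff d (linearForm c) = 0 := by
  classical
  rw [coeff_linearForm]
  exact (finsum_congr fun p => if_neg (h p)).trans finsum_zero

theorem constantCoeff_linearForm (c : σ → R) :
    MvPowerSeries.constantCoeff (linearForm c) = 0 :=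
  coeff_linearForm_of_ne c 0 fun _ => (Finsupp.single_ne_zero.2 one_ne_zero).symm

theorem linearForm_neg (c : σ → R) : linearForm (fun p => -c p) = -linearForm c := by
  classical
  refine MvPowerSeries.ext fun d => ?_
  rw [map_neg]
  by_cases hd : ∃ p, d = Finsupp.single p 1
  · obtain ⟨p, rfl⟩ := hd
    rw [coeff_linearForm_single, coeff_linearForm_single]
  · have hd' : ∀ p, d ≠ Finsupp.single p 1 := by simpa using hd
    rw [coeff_linearForm_of_ne _ d hd', coeff_linearForm_of_ne _ d hd', neg_zero]

theorem pd_linearForm (c : σ → R) (p : σ) :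
    pd p (linearForm c) = MvPowerSeries.C (c p) := by
  classical
  refine MvPowerSeries.ext fun d => ?_
  rw [coeff_pd, MvPowerSeries.coeff_C]
  split_ifs with hd
  · rw [hd, zero_add, coeff_linearForm_single]
    simp
  · rw [coeff_linearForm_of_ne, smul_zero]
    intro q h
    refine hd ?_
    have hq : q = p := by
      by_contra hq
      have := DFunLike.congr_fun h p
      simp [hq] at this
    rw [hq] at h
    simpa using h

theorem commute_linearForm {c : σ → R} {X : MvPowerSeries σ R}
    (h : ∀ p d, Commute (c p) (MvPowerSeries.coeff d X)) : Commute (linearForm c) X := by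
  classical
  refine commute_of_mvCoeff fun d e => ?_
  by_cases hd : ∃ p, d = Finsupp.single p 1
  · obtain ⟨p, rfl⟩ := hd
    rw [coeff_linearForm_single]; exact h p e
  · rw [coeff_linearForm_of_ne c d (by simpa using hd)]; exact Commute.zero_left _

theorem commute_linearForm_C {c : σ → R} {r : R} (h : ∀ p, Commute (c p) r) :
    Commute (linearForm c) (MvPowerSeries.C r) := by
  classical
  refine commute_linearForm fun p d => ?_
  rw [MvPowerSeries.coeff_C]
  split_ifs
  · exact h p
  · exact Commute.zero_right _

theorem commute_C_linearForm_self {c : σ → R} (h : ∀ p q, Commute (c p) (c q)) (p : σ) :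
    Commute (pd p (linearForm c)) (linearForm c) := by
  rw [pd_linearForm]
  exact (commute_linearForm_C fun q => h q p).symm

variable [Algebra ℂ R]

/-- The product of two vertex operators at equal arguments. -/
theorem vertex_product {c φ : σ → R} {E E' g : R} {S S' : MvPowerSeries σ R}
    (hE : E * E' = 1) (hcc : ∀ p q, Commute (c p) (c q)) (hφφ : ∀ p q, Commute (φ p) (φ q))
    (hcS : ∀ p d, Commute (c p) (MvPowerSeries.coeff d S)) (hcE' : ∀ p, Commute (c p) E')
    (hcg : ∀ p, Commute (c p) g) (hE'S : ∀ d, Commute E' (MvPowerSeries.coeff d S)) :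
    (MvPowerSeries.C E * MvPowerSeries.C 1 * expMv (linearForm c) * S * expMv (linearForm φ)) *
      (expMv (-linearForm φ) * (MvPowerSeries.C E' * MvPowerSeries.C g *
        expMv (-linearForm c) * S')) = S * MvPowerSeries.C g * S' := by
  have hc0 := constantCoeff_linearForm c
  have h1 := expMv_mul_expMv_neg (constantCoeff_linearForm φ) (commute_C_linearForm_self hφφ)
  have h2 := expMv_mul_expMv_neg hc0 (commute_C_linearForm_self hcc)
  have h3 : Commute S (expMv (linearForm c)) := commute_expMv hc0 (commute_linearForm hcS).symm
  have h4 : Commute (MvPowerSeries.C E') (expMv (linearForm c)) :=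
    commute_expMv hc0 (commute_linearForm_C hcE').symm
  have h5 : Commute (MvPowerSeries.C g) (expMv (linearForm c)) :=
    commute_expMv hc0 (commute_linearForm_C hcg).symm
  have h6 : Commute (MvPowerSeries.C E') S := commute_C_left hE'S
  have h7 : (MvPowerSeries.C E : MvPowerSeries σ R) * MvPowerSeries.C E' = 1 := by
    rw [← map_mul, hE, map_one]
  generalize (MvPowerSeries.C E : MvPowerSeries σ R) = E at *
  generalize (MvPowerSeries.C E' : MvPowerSeries σ R) = E' at *
  generalize (MvPowerSeries.C g : MvPowerSeries σ R) = g at *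
  generalize expMv (linearForm c) = y at *
  generalize expMv (-linearForm c) = y' at *
  generalize expMv (linearForm φ) = e at *
  generalize expMv (-linearForm φ) = e' at *
  rw [map_one, mul_one]
  -- The factors `e` and `e'` must cancel first, being adjacent: in the application they contain
  -- `∂_x` and commute neither with `S` nor with `E'`. The remaining factors can then be moved past
  -- each other.
  calc E * y * S * e * (e' * (E' * g * y' * S')) = E * y * S * (e * e') * E' * g * y' * S' := by
        simp only [mul_assoc]
    _ = E * (y * (S * E')) * g * y' * S' := by rw [h1]; simp only [mul_assoc, one_mul]
    _ = (E * E') * S * (y * g) * y' * S' := by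
        rw [← h6.eq, ← mul_assoc y, ← h4.eq, mul_assoc E', ← h3.eq]
        simp only [mul_assoc]
    _ = S * g * (y * y') * S' := by rw [h7, ← h5.eq]; simp only [mul_assoc, one_mul]
    _ = S * g * S' := by rw [h2, mul_one]

/-- The product of two vertex operators at equal arguments, the first one being differentiated. -/
theorem pd_vertex_product {c φ ψ : σ → R} {E E' g : R} {S S' : MvPowerSeries σ R}
    (hE : E * E' = 1) (hcc : ∀ p q, Commute (c p) (c q)) (hφφ : ∀ p q, Commute (φ p) (φ q))
    (hcS : ∀ p d, Commute (c p) (MvPowerSeries.coeff d S)) (hcE : ∀ p, Commute (c p) E)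
    (hcE' : ∀ p, Commute (c p) E')
    (hcg : ∀ p, Commute (c p) g) (hE'S : ∀ d, Commute E' (MvPowerSeries.coeff d S))
    (hE'S' : ∀ p d, Commute E' (MvPowerSeries.coeff d (pd p S)))
    (hcS' : ∀ p q d, Commute (c p) (MvPowerSeries.coeff d (pd q S)))
    (hcφ : ∀ p q, Commute (c p) (φ q)) (hcψ : ∀ p q, Commute (c p) (ψ q))
    (hφE : ∀ p, φ p * E' = E' * (φ p + ψ p)) (p : σ) :
    pd p (MvPowerSeries.C E * MvPowerSeries.C 1 * expMv (linearForm c) * S *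
        expMv (linearForm φ)) *
      (expMv (-linearForm φ) * (MvPowerSeries.C E' * MvPowerSeries.C g *
        expMv (-linearForm c) * S')) =
      pd p S * MvPowerSeries.C g * S' +
        S * MvPowerSeries.C ((c p + (φ p + ψ p)) * g) * S' := by
  have hy : pd p (expMv (linearForm c)) = MvPowerSeries.C (c p) * expMv (linearForm c) := by
    rw [pd_expMv p (constantCoeff_linearForm c) (commute_C_linearForm_self hcc p), pd_linearForm]
  have he : pd p (expMv (linearForm φ)) = MvPowerSeries.C (φ p) * expMv (linearForm φ) := by
    rw [pd_expMv p (constantCoeff_linearForm φ) (commute_C_linearForm_self hφφ p), pd_linearForm]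
  -- Leibniz's rule gives three terms: the derivative falls on `expMv (linearForm c)`, on `S` or on
  -- `expMv (linearForm φ)`. Each is an instance of `vertex_product` with a changed `S` or `g`, once
  -- the factor brought down is moved into the slot of `g`.
  have a1 := vertex_product (S := S) (S' := S') (g := c p * g) hE hcc hφφ hcS hcE'
    (fun q => (hcc q p).mul_right (hcg q)) hE'S
  have a2 := vertex_product (S := pd p S) (S' := S') (g := g) hE hcc hφφ (fun q => hcS' q p) hcE'
    hcg (hE'S' p)
  have a3 := vertex_product (S := S) (S' := S') (g := (φ p + ψ p) * g) hE hcc hφφ hcS hcE'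
    (fun q => ((hcφ q p).add_right (hcψ q p)).mul_right (hcg q)) hE'S
  have b1 : Commute (MvPowerSeries.C (c p)) S := commute_C_left (hcS p)
  have b2 : Commute (MvPowerSeries.C (c p) : MvPowerSeries σ R) (MvPowerSeries.C E) :=
    commute_C_C (hcE p)
  have b3 : Commute (MvPowerSeries.C (c p) : MvPowerSeries σ R) (MvPowerSeries.C E') :=
    commute_C_C (hcE' p)
  have b4 : Commute (MvPowerSeries.C (φ p)) (expMv (linearForm φ)) :=
    commute_expMv (constantCoeff_linearForm φ)
      (by rw [← pd_linearForm]; exact commute_C_linearForm_self hφφ p)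
  have b4' : Commute (MvPowerSeries.C (φ p)) (expMv (-linearForm φ)) :=
    commute_expMv (by rw [map_neg, constantCoeff_linearForm, neg_zero])
      (by rw [← pd_linearForm]; exact (commute_C_linearForm_self hφφ p).neg_right)
  -- The only obstacle on the way of `φ p` to the slot of `g`: passing `E'` creates the extra
  -- summand `ψ p`.
  have b5 : (MvPowerSeries.C (φ p) : MvPowerSeries σ R) * MvPowerSeries.C E' =
      MvPowerSeries.C E' * MvPowerSeries.C (φ p + ψ p) := by
    rw [← map_mul, ← map_mul, hφE]
  have b6 : Commute (MvPowerSeries.C (c p)) (expMv (linearForm φ)) :=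
    commute_expMv (constantCoeff_linearForm φ) (commute_linearForm_C fun q => (hcφ p q).symm).symm
  have b7 : Commute (MvPowerSeries.C (c p)) (expMv (-linearForm φ)) :=
    commute_expMv (by rw [map_neg, constantCoeff_linearForm, neg_zero])
      (commute_linearForm_C fun q => (hcφ p q).symm).symm.neg_right
  have b8 : Commute (MvPowerSeries.C (c p)) (expMv (linearForm c)) :=
    commute_expMv (constantCoeff_linearForm c) (commute_linearForm_C fun q => hcc q p).symm
  rw [pd_mul, pd_mul, pd_mul, pd_mul, pd_C, pd_C, hy, he, add_mul (c p), map_add, mul_add S,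
    add_mul (S * _), ← a1, ← a2, ← a3, map_mul _ (c p) g, map_mul _ (φ p + ψ p) g]
  generalize (MvPowerSeries.C (c p) : MvPowerSeries σ R) = cp at *
  generalize (MvPowerSeries.C (φ p) : MvPowerSeries σ R) = fp at *
  generalize (MvPowerSeries.C (φ p + ψ p) : MvPowerSeries σ R) = fq at *
  generalize (MvPowerSeries.C E : MvPowerSeries σ R) = E at *
  generalize (MvPowerSeries.C E' : MvPowerSeries σ R) = E' at *
  generalize (MvPowerSeries.C g : MvPowerSeries σ R) = g at *
  generalize expMv (linearForm c) = y at *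
  generalize expMv (-linearForm c) = y' at *
  generalize expMv (linearForm φ) = e at *
  generalize expMv (-linearForm φ) = e' at *
  generalize pd p S = S₁ at *
  simp only [map_one, mul_one, zero_mul, mul_zero, zero_add]
  have e1 : E * y * S * e * (e' * (E' * (cp * g) * y' * S')) =
      E * (cp * y) * S * e * (e' * (E' * g * y' * S')) := by
    calc _ = E * y * S * e * (e' * (E' * cp)) * g * y' * S' := by simp only [mul_assoc]
      _ = E * y * S * (e * (e' * cp)) * E' * g * y' * S' := by rw [← b3.eq]; simp only [mul_assoc]
      _ = E * y * (S * cp) * e * e' * E' * g * y' * S' := by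
          rw [← b7.eq, ← mul_assoc e, ← b6.eq]; simp only [mul_assoc]
      _ = E * (y * cp) * S * e * e' * E' * g * y' * S' := by rw [← b1.eq]; simp only [mul_assoc]
      _ = _ := by rw [← b8.eq]; simp only [mul_assoc]
  have e3 : E * y * S * e * (e' * (E' * (fq * g) * y' * S')) =
      E * y * S * (fp * e) * (e' * (E' * g * y' * S')) := by
    calc _ = E * y * S * e * (e' * (E' * fq)) * g * y' * S' := by simp only [mul_assoc]
      _ = E * y * S * (e * (e' * fp)) * E' * g * y' * S' := by rw [← b5]; simp only [mul_assoc]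
      _ = E * y * S * (fp * e) * e' * E' * g * y' * S' := by
          rw [← b4'.eq, ← mul_assoc e, ← b4.eq]; simp only [mul_assoc]
      _ = _ := by simp only [mul_assoc]
  rw [e1, e3]
  simp only [add_mul]
  abel

end LinearForm

/-! ## The exponentials `exp (ρ u)` -/

theorem mk_exp_eq (ρ : ℂ[X]) :
    (PowerSeries.mk fun n => C (n.factorial : ℂ)⁻¹ * ρ ^ n : PowerSeries ℂ[X]) =
    PowerSeries.rescale ρ (PowerSeries.exp ℂ[X]) := by
  ext1 n
  rw [PowerSeries.coeff_mk, PowerSeries.coeff_rescale, PowerSeries.coeff_exp, mul_comm]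
  congr 1
  rw [IsScalarTower.algebraMap_apply ℚ ℂ ℂ[X]]
  simp

theorem rescale_exp_neg_mul (ρ : ℂ[X]) :
    PowerSeries.rescale (-ρ) (PowerSeries.exp ℂ[X]) *
      PowerSeries.rescale ρ (PowerSeries.exp ℂ[X]) = 1 := by
  rw [PowerSeries.exp_mul_exp_eq_exp_add, neg_add_cancel]
  simp

theorem logUExp_neg_mul (ρ : ℂ[X]) : LogU.exp (-ρ) * LogU.exp ρ = 1 := by
  rw [LogU.exp, LogU.exp, mk_exp_eq, mk_exp_eq]
  exact rescale_exp_neg_mul ρ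

theorem derivative_mk_exp (ρ : ℂ[X]) :
    PowerSeries.derivative ℂ[X] (PowerSeries.mk fun n => C (n.factorial : ℂ)⁻¹ * ρ ^ n) =
    PowerSeries.C ρ * PowerSeries.mk fun n => C (n.factorial : ℂ)⁻¹ * ρ ^ n := by
  ext1 n
  rw [PowerSeries.coeff_derivative, PowerSeries.coeff_C_mul, PowerSeries.coeff_mk,
    PowerSeries.coeff_mk]
  have h : C ((n + 1).factorial : ℂ)⁻¹ * ((n : ℂ[X]) + 1) = C (n.factorial : ℂ)⁻¹ := by
    rw [← Nat.cast_add_one, ← C_eq_natCast, ← C_mul, Nat.factorial_succ]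
    congr 1
    have := Nat.cast_ne_zero (R := ℂ).2 n.factorial_ne_zero
    have := Nat.cast_ne_zero (R := ℂ).2 n.succ_ne_zero
    push_cast at *
    field_simp
  rw [← h]
  ring

theorem derivU_logUExp (ρ : ℂ[X]) : derivU (LogU.exp ρ) = LogU.const ρ * LogU.exp ρ :=
  derivative_mk_exp ρ

theorem derivative_mul {A : Type} [CommRing A] (f g : PowerSeries A) :
    PowerSeries.derivative A (f * g) =
      PowerSeries.derivative A f * g + f * PowerSeries.derivative A g := by
  rw [Derivation.leibniz, smul_eq_mul, smul_eq_mul]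
  ring

theorem derivU_mul (f g : LogU) : derivU (f * g) = derivU f * g + f * derivU g :=
  derivative_mul f g

theorem derivU_const (ρ : ℂ[X]) : derivU (LogU.const ρ) = 0 :=
  PowerSeries.derivative_C

theorem Eps.coeff_const_mul {M : Type} [CommRing M] (a : M) (f : Eps M) (n : ℤ) :
    (Eps.const a * f).coeff n = a * f.coeff n :=
  HahnSeries.coeff_single_zero_mul (Γ := ℤ) (R := M)

theorem coeff_derivXLog (f : FunXLog) (n : ℤ) :
    (derivXLog f).coeff n = derivU (f.coeff (n + 1)) := Eps.coeff_epsInv_mul _ _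

theorem derivXLog_const_mul (a : LogU) (f : FunXLog) :
    derivXLog (Eps.const a * f) =
      Eps.const a * derivXLog f + Eps.epsInv * Eps.const (derivU a) * f := by
  refine Eps.ext fun n => ?_
  rw [Eps.coeff_add, coeff_derivXLog, Eps.coeff_const_mul, Eps.coeff_const_mul, coeff_derivXLog,
    mul_assoc, Eps.coeff_epsInv_mul, Eps.coeff_const_mul, derivU_mul, add_comm]

theorem derivXLog_epsInv_mul (f : FunXLog) :
    derivXLog (Eps.epsInv * f) = Eps.epsInv * derivXLog f := by
  refine Eps.ext fun n => ?_
  rw [coeff_derivXLog, Eps.coeff_epsInv_mul, Eps.coeff_epsInv_mul, coeff_derivXLog]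

/-- Since u = (q_0^k + x)/ε, conjugation by exp(ρu) turns ∂_x into ∂_x + ρ/ε. As ρ is linear in log
λ, this is what later removes the logarithms from the flows. -/
theorem derivXLog_mul_mulLog_exp (ρ : ℂ[X]) :
    derivXLog * mulLog (Eps.const (LogU.exp ρ)) = mulLog (Eps.const (LogU.exp ρ)) *
      (derivXLog + mulLog (Eps.epsInv * Eps.const (LogU.const ρ))) := by
  refine LinearMap.ext fun f => ?_
  change derivXLog (Eps.const (LogU.exp ρ) * f) = Eps.const (LogU.exp ρ) *
    (derivXLog f + Eps.epsInv * Eps.const (LogU.const ρ) * f)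
  rw [derivXLog_const_mul, derivU_logUExp, map_mul]
  ring

theorem derivXLog_const_const_mul (g : ℂ[X]) (f : FunXLog) :
    derivXLog (Eps.const (LogU.const g) * f) = Eps.const (LogU.const g) * derivXLog f := by
  refine Eps.ext fun n => ?_
  rw [coeff_derivXLog, Eps.coeff_const_mul, Eps.coeff_const_mul, coeff_derivXLog, derivU_mul,
    derivU_const, zero_mul, zero_add]

theorem commute_derivXLog_mulLog_const (g : ℂ[X]) :
    Commute derivXLog (mulLog (Eps.const (LogU.const g))) :=
  LinearMap.ext (derivXLog_const_const_mul g)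

theorem commute_derivXLog_epsInv : Commute derivXLog (mulLog Eps.epsInv) :=
  LinearMap.ext derivXLog_epsInv_mul

theorem commute_derivXLog (g : ℂ[X]) :
    Commute derivXLog (mulLog (Eps.const (LogU.const g)) * mulLog Eps.epsInv) :=
  (commute_derivXLog_mulLog_const g).mul_right commute_derivXLog_epsInv

/-! ### The Hirota products at coinciding arguments. -/

section

variable {k m : ℕ}

/-! ## Multiplication operators -/

/-- All coefficients of the series are multiplication operators. -/
def IsMult (x : LamOp) : Prop := ∀ i, ∃ g, x.coeff i = mulLog g

theorem mulLog_mul (f g : FunXLog) : mulLog f * mulLog g = mulLog (f * g) :=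
  LinearMap.ext fun h => (mul_assoc f g h).symm

theorem mulLog_zero : mulLog 0 = 0 := LinearMap.ext fun h => zero_mul h

theorem mulLog_one : mulLog 1 = 1 := LinearMap.ext fun h => one_mul h

theorem commute_mulLog (f g : FunXLog) : Commute (mulLog f) (mulLog g) := by
  rw [Commute, SemiconjBy, mulLog_mul, mulLog_mul, mul_comm]

theorem IsMult.commute {x y : LamOp} (hx : IsMult x) (hy : IsMult y) : Commute x y := by
  refine commute_of_coeff fun i j => ?_
  obtain ⟨f, hf⟩ := hx i
  obtain ⟨g, hg⟩ := hy j
  rw [hf, hg]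
  exact commute_mulLog f g

theorem IsMult.zero : IsMult 0 := fun _ => ⟨0, mulLog_zero.symm⟩

theorem IsMult.single (e : ℤ) (g : FunXLog) : IsMult (HahnSeries.single e (mulLog g)) := by
  intro i
  rw [HahnSeries.coeff_single]
  split_ifs
  · exact ⟨g, rfl⟩
  · exact ⟨0, mulLog_zero.symm⟩

theorem coeff_scalarOp_mul (g : LaurentSeries ℂ[X]) (T : Module.End ℂ FunXLog) (i : ℤ) :
    (scalarOp g * HahnSeries.C T : LamOp).coeff i =
      mulLog (Eps.const (LogU.const (g.coeff i))) * T :=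
  HahnSeries.coeff_mul_single_zero

theorem isMult_expLog (ρ : ℂ[X]) : IsMult (expLog ρ) := IsMult.single 0 _

theorem commute_lamPow (c : ℂ) (p : ℤ) (x : LamOp) : Commute (lamPow c p) x := by
  refine commute_of_coeff fun i j => ?_
  rw [lamPow, HahnSeries.coeff_single]
  split_ifs
  · exact Algebra.commutes c _
  · exact Commute.zero_left _

theorem isMult_ofPowerSeries {a : ℕ → Module.End ℂ FunXLog} (ha : ∀ j, ∃ g, a j = mulLog g) :
    IsMult (HahnSeries.ofPowerSeries ℤ _ (PowerSeries.mk a)) := by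
  intro z
  rw [coeff_ofPowerSeries]
  split_ifs
  · rw [PowerSeries.coeff_mk]; exact ha _
  · exact ⟨0, mulLog_zero.symm⟩

theorem isMult_coeff_seriesOf (G : ℕ → Fock k m) (d : Idx k m →₀ ℕ) :
    IsMult (MvPowerSeries.coeff d (seriesOf G)) :=
  isMult_ofPowerSeries fun _ => ⟨_, rfl⟩

/-! ## Differentiation of series of functions -/

theorem dq_idx (p : Idx k m) : dq p.1.1 p.1.2 =
    (MvPowerSeries.pderiv FunX p).toLinearMap.restrictScalars ℂ :=
  dif_pos p.2

theorem toLog_coeff_dq (p : Idx k m) (d : Idx k m →₀ ℕ) (f : Fock k m) :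
    toLog (MvPowerSeries.coeff d (dq p.1.1 p.1.2 f)) =
      (d p + 1) • toLog (MvPowerSeries.coeff (d + Finsupp.single p 1) f) := by
  rw [dq_idx]
  have h := congrArg toLogHom (MvPowerSeries.coeff_pderiv (R := FunX) (i := p) f d)
  rw [map_mul] at h
  refine h.trans ?_
  rw [mul_comm, nsmul_eq_mul]
  congr 1
  rw [map_add, map_natCast, map_one]
  push_cast
  rfl

theorem mulLog_nsmul (n : ℕ) (f : FunXLog) : mulLog (n • f) = n • mulLog f :=
  LinearMap.ext fun h => smul_mul_assoc n f h

theorem nsmul_ofPowerSeries_mk {R : Type} [Ring R] (n : ℕ) (a : ℕ → R) :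
    n • HahnSeries.ofPowerSeries ℤ R (PowerSeries.mk a) =
      HahnSeries.ofPowerSeries ℤ R (PowerSeries.mk fun j => n • a j) := by
  rw [← map_nsmul]
  congr 1

theorem pd_seriesOf (p : Idx k m) (G : ℕ → Fock k m) :
    pd p (seriesOf G) = seriesOf fun j => dq p.1.1 p.1.2 (G j) := by
  refine MvPowerSeries.ext fun d => ?_
  refine (nsmul_ofPowerSeries_mk (R := Module.End ℂ FunXLog) (d p + 1) _).trans ?_
  change _ = HahnSeries.ofPowerSeries ℤ (Module.End ℂ FunXLog) (PowerSeries.mk _)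
  congr 2
  funext j
  rw [toLog_coeff_dq]
  exact (mulLog_nsmul _ _).symm

/-! ## Products of vertex operators -/

/-- The coefficients of the linear form `f̂₋`. -/
def minusCoeff (f : LoopVec) (p : Idx k m) : LamOp :=
  -(scalarOp (lower k m f (-(p.1.1 : ℤ) - 1) p.1.2) * HahnSeries.C (mulLog Eps.epsInv))

/-- The coefficients of the linear form `∑_{n > 0} (λ^n / n!) q_n^k T`. -/
def phiCoeff (T : Module.End ℂ FunXLog) (p : Idx k m) : LamOp :=
  if p.1.2 = k then
    HahnSeries.single (-((k * m * p.1.1 : ℕ) : ℤ)) (((p.1.1.factorial : ℂ)⁻¹) • T)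
  else 0

theorem quantMinus_eq (f : LoopVec) :
    (quantMinus f : MvPowerSeries (Idx k m) LamOp) = linearForm (minusCoeff f) := rfl

theorem hahn_mul_neg {R : Type} [Ring R] (a b : HahnSeries ℤ R) : a * -b = -(a * b) := mul_neg a b

theorem lower_neg (f : LoopVec) (n : ℤ) (α : ℕ) : lower k m (-f) n α = -lower k m f n α := by
  rw [lower, lower, ← Finset.sum_neg_distrib]
  refine Finset.sum_congr rfl fun β _ => ?_
  have h : (-f) n β = -(f n β) := rfl
  rw [h]
  exact hahn_mul_neg _ _

theorem rho_neg (f : LoopVec) : rho k m (-f) = -rho k m f := by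
  rw [rho, rho, lower_neg]; rfl

theorem coeff_minusCoeff (f : LoopVec) (p : Idx k m) (i : ℤ) :
    (minusCoeff f p).coeff i = mulLog (Eps.const (LogU.const
      (-(lower k m f (-(p.1.1 : ℤ) - 1) p.1.2).coeff i)) * Eps.epsInv) := by
  refine (congrArg Neg.neg (coeff_scalarOp_mul (lower k m f (-(p.1.1 : ℤ) - 1) p.1.2)
    (mulLog Eps.epsInv) i)).trans ?_
  rw [mulLog_mul, map_neg, map_neg, neg_mul]
  exact LinearMap.ext fun h => (neg_mul _ h).symm

theorem minusCoeff_neg (f : LoopVec) (p : Idx k m) :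
    (minusCoeff (-f) p) = -(minusCoeff f p) := by
  ext1
  funext i
  refine (coeff_minusCoeff _ p i).trans (Eq.trans ?_
    (congrArg Neg.neg (coeff_minusCoeff f p i)).symm)
  rw [lower_neg]
  refine LinearMap.ext fun h => ?_
  change Eps.const (LogU.const (- -(lower k m f (-(p.1.1 : ℤ) - 1) p.1.2).coeff i)) *
    Eps.epsInv * h = -(Eps.const (LogU.const (-(lower k m f (-(p.1.1 : ℤ) - 1) p.1.2).coeff i)) *
    Eps.epsInv * h)
  rw [map_neg LogU.const (-_), map_neg, neg_mul, neg_mul]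

theorem quantMinus_neg (f : LoopVec) :
    (quantMinus (-f) : MvPowerSeries (Idx k m) LamOp) = -linearForm (minusCoeff f) := by
  rw [quantMinus_eq, ← linearForm_neg]
  congr 1
  funext p
  exact minusCoeff_neg f p

theorem isMult_minusCoeff (f : LoopVec) (p : Idx k m) : IsMult (minusCoeff f p) :=
  fun i => ⟨_, coeff_minusCoeff f p i⟩

theorem commute_minusCoeff_phiCoeff (f : LoopVec) (p q : Idx k m) :
    Commute (minusCoeff f p) (phiCoeff derivXLog q) := by
  refine commute_of_coeff fun i j => ?_
  rw [coeff_minusCoeff, ← mulLog_mul]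
  unfold phiCoeff
  split_ifs
  · rw [HahnSeries.coeff_single]
    split_ifs
    · exact ((commute_derivXLog _).symm).smul_right _
    · exact Commute.zero_right _
  · exact Commute.zero_right _

theorem smul_mulLog (c : ℂ) (g : FunXLog) : c • mulLog g = mulLog (c • g) :=
  LinearMap.ext fun h => (smul_mul_assoc c g h).symm

theorem isMult_phiCoeff (g : FunXLog) (p : Idx k m) : IsMult (phiCoeff (mulLog g) p) := by
  unfold phiCoeff
  split_ifs
  · rw [smul_mulLog]; exact IsMult.single _ _
  · exact IsMult.zero

theorem commute_single_single {R : Type} [Ring R] {a b : R} (h : Commute a b) (i j : ℤ) :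
    Commute (HahnSeries.single i a) (HahnSeries.single j b) := by
  rw [Commute, SemiconjBy, HahnSeries.single_mul_single, HahnSeries.single_mul_single, h.eq,
    add_comm]

theorem commute_phiCoeff (T : Module.End ℂ FunXLog) (p q : Idx k m) :
    Commute (phiCoeff T p) (phiCoeff T q) := by
  unfold phiCoeff
  by_cases hp : p.1.2 = k
  · by_cases hq : q.1.2 = k
    · rw [if_pos hp, if_pos hq]
      exact commute_single_single (((Commute.refl T).smul_left _).smul_right _) _ _
    · rw [if_neg hq]
      exact Commute.zero_right _
  · rw [if_neg hp]
    exact Commute.zero_left _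

theorem phiCoeff_mul_expLog (ρ : ℂ[X]) (p : Idx k m) :
    phiCoeff derivXLog p * expLog ρ = expLog ρ *
      (phiCoeff derivXLog p +
        phiCoeff (mulLog (Eps.epsInv * Eps.const (LogU.const ρ))) p) := by
  unfold phiCoeff expLog
  split_ifs
  · rw [← HahnSeries.single_add, ← smul_add]
    change HahnSeries.single _ _ * HahnSeries.single 0 _ =
      HahnSeries.single 0 _ * HahnSeries.single _ _
    rw [HahnSeries.single_mul_single, HahnSeries.single_mul_single, smul_mul_assoc, mul_smul_comm,
      add_zero, zero_add, derivXLog_mul_mulLog_exp]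
  · rw [add_zero, zero_mul, mul_zero]

theorem expLog_neg_mul (ρ : ℂ[X]) : expLog (-ρ) * expLog ρ = 1 := by
  rw [expLog, expLog, ← map_mul, mulLog_mul, ← map_mul, logUExp_neg_mul, map_one, mulLog_one,
    map_one]

/-- The functions `e ^ f̂₊ τ`, translated by `ε r`. -/
def plusPart (f : LoopVec) (r : ℤ) (τ : Fock k m) (j : ℕ) : Fock k m :=
  shift (r : ℂ) (expPlus f j τ)

/-- When the variables `q'` and `q''` coincide, the second factor carries the inverses of the linear
exponential, of exp(-ρu) and of the exponential of `∂_x`. Only the series e^{±f̂₊}τ and the scalar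
survive. -/
theorem vertexSharp_mul_vertexDelta (f : LoopVec) (r : ℤ) (c : ℂ) (q : ℤ) (τ : Fock k m) :
    vertexSharp f τ * vertexDelta (-f) r (lamPow c q) τ =
      seriesOf (plusPart f 0 τ) * MvPowerSeries.C (lamPow c q) *
        seriesOf (plusPart (-f) r τ) := by
  unfold vertexSharp vertexDelta vertex
  rw [quantMinus_neg, rho_neg, neg_neg]
  exact vertex_product (R := LamOp) (c := minusCoeff f) (φ := phiCoeff derivXLog)
    (E := expLog (-rho k m f)) (E' := expLog (rho k m f)) (g := lamPow c q)
    (S' := seriesOf (plusPart (-f) r τ)) (S := seriesOf (plusPart f 0 τ))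
    (expLog_neg_mul _) (fun p q => (isMult_minusCoeff f p).commute (isMult_minusCoeff f q))
    (commute_phiCoeff derivXLog)
    (fun p d => (isMult_minusCoeff f p).commute (isMult_coeff_seriesOf _ d))
    (fun p => (isMult_minusCoeff f p).commute (isMult_expLog _))
    (fun p => (commute_lamPow c q _).symm)
    (fun d => (isMult_expLog _).commute (isMult_coeff_seriesOf _ d))

/-- The coefficient of the first order term in the expansion of the Hirota equation. -/
def flowCoeff (f : LoopVec) (p : Idx k m) : LamOp :=
  minusCoeff f p + (phiCoeff derivXLog p +
    phiCoeff (mulLog (Eps.epsInv * Eps.const (LogU.const (rho k m f)))) p)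

theorem pd_vertexSharp_mul_vertexDelta (f : LoopVec) (r : ℤ) (c : ℂ) (q : ℤ) (τ : Fock k m)
    (p : Idx k m) :
    pd p (vertexSharp f τ) * vertexDelta (-f) r (lamPow c q) τ =
      seriesOf (fun j => dq p.1.1 p.1.2 (plusPart f 0 τ j)) * MvPowerSeries.C (lamPow c q) *
        seriesOf (plusPart (-f) r τ) +
      seriesOf (plusPart f 0 τ) * MvPowerSeries.C (flowCoeff f p * lamPow c q) *
        seriesOf (plusPart (-f) r τ) := by
  have h1 : ∀ q d, IsMult (MvPowerSeries.coeff d (pd q (seriesOf (plusPart f 0 τ)))) := by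
    intro q d
    rw [pd_seriesOf]
    exact isMult_coeff_seriesOf _ d
  have h0 : ∀ d, IsMult (MvPowerSeries.coeff d (seriesOf (plusPart f 0 τ))) :=
    isMult_coeff_seriesOf _
  have h3 : ∀ (p : Idx k m) d,
      Commute (minusCoeff f p) (MvPowerSeries.coeff d (seriesOf (plusPart f 0 τ))) :=
    fun p d => (isMult_minusCoeff f p).commute (h0 d)
  have h4 : ∀ (p q : Idx k m) d,
      Commute (minusCoeff f p) (MvPowerSeries.coeff d (pd q (seriesOf (plusPart f 0 τ)))) :=
    fun p q d => (isMult_minusCoeff f p).commute (h1 q d)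
  have h5 : ∀ d, Commute (expLog (rho k m f))
      (MvPowerSeries.coeff d (seriesOf (plusPart f 0 τ))) :=
    fun d => (isMult_expLog _).commute (h0 d)
  have h6 : ∀ (q : Idx k m) d, Commute (expLog (rho k m f))
      (MvPowerSeries.coeff d (pd q (seriesOf (plusPart f 0 τ)))) :=
    fun q d => (isMult_expLog _).commute (h1 q d)
  have h2 : ∀ p q : Idx k m, Commute (minusCoeff f p)
      (phiCoeff (mulLog (Eps.epsInv * Eps.const (LogU.const (rho k m f)))) q) :=
    fun p q => (isMult_minusCoeff f p).commute (isMult_phiCoeff _ q)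
  unfold vertexSharp vertexDelta vertex
  rw [quantMinus_neg, rho_neg, neg_neg, ← pd_seriesOf p (plusPart f 0 τ)]
  refine pd_vertex_product (R := LamOp) (c := minusCoeff f) (φ := phiCoeff derivXLog)
    (ψ := phiCoeff (mulLog (Eps.epsInv * Eps.const (LogU.const (rho k m f)))))
    (E := expLog (-rho k m f)) (E' := expLog (rho k m f)) (g := lamPow c q)
    (S' := seriesOf (plusPart (-f) r τ)) (S := seriesOf (plusPart f 0 τ))
    ?_ ?_ ?_ ?_ ?_ ?_ ?_ ?_ ?_ ?_ ?_ ?_ ?_ p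
  · exact expLog_neg_mul _
  · exact fun p q => (isMult_minusCoeff f p).commute (isMult_minusCoeff f q)
  · exact commute_phiCoeff derivXLog
  · exact h3
  · exact fun p => (isMult_minusCoeff f p).commute (isMult_expLog _)
  · exact fun p => (isMult_minusCoeff f p).commute (isMult_expLog _)
  · exact fun p => (commute_lamPow c q _).symm
  · exact h5
  · exact h6
  · exact h4
  · exact commute_minusCoeff_phiCoeff f
  · exact h2
  · exact phiCoeff_mul_expLog _

end

/-! ## Substitutions in power series -/

/-! ### The vertex exponents are the dressing exponents, with `ζ` a root of `λ`. -/

section Spread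

variable {R : Type} [Ring R] [Algebra ℂ R]

/-- The substitution of `χ w ^ c` for the variable, the powers of `χ` being given by `χ j`. -/
def spread (c : ℕ) (χ : ℕ → ℂ) (Y : PowerSeries R) : PowerSeries R :=
  PowerSeries.mk fun j => if c ∣ j then χ j • PowerSeries.coeff (j / c) Y else 0

theorem coeff_spread (c : ℕ) (χ : ℕ → ℂ) (Y : PowerSeries R) (j : ℕ) :
    PowerSeries.coeff j (spread c χ Y) = if c ∣ j then χ j • PowerSeries.coeff (j / c) Y else 0 :=
  PowerSeries.coeff_mk _ _

theorem coeff_mul_eq_conv {R : Type} [Ring R] (X Y : PowerSeries R) (j : ℕ) : PowerSeries.coeff j (X * Y) =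
    conv (fun a b => PowerSeries.coeff a X * PowerSeries.coeff b Y) (j : ℤ) := by
  rw [PowerSeries.coeff_mul, conv, if_pos (by positivity), Int.toNat_natCast]

theorem spread_mul {c : ℕ} (hc : 1 ≤ c) {χ : ℕ → ℂ} (hχ : ∀ a b, χ (a + b) = χ a * χ b)
    (X Y : PowerSeries R) : spread c χ (X * Y) = spread c χ X * spread c χ Y := by
  ext1 j
  rw [coeff_spread]
  split_ifs with hj
  · obtain ⟨j, rfl⟩ := hj
    rw [coeff_mul_eq_conv, coeff_mul_eq_conv, Nat.cast_mul, conv_mul hc, Nat.mul_div_cancel_left _ hc]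
    · refine (map_conv (DistribSMul.toAddMonoidHom R (χ (c * j))) _ _).trans ?_
      refine conv_congr fun a b hab => ?_
      rw [coeff_spread, coeff_spread, if_pos (dvd_mul_right c a), if_pos (dvd_mul_right c b),
        Nat.mul_div_cancel_left _ hc, Nat.mul_div_cancel_left _ hc, smul_mul_smul_comm, ← hχ,
        ← mul_add]
      have : a + b = j := by exact_mod_cast hab
      rw [this]; rfl
    · intro a b ha
      rw [coeff_spread, if_neg ha, zero_mul]
  · rw [PowerSeries.coeff_mul]
    symm
    refine Finset.sum_eq_zero fun x hx => ?_
    rw [coeff_spread, coeff_spread]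
    split_ifs with h1 h2
    · exact absurd (Finset.HasAntidiagonal.mem_antidiagonal.1 hx ▸ dvd_add h1 h2) hj
    · rw [mul_zero]
    · rw [zero_mul]
    · rw [zero_mul]

theorem spread_pow {c : ℕ} (hc : 1 ≤ c) {χ : ℕ → ℂ} (hχ : ∀ a b, χ (a + b) = χ a * χ b)
    (h0 : χ 0 = 1) (X : PowerSeries R) (n : ℕ) : spread c χ (X ^ n) = spread c χ X ^ n := by
  induction n with
  | zero =>
    rw [pow_zero, pow_zero]
    ext1 j
    rw [coeff_spread, PowerSeries.coeff_one, PowerSeries.coeff_one]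
    split_ifs with h1 h2 h3 h3 h4
    · rw [h3, h0, one_smul]
    · obtain ⟨a, rfl⟩ := h1
      rw [Nat.mul_div_cancel_left _ hc] at h2
      exact absurd (by rw [h2, mul_zero]) h3
    · subst h3; simp at h2
    · rw [smul_zero]
    · subst h4; exact absurd (dvd_zero c) h1
    · rfl
  | succ n ih => rw [pow_succ, pow_succ, spread_mul hc hχ, ih]

theorem coeff_ps_pow_eq_zero {R : Type} [Ring R] {Y : PowerSeries R} (hY : PowerSeries.coeff 0 Y = 0) (n j : ℕ)
    (hj : j < n) : PowerSeries.coeff j (Y ^ n) = 0 := by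
  induction n generalizing j with
  | zero => omega
  | succ n ih =>
    rw [pow_succ, PowerSeries.coeff_mul]
    refine Finset.sum_eq_zero fun x hx => ?_
    have h := Finset.HasAntidiagonal.mem_antidiagonal.1 hx
    rcases lt_or_ge x.1 n with h1 | h1
    · rw [ih _ h1, zero_mul]
    · have : x.2 = 0 := by omega
      rw [this, hY, mul_zero]

theorem coeff_expPS {Y : PowerSeries R} (hY : PowerSeries.coeff 0 Y = 0) {j N : ℕ} (hN : j < N) :
    PowerSeries.coeff j (expPS Y) =
      ∑ n ∈ Finset.range N, ((n.factorial : ℂ)⁻¹) • PowerSeries.coeff j (Y ^ n) := by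
  rw [expPS, PowerSeries.coeff_mk]
  refine Finset.sum_subset (Finset.range_mono hN) fun n _ hn => ?_
  rw [coeff_ps_pow_eq_zero hY n j (by simpa using hn), smul_zero]

theorem coeff_zero_expPS (Y : PowerSeries R) : PowerSeries.coeff 0 (expPS Y) = 1 := by
  rw [expPS, PowerSeries.coeff_mk]
  simp

/-- For multiplicative `χ` the substitution is a ring homomorphism, so it commutes with the
exponential. -/
theorem expPS_spread {c : ℕ} (hc : 1 ≤ c) {χ : ℕ → ℂ} (hχ : ∀ a b, χ (a + b) = χ a * χ b)
    (h0 : χ 0 = 1) {Y : PowerSeries R} (hY : PowerSeries.coeff 0 Y = 0) :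
    expPS (spread c χ Y) = spread c χ (expPS Y) := by
  ext1 j
  have hY' : PowerSeries.coeff 0 (spread c χ Y) = 0 := by
    rw [coeff_spread, if_pos (dvd_zero c), Nat.zero_div, hY, smul_zero]
  rw [coeff_expPS hY' (Nat.lt_succ_self j), coeff_spread]
  split_ifs with hj
  · rw [coeff_expPS hY (Nat.lt_succ_of_le (Nat.div_le_self j c)), Finset.smul_sum]
    refine Finset.sum_congr rfl fun n _ => ?_
    rw [← spread_pow hc hχ h0, coeff_spread, if_pos hj, smul_comm]
  · refine Finset.sum_eq_zero fun n _ => ?_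
    rw [← spread_pow hc hχ h0, coeff_spread, if_neg hj, smul_zero]

theorem spread_neg (c : ℕ) (χ : ℕ → ℂ) (Y : PowerSeries R) : spread c χ (-Y) = -spread c χ Y := by
  ext1 j
  rw [coeff_spread, map_neg, map_neg, coeff_spread]
  split_ifs
  · rw [smul_neg]
  · rw [neg_zero]

theorem neg_smul_alg (c : ℂ) (x : R) : (-c) • x = -(c • x) := neg_smul c x

end Spread

/-! ## Branches and falling factorials -/

theorem branch_add (k m i : ℕ) (p q : ℤ) :
    branch k m i (p + q) = branch k m i p * branch k m i q := by
  rw [branch, branch, branch, ← Complex.exp_add]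
  congr 1
  push_cast
  ring

theorem branch_zero (k m i : ℕ) : branch k m i 0 = 1 := by simp [branch]

/-- The factors by which the branches differ. -/
def branchNeg (k m i : ℕ) (j : ℕ) : ℂ := branch k m i (-(j : ℤ))

theorem branchNeg_add (k m i a b : ℕ) :
    branchNeg k m i (a + b) = branchNeg k m i a * branchNeg k m i b := by
  rw [branchNeg, branchNeg, branchNeg, ← branch_add]
  congr 1
  push_cast
  ring

theorem branchNeg_zero (k m i : ℕ) : branchNeg k m i 0 = 1 := branch_zero k m i

/-- Exponents divisible by `k * m` are integral powers of λ, on which all branches agree. -/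
theorem branch_mul {k m : ℕ} (hk : 1 ≤ k) (hm : 1 ≤ m) (i : ℕ) (z : ℤ) :
    branch k m i (k * m * z) = 1 := by
  rw [branch, Complex.exp_eq_one_iff]
  refine ⟨i * z, ?_⟩
  have h1 : (k : ℂ) ≠ 0 := Nat.cast_ne_zero.2 (by omega)
  have h2 : (m : ℂ) ≠ 0 := Nat.cast_ne_zero.2 (by omega)
  push_cast
  field_simp

theorem fall_natCast (q : ℂ) (n : ℕ) : fall q (n : ℤ) = ∏ l ∈ Finset.Icc 1 n, (q - l + 1) := rfl

/-- The factors q - l become l - q after the signs are distributed, and are then read in reverse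
order. This turns the coefficients (α/k - 1)_n of f^a into the (n - α/k)_n of the dressing
operators. -/
theorem neg_one_pow_mul_fall (q : ℂ) (n : ℕ) :
    (-1) ^ n * fall (q - 1) (n : ℤ) = fall ((n : ℂ) - q) (n : ℤ) := by
  rw [fall_natCast, fall_natCast]
  have h : ((-1 : ℂ)) ^ n = ∏ _l ∈ Finset.Icc 1 n, (-1) := by simp
  rw [h, ← Finset.prod_mul_distrib]
  refine Finset.prod_nbij' (fun l => n + 1 - l) (fun l => n + 1 - l) ?_ ?_ ?_ ?_ ?_
  · intro l hl; simp only [Finset.mem_Icc] at *; omega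
  · intro l hl; simp only [Finset.mem_Icc] at *; omega
  · intro l hl; simp only [Finset.mem_Icc] at *; omega
  · intro l hl; simp only [Finset.mem_Icc] at *; omega
  · intro l hl
    simp only [Finset.mem_Icc] at hl
    rw [Nat.cast_sub (by omega)]
    push_cast
    ring

/-! ## The components of the vectors `f_∞^a` and `f_∞^b` -/

theorem fInfA_lt {k α : ℕ} (m i : ℕ) (h1 : 1 ≤ α) (h2 : α < k) (n : ℤ) :
    fInfA k m i n α = HahnSeries.single (-(m * (α - (n + 1) * k) : ℤ))
      (C (fall ((α : ℂ) / k - 1) n * branch k m i (m * (α - (n + 1) * k)))) :=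
  if_pos ⟨h1, h2⟩

theorem fInfA_top (k m i n : ℕ) :
    fInfA k m i (n : ℤ) (k + m) = HahnSeries.single ((k * m * (n + 1) : ℕ) : ℤ)
      (C ((-1) ^ n * ((m : ℂ) / k) * n.factorial)) :=
  (if_neg (by omega)).trans (if_pos rfl)

theorem fInfA_top_neg (k m i n : ℕ) :
    fInfA k m i (-(n : ℤ) - 1) (k + m) = HahnSeries.single (-((k * m * n : ℕ) : ℤ))
      (C (((m : ℂ) / k) * (n.factorial : ℂ)⁻¹) * (logLam i - C (harm n))) := by
  have h : -(n : ℤ) - 1 = Int.negSucc n := by omega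
  rw [h]
  exact (if_neg (by omega)).trans (if_pos rfl)

theorem fInfA_eq_zero {k m α : ℕ} (i : ℕ) (n : ℤ) (h1 : ¬ (1 ≤ α ∧ α < k)) (h2 : α ≠ k + m) :
    fInfA k m i n α = 0 :=
  (if_neg h1).trans (if_neg h2)

theorem fInfB_mid {k m α : ℕ} (logQ : ℂ) (i : ℕ) (h1 : k ≤ α) (h2 : α < k + m) (n : ℤ) :
    fInfB k m logQ i n α =
      HahnSeries.single (-(k * (((k + m - α : ℕ) : ℤ) - (n + 1) * m) : ℤ))
      (-C (fall (((k + m - α : ℕ) : ℂ) / m - 1) n *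
        branch k m i (k * (((k + m - α : ℕ) : ℤ) - (n + 1) * m)))) :=
  if_pos ⟨h1, h2⟩

theorem fInfB_top (k : ℕ) {m : ℕ} (hm : 1 ≤ m) (logQ : ℂ) (i n : ℕ) :
    fInfB k m logQ i (n : ℤ) (k + m) = HahnSeries.single ((k * m * (n + 1) : ℕ) : ℤ)
      (-C ((-1) ^ n * (n.factorial : ℂ))) := by
  have h2 : (m : ℂ) ≠ 0 := Nat.cast_ne_zero.2 (by omega)
  have h : fInfB k m logQ i (n : ℤ) (k + m) = HahnSeries.single ((k * m * (n + 1) : ℕ) : ℤ)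
      (-C ((-1) ^ n * ((m : ℂ) / m) * n.factorial)) := (if_neg (by omega)).trans (if_pos rfl)
  rw [h, div_self h2, mul_one]

theorem fInfB_top_neg (k : ℕ) {m : ℕ} (hm : 1 ≤ m) (logQ : ℂ) (i n : ℕ) :
    fInfB k m logQ i (-(n : ℤ) - 1) (k + m) = HahnSeries.single (-((k * m * n : ℕ) : ℤ))
      (-(C (n.factorial : ℂ)⁻¹ * (logLam i - C (m * logQ) - C (harm n)))) := by
  have h2 : (m : ℂ) ≠ 0 := Nat.cast_ne_zero.2 (by omega)
  have h1 : -(n : ℤ) - 1 = Int.negSucc n := by omega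
  have h : fInfB k m logQ i (Int.negSucc n) (k + m) = HahnSeries.single (-((k * m * n : ℕ) : ℤ))
      (-(C (((m : ℂ) / m) * (n.factorial : ℂ)⁻¹) * (logLam i - C (m * logQ) - C (harm n)))) :=
    (if_neg (by omega)).trans (if_pos rfl)
  rw [h1, h, div_self h2, one_mul]

theorem fInfB_eq_zero {k m α : ℕ} (hm : 1 ≤ m) (logQ : ℂ) (i : ℕ) (n : ℤ) (h1 : α < k) :
    fInfB k m logQ i n α = 0 :=
  (if_neg (by omega)).trans (if_neg (by omega))

/-! ## The exponents of the vertex operators -/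

theorem finsum_subtype_eq_sum {ι V : Type} [AddCommMonoid V] (P : ι → Prop) [DecidablePred P]
    (G : ι → V) (s : Finset ι) (hs : ∀ x, P x → x ∉ s → G x = 0) :
    ∑ᶠ x : {x // P x}, G x = ∑ x ∈ s with P x, G x := by
  classical
  rw [finsum_eq_sum_of_support_subset (s := s.subtype P), Finset.sum_subtype_eq_sum_filter]
  intro x hx
  rw [Finset.mem_coe, Finset.mem_subtype]
  by_contra h
  exact hx (hs x x.2 h)

theorem finsum_idx {k m : ℕ} {V : Type} [AddCommMonoid V] (G : ℕ → ℕ → V) (N : ℕ)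
    (hG : ∀ n α, N < n → α ≤ k + m → G n α = 0) :
    ∑ᶠ p : Idx k m, G p.1.1 p.1.2 =
      ∑ n ∈ Finset.range (N + 1), ∑ α ∈ Finset.Icc 1 (k + m),
        if (n, α) = (0, k) then 0 else G n α := by
  classical
  refine (finsum_subtype_eq_sum (fun p : ℕ × ℕ => 1 ≤ p.2 ∧ p.2 ≤ k + m ∧ p ≠ (0, k))
    (fun p => G p.1 p.2) (Finset.range (N + 1) ×ˢ Finset.Icc 1 (k + m)) ?_).trans ?_
  · rintro ⟨n, α⟩ h h'
    refine hG n α ?_ h.2.1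
    by_contra hn
    exact h' (Finset.mem_product.2
      ⟨Finset.mem_range.2 (show n < N + 1 by omega), Finset.mem_Icc.2 ⟨h.1, h.2.1⟩⟩)
  rw [Finset.sum_filter, Finset.sum_product]
  refine Finset.sum_congr rfl fun n _ => Finset.sum_congr rfl fun α hα => ?_
  rw [Finset.mem_Icc] at hα
  by_cases h : (n, α) = (0, k)
  · rw [if_pos h, if_neg (by simp [h])]
  · rw [if_neg h, if_pos ⟨hα.1, hα.2, h⟩]

theorem sum_Icc_split {V : Type} [AddCommMonoid V] {k : ℕ} (hk : 1 ≤ k) (m : ℕ) (g : ℕ → V) :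
    ∑ α ∈ Finset.Icc 1 (k + m), g α =
      (∑ α ∈ Finset.Ico 1 k, g α + ∑ α ∈ Finset.Ico k (k + m), g α) + g (k + m) := by
  rw [Finset.sum_Ico_consecutive g hk (by omega), ← Finset.sum_Ico_succ_top (by omega)]
  rfl

theorem sum_Ico_reflect_top {V : Type} [AddCommMonoid V] (k m : ℕ) (g : ℕ → V) :
    ∑ α ∈ Finset.Ico k (k + m), g α = ∑ α ∈ Finset.Icc 1 m, g (k + m - α) := by
  refine Finset.sum_nbij' (fun α => k + m - α) (fun α => k + m - α) ?_ ?_ ?_ ?_ ?_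
  · intro l hl; simp only [Finset.mem_Icc, Finset.mem_Ico] at *; omega
  · intro l hl; simp only [Finset.mem_Icc, Finset.mem_Ico] at *; omega
  · intro l hl; simp only [Finset.mem_Ico] at *; omega
  · intro l hl; simp only [Finset.mem_Icc] at *; omega
  · intro l hl
    simp only [Finset.mem_Ico] at hl
    congr 1; omega

theorem coeff_quantPlus {k m : ℕ} (f : LoopVec) (j : ℕ) :
    PowerSeries.coeff j (quantPlus f : PowerSeries (FockOp k m)) = ∑ᶠ p : Idx k m,
      ((-1) ^ p.1.1 * ((f p.1.1 p.1.2).coeff j).coeff 0) • (epsOp * dq p.1.1 p.1.2) :=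
  PowerSeries.coeff_mk _ _

theorem quantPlus_neg {k m : ℕ} (f : LoopVec) :
    (quantPlus (-f) : PowerSeries (FockOp k m)) = -quantPlus f := by
  ext1 j
  rw [map_neg, coeff_quantPlus, coeff_quantPlus, ← finsum_neg_distrib]
  refine finsum_congr fun p => ?_
  exact (congrArg (· • (epsOp * dq p.1.1 p.1.2 : FockOp k m))
    (mul_neg ((-1) ^ p.1.1) (((f p.1.1 p.1.2).coeff j).coeff 0))).trans (neg_smul_alg (R := FockOp k m) _ _)

theorem coeff_fInfA_lt {k m α : ℕ} (hm : 1 ≤ m) (i : ℕ) (h1 : 1 ≤ α) (h2 : α < k) (n j : ℕ) :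
    (-1) ^ n * ((fInfA k m i n α).coeff ((m * j : ℕ) : ℤ)).coeff 0 =
      if n * k + k = j + α then
        branch k m i (-((m * j : ℕ) : ℤ)) * fall ((n : ℂ) - (α : ℂ) / k) n else 0 := by
  rw [fInfA_lt m i h1 h2, HahnSeries.coeff_single]
  by_cases h : n * k + k = j + α
  · have h' : (n : ℤ) * k + k = j + α := by exact_mod_cast h
    have h3 : (m * (α - (n + 1) * k) : ℤ) = -((m * j : ℕ) : ℤ) := by
      push_cast
      linear_combination (-(m : ℤ)) * h'
    rw [h3, neg_neg, if_pos rfl, if_pos h, coeff_C_zero, ← mul_assoc, neg_one_pow_mul_fall,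
      mul_comm]
  · rw [if_neg, if_neg h, coeff_zero, mul_zero]
    intro h'
    refine h ?_
    have h3 : (m : ℤ) * (n * k + k) = m * (j + α) := by
      push_cast at h'
      linear_combination -h'
    exact_mod_cast mul_left_cancel₀ (show (m : ℤ) ≠ 0 by omega) h3

theorem coeff_fInfA_top {k m : ℕ} (hk : 1 ≤ k) (hm : 1 ≤ m) (i n j : ℕ) :
    (-1) ^ n * ((fInfA k m i n (k + m)).coeff ((m * j : ℕ) : ℤ)).coeff 0 =
      if n * k + k = j then
        branch k m i (-((m * j : ℕ) : ℤ)) * (((m : ℂ) / k) * n.factorial) else 0 := by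
  rw [fInfA_top, HahnSeries.coeff_single]
  by_cases h : n * k + k = j
  · subst h
    have h3 : (-((m * (n * k + k) : ℕ) : ℤ)) = k * m * (-(n + 1)) := by push_cast; ring
    rw [if_pos (by push_cast; ring), if_pos rfl, h3, branch_mul hk hm, coeff_C_zero,
      ← mul_assoc, ← mul_assoc, ← mul_pow]
    norm_num
  · rw [if_neg, if_neg h, coeff_zero, mul_zero]
    intro h'
    refine h ?_
    have h3 : m * (n * k + k) = m * j := by
      have h4 : m * j = k * m * (n + 1) := by exact_mod_cast h'
      rw [h4]; ring
    exact Nat.eq_of_mul_eq_mul_left hm h3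

/-- The substitution is ζ = λ_a^{1/k}, so that ζ⁻¹ is `w ^ m` times a root of unity depending on the
branch. -/
theorem quantPlus_fInfA {k m : ℕ} (hk : 1 ≤ k) (hm : 1 ≤ m) (i : ℕ) :
    (quantPlus (fInfA k m i) : PowerSeries (FockOp k m)) =
      spread m (branchNeg k m i) (dressExp₁ k m) := by
  ext1 j
  rw [coeff_quantPlus, coeff_spread, branchNeg]
  split_ifs with hj
  · obtain ⟨j, rfl⟩ := hj
    rw [Nat.mul_div_cancel_left _ hm]
    refine (finsum_idx (fun n α => ((-1) ^ n *
      ((fInfA k m i n α).coeff ((m * j : ℕ) : ℤ)).coeff 0) • (epsOp * dq n α : FockOp k m)) j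
      ?_).trans ?_
    · intro n α hn _
      by_cases h1 : 1 ≤ α ∧ α < k
      · rw [coeff_fInfA_lt hm i h1.1 h1.2, if_neg, zero_smul]
        have := Nat.le_mul_of_pos_right n hk
        omega
      · by_cases h2 : α = k + m
        · rw [h2, coeff_fInfA_top hk hm, if_neg, zero_smul]
          have := Nat.le_mul_of_pos_right n hk
          omega
        · rw [fInfA_eq_zero i _ h1 h2, HahnSeries.coeff_zero, coeff_zero, mul_zero, zero_smul]
    · rw [dressExp₁, PowerSeries.coeff_mk, ← Finset.sum_add_distrib, Finset.smul_sum]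
      refine Finset.sum_congr rfl fun n _ => ?_
      rw [sum_Icc_split hk, smul_add, add_comm (_ • _)]
      congr 1
      · rw [Finset.sum_eq_zero (s := Finset.Ico k (k + m)), add_zero, Finset.smul_sum]
        · refine Finset.sum_congr rfl fun α hα => ?_
          rw [Finset.mem_Ico] at hα
          rw [if_neg (by simp; omega), coeff_fInfA_lt hm i hα.1 hα.2]
          split_ifs
          · rw [mul_smul]
          · rw [zero_smul, smul_zero]
        · intro α hα
          rw [Finset.mem_Ico] at hα
          rw [fInfA_eq_zero i _ (by omega) (by omega), HahnSeries.coeff_zero, coeff_zero, mul_zero,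
            zero_smul, ite_self]
      · rw [if_neg (by simp; omega), coeff_fInfA_top hk hm]
        split_ifs
        · rw [mul_smul]
        · rw [zero_smul, smul_zero]
  · refine (finsum_congr fun p => ?_).trans finsum_zero
    have h0 : ((fInfA k m i p.1.1 p.1.2).coeff (j : ℤ)) = 0 := by
      by_cases h1 : 1 ≤ p.1.2 ∧ p.1.2 < k
      · rw [fInfA_lt m i h1.1 h1.2, HahnSeries.coeff_single, if_neg]
        intro h
        refine hj (Int.natCast_dvd_natCast.1 ⟨-(p.1.2 - (p.1.1 + 1) * k), ?_⟩)
        rw [h]; ring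
      · by_cases h2 : p.1.2 = k + m
        · rw [h2, fInfA_top, HahnSeries.coeff_single, if_neg]
          intro h
          refine hj (Int.natCast_dvd_natCast.1 ⟨k * (p.1.1 + 1), ?_⟩)
          rw [h]; push_cast; ring
        · rw [fInfA_eq_zero i _ h1 h2, HahnSeries.coeff_zero]
    rw [h0, coeff_zero, mul_zero, zero_smul]

theorem coeff_fInfB_mid {k m α : ℕ} (hk : 1 ≤ k) (logQ : ℂ) (i : ℕ) (h1 : 1 ≤ α) (h2 : α ≤ m)
    (n j : ℕ) :
    (-1) ^ n * ((fInfB k m logQ i n (k + m - α)).coeff ((k * j : ℕ) : ℤ)).coeff 0 =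
      if n * m + m = j + α then
        -(branch k m i (-((k * j : ℕ) : ℤ)) * fall ((n : ℂ) - (α : ℂ) / m) n) else 0 := by
  have h0 : k + m - (k + m - α) = α := by omega
  rw [fInfB_mid logQ i (by omega) (by omega), HahnSeries.coeff_single, h0]
  by_cases h : n * m + m = j + α
  · have h' : (n : ℤ) * m + m = j + α := by exact_mod_cast h
    have h3 : (k * (α - (n + 1) * m) : ℤ) = -((k * j : ℕ) : ℤ) := by
      push_cast
      linear_combination (-(k : ℤ)) * h'
    rw [h3, neg_neg, if_pos rfl, if_pos h, coeff_neg, coeff_C_zero, mul_neg, ← mul_assoc,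
      neg_one_pow_mul_fall, mul_comm]
  · rw [if_neg, if_neg h, coeff_zero, mul_zero]
    intro h'
    refine h ?_
    have h3 : (k : ℤ) * (n * m + m) = k * (j + α) := by
      push_cast at h'
      linear_combination -h'
    exact_mod_cast mul_left_cancel₀ (show (k : ℤ) ≠ 0 by omega) h3

theorem coeff_fInfB_top {k m : ℕ} (hk : 1 ≤ k) (hm : 1 ≤ m) (logQ : ℂ) (i n j : ℕ) :
    (-1) ^ n * ((fInfB k m logQ i n (k + m)).coeff ((k * j : ℕ) : ℤ)).coeff 0 =
      if n * m + m = j then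
        -(branch k m i (-((k * j : ℕ) : ℤ)) * n.factorial) else 0 := by
  rw [fInfB_top k hm, HahnSeries.coeff_single]
  by_cases h : n * m + m = j
  · subst h
    have h3 : (-((k * (n * m + m) : ℕ) : ℤ)) = k * m * (-(n + 1)) := by push_cast; ring
    rw [if_pos (by push_cast; ring), if_pos rfl, h3, branch_mul hk hm, coeff_neg, coeff_C_zero,
      mul_neg, ← mul_assoc, ← mul_pow]
    norm_num
  · rw [if_neg, if_neg h, coeff_zero, mul_zero]
    intro h'
    refine h ?_
    have h3 : k * (n * m + m) = k * j := by
      have h4 : k * j = k * m * (n + 1) := by exact_mod_cast h'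
      rw [h4]; ring
    exact Nat.eq_of_mul_eq_mul_left hk h3

/-- Here ζ = λ_b^{1/m}, so that ζ⁻¹ is `w ^ k` times a root of unity. Both sides leave out the
derivative in q_0^k, which is treated as a translation. -/
theorem quantPlus_fInfB {k m : ℕ} (hk : 1 ≤ k) (hm : 1 ≤ m) (logQ : ℂ) (i : ℕ) :
    (quantPlus (fInfB k m logQ i) : PowerSeries (FockOp k m)) =
      spread k (branchNeg k m i) (dressExp₂ k m) := by
  ext1 j
  rw [coeff_quantPlus, coeff_spread, branchNeg]
  have hlow : ∀ α, α ≤ k + m → ¬ α < k → α ≠ k + m → ∃ β, 1 ≤ β ∧ β ≤ m ∧ α = k + m - β :=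
    fun α h1 h2 h3 => ⟨k + m - α, by omega, by omega, by omega⟩
  split_ifs with hj
  · obtain ⟨j, rfl⟩ := hj
    rw [Nat.mul_div_cancel_left _ hk]
    refine (finsum_idx (fun n α => ((-1) ^ n *
      ((fInfB k m logQ i n α).coeff ((k * j : ℕ) : ℤ)).coeff 0) • (epsOp * dq n α : FockOp k m)) j
      ?_).trans ?_
    · intro n α hn hα
      have hnm := Nat.le_mul_of_pos_right n hm
      by_cases h1 : α < k
      · rw [fInfB_eq_zero hm logQ i _ h1, HahnSeries.coeff_zero, coeff_zero, mul_zero, zero_smul]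
      · by_cases h2 : α = k + m
        · rw [h2, coeff_fInfB_top hk hm, if_neg (by omega), zero_smul]
        · obtain ⟨β, hβ1, hβ2, rfl⟩ := hlow α hα h1 h2
          rw [coeff_fInfB_mid hk logQ i hβ1 hβ2, if_neg (by omega), zero_smul]
    · rw [dressExp₂, PowerSeries.coeff_mk]
      -- The only term without a power of `w` would be the one of index `(0, k)`, which is excluded
      -- on both sides.
      by_cases hj0 : j = 0
      · subst hj0
        rw [if_pos rfl, smul_zero, zero_add, Finset.sum_range_one]
        refine Finset.sum_eq_zero fun α hα => ?_
        rw [Finset.mem_Icc] at hα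
        split_ifs with h
        · rfl
        have hαk : α ≠ k := fun h' => h (by rw [h'])
        by_cases h1 : α < k
        · rw [fInfB_eq_zero hm logQ i _ h1, HahnSeries.coeff_zero, coeff_zero, mul_zero, zero_smul]
        · by_cases h2 : α = k + m
          · rw [h2, coeff_fInfB_top hk hm, if_neg (by omega), zero_smul]
          · obtain ⟨β, hβ1, hβ2, rfl⟩ := hlow α hα.2 h1 h2
            rw [coeff_fInfB_mid hk logQ i hβ1 hβ2, if_neg (by omega), zero_smul]
      · rw [if_neg hj0, ← neg_add', ← Finset.sum_add_distrib, smul_neg, Finset.smul_sum,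
          ← Finset.sum_neg_distrib]
        refine Finset.sum_congr rfl fun n _ => ?_
        rw [sum_Icc_split hk, smul_add, neg_add, add_comm (-(_ • _))]
        congr 1
        · rw [Finset.sum_eq_zero (s := Finset.Ico 1 k), zero_add, sum_Ico_reflect_top,
            Finset.smul_sum, ← Finset.sum_neg_distrib]
          · refine Finset.sum_congr rfl fun α hα => ?_
            rw [Finset.mem_Icc] at hα
            rw [coeff_fInfB_mid hk logQ i hα.1 hα.2]
            by_cases h : n * m + m = j + α
            · rw [if_pos h, if_pos h, if_neg, neg_smul_alg (R := FockOp k m), mul_smul]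
              -- Index `(0, k)` means `n = 0` and `α = m`; then `h` forces `j = 0`.
              intro h'
              rw [Prod.mk.injEq] at h'
              have hα' : α = m := by omega
              rw [h'.1] at h
              omega
            · rw [if_neg h, if_neg h, zero_smul, smul_zero, neg_zero, ite_self]
          · intro α hα
            rw [Finset.mem_Ico] at hα
            rw [fInfB_eq_zero hm logQ i _ hα.2, HahnSeries.coeff_zero, coeff_zero, mul_zero,
              zero_smul, ite_self]
        · rw [if_neg (by simp; omega), coeff_fInfB_top hk hm]
          split_ifs
          · rw [neg_smul_alg (R := FockOp k m), mul_smul]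
          · rw [zero_smul, smul_zero, neg_zero]
  · refine (finsum_congr fun p => ?_).trans finsum_zero
    have h0 : ((fInfB k m logQ i p.1.1 p.1.2).coeff (j : ℤ)) = 0 := by
      by_cases h1 : p.1.2 < k
      · rw [fInfB_eq_zero hm logQ i _ h1, HahnSeries.coeff_zero]
      · by_cases h2 : p.1.2 = k + m
        · rw [h2, fInfB_top k hm, HahnSeries.coeff_single, if_neg]
          intro h
          refine hj (Int.natCast_dvd_natCast.1 ⟨m * (p.1.1 + 1), ?_⟩)
          rw [h]; push_cast; ring
        · have hp := p.2.2.1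
          rw [fInfB_mid logQ i (by omega) (by omega), HahnSeries.coeff_single, if_neg]
          intro h
          refine hj (Int.natCast_dvd_natCast.1
            ⟨-(((k + m - p.1.2 : ℕ) : ℤ) - (p.1.1 + 1) * m), ?_⟩)
          rw [h]; ring
    rw [h0, coeff_zero, mul_zero, zero_smul]

section

variable {k m : ℕ}

/-! ## The first order coefficients of the Hirota equation -/

theorem lower_of_lt (f : LoopVec) (n : ℤ) {α : ℕ} (h1 : 1 ≤ α) (h2 : α < k) :
    lower k m f n α = HahnSeries.C (C (1 / (k : ℂ))) * f n (k - α) := by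
  rw [lower, Finset.sum_eq_single (k - α)]
  · rw [eta, if_pos ⟨h1, h2, by omega⟩]
  · intro β _ hβ
    rw [eta, if_neg (by omega), if_neg (by omega), map_zero, map_zero, zero_mul]
  · intro h
    exact absurd (Finset.mem_Icc.2 ⟨by omega, by omega⟩) h

theorem lower_of_ge (hk : 1 ≤ k) (f : LoopVec) (n : ℤ) {α : ℕ} (h1 : k ≤ α) (h2 : α ≤ k + m) :
    lower k m f n α = HahnSeries.C (C (1 / (m : ℂ))) * f n (2 * k + m - α) := by
  rw [lower, Finset.sum_eq_single (2 * k + m - α)]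
  · rw [eta, if_neg (by omega), if_pos ⟨h1, h2, by omega⟩]
  · intro β _ hβ
    rw [eta, if_neg (by omega), if_neg (by omega), map_zero, map_zero, zero_mul]
  · intro h
    exact absurd (Finset.mem_Icc.2 ⟨by omega, by omega⟩) h

/-- The operator `a ∂_x + b ε⁻¹`. -/
def flowLog (a b : ℂ) : Module.End ℂ FunXLog := a • derivXLog + b • mulLog Eps.epsInv

theorem const_C_mul (c : ℂ) (f : FunXLog) : Eps.const (LogU.const (C c)) * f = c • f :=
  (Algebra.smul_def c f).symm

theorem minusCoeff_of_lower {f : LoopVec} {p : Idx k m} {e : ℤ} {g : ℂ[X]}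
    (h : lower k m f (-(p.1.1 : ℤ) - 1) p.1.2 = HahnSeries.single e g) :
    minusCoeff f p =
      HahnSeries.single e (mulLog (Eps.const (LogU.const (-g)) * Eps.epsInv)) := by
  ext1
  funext i
  rw [coeff_minusCoeff, h, HahnSeries.coeff_single, HahnSeries.coeff_single]
  split_ifs
  · rfl
  · rw [neg_zero, map_zero, map_zero, zero_mul, mulLog_zero]

theorem flowCoeff_of_ne {f : LoopVec} {p : Idx k m} (hp : p.1.2 ≠ k) {e : ℤ} {c : ℂ}
    (h : lower k m f (-(p.1.1 : ℤ) - 1) p.1.2 = HahnSeries.single e (C c)) :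
    flowCoeff f p = HahnSeries.single e (flowLog 0 (-c)) := by
  have h1 : flowLog 0 (-c) = mulLog (Eps.const (LogU.const (-C c)) * Eps.epsInv) := by
    rw [flowLog, ← C_neg, const_C_mul, ← smul_mulLog]
    refine LinearMap.ext fun x => ?_
    simp
  have h2 : ∀ T, phiCoeff T p = 0 := fun T => if_neg hp
  unfold flowCoeff
  rw [h2, h2, minusCoeff_of_lower h, h1]
  exact (congrArg _ (add_zero (0 : LamOp))).trans (add_zero (_ : LamOp))

theorem mulLog_add (f g : FunXLog) : mulLog (f + g) = mulLog f + mulLog g :=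
  LinearMap.ext fun h => add_mul f g h

/-- Hypothesis `hc` is the cancellation of log λ: `-g` comes from differentiating e^{f̂₋}, and `rho`
divided by `n!` from moving (λ^n/n!)∂_x past exp(ρu). Only the harmonic number is left in `c`. -/
theorem flowCoeff_of_eq {f : LoopVec} {p : Idx k m} (hp : p.1.2 = k) {g : ℂ[X]} {c : ℂ}
    (h : lower k m f (-(p.1.1 : ℤ) - 1) p.1.2 =
      HahnSeries.single (-((k * m * p.1.1 : ℕ) : ℤ)) g)
    (hc : -g + C (p.1.1.factorial : ℂ)⁻¹ * rho k m f = C c) :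
    flowCoeff f p = HahnSeries.single (-((k * m * p.1.1 : ℕ) : ℤ))
      (flowLog (p.1.1.factorial : ℂ)⁻¹ c) := by
  have h2 : ∀ T, phiCoeff T p = HahnSeries.single (-((k * m * p.1.1 : ℕ) : ℤ))
      (((p.1.1.factorial : ℂ)⁻¹) • T) := fun T => if_pos hp
  unfold flowCoeff
  rw [h2, h2, minusCoeff_of_lower h, ← HahnSeries.single_add, ← HahnSeries.single_add]
  have h3 : Eps.const (LogU.const (-g)) * Eps.epsInv + (p.1.1.factorial : ℂ)⁻¹ •
      (Eps.epsInv * Eps.const (LogU.const (rho k m f))) = c • Eps.epsInv := by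
    rw [← const_C_mul, ← const_C_mul, ← hc]
    simp only [map_add, map_mul]
    ring
  refine congrArg (HahnSeries.single _) ((add_left_comm _ _ _).trans ?_)
  rw [flowLog, smul_mulLog _ Eps.epsInv, smul_mulLog _ (_ * _), ← mulLog_add, h3]

theorem rho_eq_of_lower {f : LoopVec} {g : ℂ[X]}
    (h : lower k m f (-1) k = HahnSeries.single 0 g) : rho k m f = g := by
  rw [rho, h, HahnSeries.coeff_single_same]

/-- The coefficient of `∂_x` in the operator which describes the flow of `q_n^β`. -/
def flowA (k n β : ℕ) : ℂ := if β = k then (n.factorial : ℂ)⁻¹ else 0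

/-- The coefficient of `ε⁻¹` in the operator which describes the flow of `q_n^β`, at `f_∞^a`. -/
def flowB₁ (k n β : ℕ) : ℂ :=
  if β < k then -(1 / (k : ℂ) * fall (-((β : ℂ) / k)) (-(n : ℤ) - 1))
  else if β = k then (n.factorial : ℂ)⁻¹ * (harm n / k) else 0

/-- The coefficient of `ε⁻¹` in the operator which describes the flow of `q_n^β`, at `f_∞^b`. -/
def flowB₂ (k m n β : ℕ) : ℂ :=
  if β < k then 0
  else if β = k then -((n.factorial : ℂ)⁻¹ * (harm n / m))
  else 1 / (m : ℂ) * fall (((β : ℂ) - k) / m - 1) (-(n : ℤ) - 1)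

theorem smul_flowLog (c a b : ℂ) : c • flowLog a b = flowLog (c * a) (c * b) := by
  rw [flowLog, flowLog, smul_add, smul_smul, smul_smul]

theorem flowLog_zero : flowLog 0 0 = 0 := by
  refine LinearMap.ext fun x => ?_
  simp [flowLog]

theorem C_mul_single {R : Type} [Ring R] (c g : R) (e : ℤ) :
    HahnSeries.C c * HahnSeries.single e g = HahnSeries.single e (c * g) := by
  rw [HahnSeries.C_apply, HahnSeries.single_mul_single, zero_add]

theorem lower_fInfA_eq (hk : 1 ≤ k) (hm : 1 ≤ m) (i n : ℕ) :
    lower k m (fInfA k m i) (-(n : ℤ) - 1) k = HahnSeries.single (-((k * m * n : ℕ) : ℤ))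
      (C ((k : ℂ)⁻¹ * (n.factorial : ℂ)⁻¹) * (logLam i - C (harm n))) := by
  have h2 : (m : ℂ) ≠ 0 := Nat.cast_ne_zero.2 (by omega)
  have h3 : 2 * k + m - k = k + m := by omega
  rw [lower_of_ge hk _ _ le_rfl (by omega), h3, fInfA_top_neg, C_mul_single, ← mul_assoc, ← C_mul]
  congr 3
  field_simp

theorem lower_fInfB_eq (hk : 1 ≤ k) (hm : 1 ≤ m) (logQ : ℂ) (i n : ℕ) :
    lower k m (fInfB k m logQ i) (-(n : ℤ) - 1) k = HahnSeries.single (-((k * m * n : ℕ) : ℤ))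
      (-(C ((m : ℂ)⁻¹ * (n.factorial : ℂ)⁻¹) * (logLam i - C (m * logQ) - C (harm n)))) := by
  have h3 : 2 * k + m - k = k + m := by omega
  rw [lower_of_ge hk _ _ le_rfl (by omega), h3, fInfB_top_neg k hm, C_mul_single, mul_neg,
    ← mul_assoc, ← C_mul, one_div]

theorem harm_zero : harm 0 = 0 := by simp [harm]

theorem rho_fInfA (hk : 1 ≤ k) (hm : 1 ≤ m) (i : ℕ) :
    rho k m (fInfA k m i) = C ((k : ℂ)⁻¹) * logLam i := by
  have h := lower_fInfA_eq hk hm i 0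
  simp only [Nat.cast_zero, neg_zero, zero_sub, mul_zero, Nat.factorial_zero, Nat.cast_one,
    inv_one, mul_one, harm_zero, map_zero, sub_zero] at h
  exact rho_eq_of_lower h

theorem rho_fInfB (hk : 1 ≤ k) (hm : 1 ≤ m) (logQ : ℂ) (i : ℕ) :
    rho k m (fInfB k m logQ i) = -(C ((m : ℂ)⁻¹) * (logLam i - C (m * logQ))) := by
  have h := lower_fInfB_eq hk hm logQ i 0
  simp only [Nat.cast_zero, neg_zero, zero_sub, mul_zero, Nat.factorial_zero, Nat.cast_one,
    inv_one, mul_one, harm_zero, map_zero, sub_zero] at h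
  exact rho_eq_of_lower h

theorem branch_natCast_mul (hk : 1 ≤ k) (hm : 1 ≤ m) (i n : ℕ) :
    branch k m i ((k * m * n : ℕ) : ℤ) = 1 := by
  rw [← branch_mul hk hm i n]
  congr 1

/-- For β < k only f̂₋ contributes; for β = k there is also the term with ∂_x; for β > k the metric
pairs β with an index at which f^a has no component. -/
theorem flowCoeff_fInfA (hk : 1 ≤ k) (hm : 1 ≤ m) (i : ℕ) (p : Idx k m) :
    flowCoeff (fInfA k m i) p =
      HahnSeries.single (-((m * (p.1.1 * k + k - p.1.2) : ℕ) : ℤ))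
        (branch k m i ((m * (p.1.1 * k + k - p.1.2) : ℕ) : ℤ) •
          flowLog (flowA k p.1.1 p.1.2) (flowB₁ k p.1.1 p.1.2)) := by
  have hk0 : (k : ℂ) ≠ 0 := Nat.cast_ne_zero.2 (by omega)
  obtain ⟨⟨n, β⟩, hp⟩ := p
  have hp1 : 1 ≤ β := hp.1
  have hp2 : β ≤ k + m := hp.2.1
  dsimp only
  rcases lt_trichotomy β k with h | h | h
  · have he : (m * (((k - β : ℕ) : ℤ) - (-(n : ℤ) - 1 + 1) * k)) =
        ((m * (n * k + k - β) : ℕ) : ℤ) := by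
      have : k ≤ n * k + k := by omega
      push_cast [Nat.cast_sub h.le, Nat.cast_sub (h.le.trans this)]
      ring
    have hf : ((k - β : ℕ) : ℂ) / k - 1 = -((β : ℂ) / k) := by
      rw [Nat.cast_sub h.le]
      field_simp
      ring
    refine (flowCoeff_of_ne (e := -((m * (n * k + k - β) : ℕ) : ℤ))
      (c := 1 / (k : ℂ) * (fall (-((β : ℂ) / k)) (-(n : ℤ) - 1) *
        branch k m i ((m * (n * k + k - β) : ℕ) : ℤ))) h.ne ?_).trans ?_
    · dsimp only
      rw [lower_of_lt _ _ hp1 h, fInfA_lt m i (by omega) (by omega), C_mul_single, he, hf, ← C_mul]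
    · rw [smul_flowLog, flowA, if_neg h.ne, flowB₁, if_pos h, mul_zero]
      exact congrArg (fun b => HahnSeries.single _ (flowLog 0 b)) (by ring)
  · subst h
    have he : m * (n * β + β - β) = β * m * n := by rw [Nat.add_sub_cancel]; ring
    rw [he, branch_natCast_mul hk hm, one_smul, flowA, if_pos rfl, flowB₁, if_neg (lt_irrefl _),
      if_pos rfl]
    refine flowCoeff_of_eq rfl (lower_fInfA_eq hk hm i n) ?_
    rw [rho_fInfA hk hm]
    dsimp only
    simp only [div_eq_mul_inv, C_mul]
    ring
  -- The operator vanishes here, so the exponent, possibly a truncated subtraction, is immaterial.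
  · rw [flowA, if_neg h.ne', flowB₁, if_neg (by omega), if_neg h.ne', flowLog_zero]
    refine (flowCoeff_of_ne (e := 0) (c := 0) h.ne' ?_).trans ?_
    · dsimp only
      rw [lower_of_ge hk _ _ h.le hp2, fInfA_eq_zero i _ (by omega) (by omega), mul_zero, map_zero,
        map_zero]
    · rw [neg_zero, flowLog_zero, smul_zero, map_zero, map_zero]

theorem flowCoeff_fInfB (hk : 1 ≤ k) (hm : 1 ≤ m) (logQ : ℂ) (i : ℕ) (p : Idx k m) :
    flowCoeff (fInfB k m logQ i) p =
      HahnSeries.single (-((k * (p.1.2 - k + p.1.1 * m) : ℕ) : ℤ))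
        (branch k m i ((k * (p.1.2 - k + p.1.1 * m) : ℕ) : ℤ) •
          flowLog (flowA k p.1.1 p.1.2) (flowB₂ k m p.1.1 p.1.2)) := by
  obtain ⟨⟨n, β⟩, hp⟩ := p
  have hp1 : 1 ≤ β := hp.1
  have hp2 : β ≤ k + m := hp.2.1
  dsimp only
  rcases lt_trichotomy β k with h | h | h
  -- The metric pairs β < k with k - β < k, where f^b has no component; the truncated `β - k` in the
  -- exponent is harmless.
  · rw [flowA, if_neg h.ne, flowB₂, if_pos h, flowLog_zero]
    refine (flowCoeff_of_ne (e := 0) (c := 0) h.ne ?_).trans ?_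
    · dsimp only
      rw [lower_of_lt _ _ hp1 h, fInfB_eq_zero hm logQ i _ (by omega), mul_zero, map_zero,
        map_zero]
    · rw [neg_zero, flowLog_zero, smul_zero, map_zero, map_zero]
  · subst h
    have he : β * (β - β + n * m) = β * m * n := by rw [Nat.sub_self]; ring
    rw [he, branch_natCast_mul hk hm, one_smul, flowA, if_pos rfl, flowB₂, if_neg (lt_irrefl _),
      if_pos rfl]
    refine flowCoeff_of_eq rfl (lower_fInfB_eq hk hm logQ i n) ?_
    rw [rho_fInfB hk hm]
    dsimp only
    simp only [div_eq_mul_inv, C_neg, C_mul]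
    ring
  · have h0 : k + m - (2 * k + m - β) = β - k := by omega
    have he : (k * (((β - k : ℕ) : ℤ) - (-(n : ℤ) - 1 + 1) * m)) =
        ((k * (β - k + n * m) : ℕ) : ℤ) := by
      push_cast
      ring
    refine (flowCoeff_of_ne (e := -((k * (β - k + n * m) : ℕ) : ℤ))
      (c := 1 / (m : ℂ) * -(fall (((β : ℂ) - k) / m - 1) (-(n : ℤ) - 1) *
        branch k m i ((k * (β - k + n * m) : ℕ) : ℤ))) h.ne' ?_).trans ?_
    · dsimp only
      rw [lower_of_ge hk _ _ h.le hp2, fInfB_mid logQ i (by omega) (by omega), C_mul_single, h0,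
        he, Nat.cast_sub h.le, ← C_neg, ← C_mul]
    · rw [smul_flowLog, flowA, if_neg h.ne', flowB₂, if_neg (by omega), if_neg h.ne', mul_zero]
      exact congrArg (fun b => HahnSeries.single _ (flowLog 0 b)) (by ring)

end

/-! ### The HQE turned into bilinear identities between operators on the Fock space. -/

section

variable {k m : ℕ}

/-! ## Translations -/

theorem coeff_shiftX (c : ℂ) (f : FunX) (n : ℤ) :
    (shiftX c f).coeff n = Polynomial.taylor c (f.coeff n) := rfl

theorem shiftX_zero : shiftX 0 = 1 := by
  refine LinearMap.ext fun f => Eps.ext fun n => ?_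
  rw [coeff_shiftX, Polynomial.taylor_zero]
  rfl

theorem shiftX_mul_shiftX (a b : ℂ) : shiftX a * shiftX b = shiftX (a + b) := by
  refine LinearMap.ext fun f => Eps.ext fun n => ?_
  rw [Module.End.mul_apply, coeff_shiftX, coeff_shiftX, coeff_shiftX, Polynomial.taylor_taylor,
    add_comm]

theorem liftX_one : (liftX 1 : FockOp k m) = 1 := rfl

theorem liftX_mul (φ ψ : Module.End ℂ FunX) : (liftX (φ * ψ) : FockOp k m) = liftX φ * liftX ψ :=
  rfl

theorem liftX_smul (c : ℂ) (φ : Module.End ℂ FunX) :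
    (liftX (c • φ) : FockOp k m) = c • liftX φ := rfl

theorem shift_zero : (shift 0 : FockOp k m) = 1 := by
  rw [shift, shiftX_zero, liftX_one]

theorem shift_mul_shift (a b : ℂ) : (shift a * shift b : FockOp k m) = shift (a + b) := by
  rw [shift, shift, ← liftX_mul, shiftX_mul_shiftX, shift]

/-! ## The exponentials acting on the tau function -/

/-- The coefficients of `e ^ {f̂₊} τ` for `f = f_∞^a`, up to the branch. -/
def aFun (τ : Fock k m) (j : ℕ) : Fock k m := PowerSeries.coeff j (expPS (dressExp₁ k m)) τ

/-- The coefficients of `e ^ {-f̂₊} τ` for `f = f_∞^a`, up to the branch. -/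
def aFunNeg (τ : Fock k m) (j : ℕ) : Fock k m := PowerSeries.coeff j (expPS (-dressExp₁ k m)) τ

/-- The coefficients of `e ^ {f̂₊} τ` for `f = f_∞^b`, up to the branch. -/
def bFun (τ : Fock k m) (j : ℕ) : Fock k m :=
  PowerSeries.coeff j (expPS (dressExp₂ k m)) (shift (-1) τ)

/-- The coefficients of `e ^ {-f̂₊} τ` for `f = f_∞^b`, up to the branch. -/
def bFunNeg (τ : Fock k m) (j : ℕ) : Fock k m :=
  PowerSeries.coeff j (expPS (-dressExp₂ k m)) (shift 1 τ)

theorem coeff_zero_dressExp₁ (hk : 1 ≤ k) : PowerSeries.coeff 0 (dressExp₁ k m) = 0 := by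
  rw [dressExp₁, PowerSeries.coeff_mk, zero_add, Finset.sum_range_one, Finset.sum_range_one,
    if_neg (by omega), zero_add]
  refine Finset.sum_eq_zero fun α hα => ?_
  rw [Finset.mem_Ico] at hα
  exact if_neg (by omega)

theorem coeff_zero_dressExp₂ : PowerSeries.coeff 0 (dressExp₂ k m) = 0 := by
  rw [dressExp₂, PowerSeries.coeff_mk, if_pos rfl]

/-- The sequence obtained from `a` by the substitution of `χ w ^ c` for the variable. -/
def spreadFun (c : ℕ) (χ : ℕ → ℂ) (a : ℕ → Fock k m) (j : ℕ) : Fock k m :=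
  if c ∣ j then χ j • a (j / c) else 0

theorem coeff_spread_apply (c : ℕ) (χ : ℕ → ℂ) (Y : PowerSeries (FockOp k m)) (τ : Fock k m)
    (j : ℕ) : PowerSeries.coeff j (spread c χ Y) τ =
      spreadFun c χ (fun j => PowerSeries.coeff j Y τ) j := by
  rw [coeff_spread, spreadFun]
  split_ifs <;> rfl

theorem map_spreadFun (φ : FockOp k m) (c : ℕ) (χ : ℕ → ℂ) (a : ℕ → Fock k m) (j : ℕ) :
    φ (spreadFun c χ a j) = spreadFun c χ (fun j => φ (a j)) j := by
  unfold spreadFun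
  split_ifs
  · exact φ.map_smul _ _
  · exact φ.map_zero

theorem expPlus_fInfA (hk : 1 ≤ k) (hm : 1 ≤ m) (i j : ℕ) (τ : Fock k m) :
    expPlus (fInfA k m i) j τ = spreadFun m (branchNeg k m i) (aFun τ) j := by
  have h0 : fInfA k m i 0 k = 0 := fInfA_eq_zero i 0 (by omega) (by omega)
  unfold expPlus
  rw [quantPlus_fInfA hk hm, expPS_spread hm (branchNeg_add k m i) (branchNeg_zero k m i)
    (coeff_zero_dressExp₁ hk), h0, HahnSeries.coeff_zero, coeff_zero, shift_zero, mul_one]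
  exact coeff_spread_apply _ _ _ _ _

theorem expPlus_neg_fInfA (hk : 1 ≤ k) (hm : 1 ≤ m) (i j : ℕ) (τ : Fock k m) :
    expPlus (-fInfA k m i) j τ = spreadFun m (branchNeg k m i) (aFunNeg τ) j := by
  have h0 : (-fInfA k m i) 0 k = 0 := by
    change -(fInfA k m i 0 k) = 0
    rw [fInfA_eq_zero i 0 (by omega) (by omega), neg_zero]
  have h1 : PowerSeries.coeff 0 (-dressExp₁ k m) = 0 := by
    rw [map_neg, coeff_zero_dressExp₁ hk, neg_zero]
  unfold expPlus
  rw [quantPlus_neg, quantPlus_fInfA hk hm, ← spread_neg,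
    expPS_spread hm (branchNeg_add k m i) (branchNeg_zero k m i) h1, h0, HahnSeries.coeff_zero,
    coeff_zero, shift_zero, mul_one]
  exact coeff_spread_apply _ _ _ _ _

/-- The q_0^k term of f̂₊ for f^b is -ε∂/∂q_0^k, with no power of λ; its exponential is the `shift
(-1)` in `bFun`. -/
theorem coeff_fInfB_zero (hm : 1 ≤ m) (logQ : ℂ) (i : ℕ) :
    ((fInfB k m logQ i 0 k).coeff 0).coeff 0 = -1 := by
  have hm0 : (m : ℂ) ≠ 0 := Nat.cast_ne_zero.2 (by omega)
  have h0 : k + m - k = m := by omega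
  have h1 : (k * ((m : ℤ) - (0 + 1) * m)) = 0 := by ring
  rw [fInfB_mid logQ i le_rfl (by omega), h0, h1, neg_zero, HahnSeries.coeff_single_same,
    coeff_neg, coeff_C_zero, branch_zero]
  simp [fall]

theorem expPlus_fInfB (hk : 1 ≤ k) (hm : 1 ≤ m) (logQ : ℂ) (i j : ℕ) (τ : Fock k m) :
    expPlus (fInfB k m logQ i) j τ = spreadFun k (branchNeg k m i) (bFun τ) j := by
  unfold expPlus
  rw [quantPlus_fInfB hk hm, expPS_spread hk (branchNeg_add k m i) (branchNeg_zero k m i)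
    coeff_zero_dressExp₂, coeff_fInfB_zero hm]
  exact coeff_spread_apply _ _ _ _ _

theorem expPlus_neg_fInfB (hk : 1 ≤ k) (hm : 1 ≤ m) (logQ : ℂ) (i j : ℕ) (τ : Fock k m) :
    expPlus (-fInfB k m logQ i) j τ = spreadFun k (branchNeg k m i) (bFunNeg τ) j := by
  have h0 : (((-fInfB k m logQ i) 0 k).coeff 0).coeff 0 = 1 := by
    change -(((fInfB k m logQ i 0 k).coeff 0).coeff 0) = 1
    rw [coeff_fInfB_zero hm, neg_neg]
  have h1 : PowerSeries.coeff 0 (-dressExp₂ k m) = 0 := by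
    rw [map_neg, coeff_zero_dressExp₂, neg_zero]
  unfold expPlus
  rw [quantPlus_neg, quantPlus_fInfB hk hm, ← spread_neg,
    expPS_spread hk (branchNeg_add k m i) (branchNeg_zero k m i) h1, h0]
  exact coeff_spread_apply _ _ _ _ _

/-! ## Bilinear expressions in the tau function -/

/-- The coefficient of `w ^ z` in the composition of `∑ (a i) w ^ i`, `O` and `∑ (a' j) w ^ j`. -/
def pairing (a a' : ℕ → Fock k m) (O : FockOp k m) (z : ℤ) : FockOp k m :=
  conv (fun i j => mulOp (a i) * O * mulOp (a' j)) z

theorem mulOp_zero : (mulOp 0 : FockOp k m) = 0 := LinearMap.ext fun h => zero_mul h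

theorem mulOp_smul (c : ℂ) (f : Fock k m) : mulOp (c • f) = c • mulOp f :=
  LinearMap.ext fun h => smul_mul_assoc c f h

theorem smul_mul_smul_mul_smul {R : Type} [Ring R] [Algebra ℂ R] (a b c : ℂ) (x y z : R) :
    (a • x) * (b • y) * (c • z) = (a * c * b) • (x * y * z) := by
  rw [smul_mul_smul_comm, smul_mul_smul_comm, mul_right_comm]

/-- The branch factors of the two series depend only on the total degree, so they combine into one
root of unity outside the sum. It will cancel the branch factor of the prefactors. -/
theorem pairing_spreadFun {c : ℕ} (hc : 1 ≤ c) (i : ℕ) (a a' : ℕ → Fock k m) (O : FockOp k m)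
    (t : ℂ) (z : ℤ) :
    pairing (spreadFun c (branchNeg k m i) a) (spreadFun c (branchNeg k m i) a') (t • O) (c * z) =
      (branch k m i (-(c * z)) * t) • pairing a a' O z := by
  have h : ∀ (b : ℕ → Fock k m) j, spreadFun c (branchNeg k m i) b (c * j) =
      branchNeg k m i (c * j) • b j := by
    intro b j
    rw [spreadFun, if_pos (dvd_mul_right c j), Nat.mul_div_cancel_left _ hc]
  unfold pairing
  rw [conv_mul hc]
  · refine Eq.trans (conv_congr fun x y hxy => ?_)
      (map_conv (DistribSMul.toAddMonoidHom (FockOp k m) (branch k m i (-(c * z)) * t)) _ _).symm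
    rw [h, h, mulOp_smul, mulOp_smul]
    refine (smul_mul_smul_mul_smul (R := FockOp k m) _ _ _ _ _ _).trans ?_
    rw [← branchNeg_add, ← mul_add, branchNeg, ← hxy]
    push_cast
    rfl
  · intro x y hx
    rw [spreadFun, if_neg hx, mulOp_zero]
    exact (congrArg (· * _) (zero_mul O)).trans (zero_mul _)

/-- The inclusion of functions without logarithms is injective. This transports the HQE to the Fock
space. -/
theorem Represents.unique {X : MvPowerSeries (Idx k m) (Module.End ℂ FunXLog)}
    {O P : FockOp k m} (hO : Represents X O) (hP : Represents X P) : O = P := by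
  refine LinearMap.ext fun f => MvPowerSeries.ext fun d => toLogHom_injective ?_
  exact (hO f d).symm.trans (hP f d)

end

section

variable {k m : ℕ}

/-! ## Consequences of the Hirota equation -/

theorem lamPow_mul_single (c : ℂ) (p e : ℤ) (T : Module.End ℂ FunXLog) :
    lamPow c p * HahnSeries.single e T = HahnSeries.single (e - p) (c • T) := by
  rw [lamPow, HahnSeries.single_mul_single, Algebra.smul_def, neg_add_eq_sub]

theorem C_central_mul {σ R : Type} [Ring R] {l : R} (hl : ∀ x, Commute l x) (x : R)
    (S S' : MvPowerSeries σ R) :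
    MvPowerSeries.C l * (S * MvPowerSeries.C x * S') = S * MvPowerSeries.C (l * x) * S' := by
  have h : Commute (MvPowerSeries.C l) S := commute_C_left fun d => hl _
  rw [← mul_assoc, ← mul_assoc, h.eq, mul_assoc S, ← map_mul]

theorem lamPow_term (c c' : ℂ) (p q e : ℤ) (T : Module.End ℂ FunXLog)
    (S S' : MvPowerSeries (Idx k m) LamOp) :
    MvPowerSeries.C (lamPow c p) *
      (S * MvPowerSeries.C (HahnSeries.single e T * lamPow c' q) * S') =
    S * MvPowerSeries.C (HahnSeries.single (e - (p + q)) ((c * c') • T) : LamOp) * S' := by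
  refine (C_central_mul (R := LamOp) (commute_lamPow c p) _ S S').trans ?_
  rw [← (commute_lamPow c' q (HahnSeries.single e T)).eq, lamPow_mul_single, lamPow_mul_single,
    smul_smul, sub_sub, add_comm q p]

theorem represents_lamPow_term (c c' : ℂ) (p q e J : ℤ) {T : Module.End ℂ FunXLog}
    {T₀ : Module.End ℂ FunX} (h : ∀ f, T (toLog f) = toLog (T₀ f)) (G G' : ℕ → Fock k m) :
    Represents
      (coeffLam J (MvPowerSeries.C (lamPow c p) *
        (seriesOf G * MvPowerSeries.C (HahnSeries.single e T * lamPow c' q) * seriesOf G')))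
      (pairing G G' ((c * c') • liftX T₀) (J - (e - (p + q)))) := by
  rw [lamPow_term]
  refine represents_coeffLam G G' _ ?_ J
  refine Represents.liftX (T₀ := (c * c') • T₀) fun f => ?_
  rw [LinearMap.smul_apply, LinearMap.smul_apply, toLog_smul, h]

-- Adding up the coefficients of all (q')^{d'}(q'')^{d''} with d' + d'' = d amounts to setting q' =
-- q''.
open Classical in
theorem coeffLam_sum_mul (ι : Type) (s : Finset ι) (J : ℤ) (L : ι → LamOp)
    (V W : ι → MvPowerSeries (Idx k m) LamOp) (d : Idx k m →₀ ℕ) :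
    MvPowerSeries.coeff d (∑ i ∈ s, coeffLam J (MvPowerSeries.C (L i) * (V i * W i))) =
      ∑ x ∈ Finset.HasAntidiagonal.antidiagonal d, (∑ i ∈ s, L i *
        (MvPowerSeries.coeff x.1 (V i) * MvPowerSeries.coeff x.2 (W i))).coeff J := by
  rw [map_sum]
  simp only [HahnSeries.coeff_sum]
  rw [Finset.sum_comm]
  refine Finset.sum_congr rfl fun i _ => ?_
  change (MvPowerSeries.coeff d (MvPowerSeries.C (L i) * (V i * W i))).coeff J = _
  rw [MvPowerSeries.coeff_C_mul, MvPowerSeries.coeff_mul, Finset.mul_sum, HahnSeries.coeff_sum]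

/-- The prefactor of the term `Γ^a ⊗ Γ^{-a}`. -/
def prefA (k m i : ℕ) : LamOp := lamPow ((k : ℂ)⁻¹ * branch k m i (m * (1 - k))) (m * (1 - k))

/-- The prefactor of the term `Γ^b ⊗ Γ^{-b}`. -/
def prefB (k m : ℕ) (logQ : ℂ) (i : ℕ) : LamOp :=
  lamPow (Complex.exp logQ * (m : ℂ)⁻¹ * branch k m i (-(k * (1 + m)))) (-(k * (1 + m)))

/-- The second factor of `Γ^a ⊗ Γ^{-a}`. -/
def deltaA (i : ℕ) (r : ℤ) (τ : Fock k m) : MvPowerSeries (Idx k m) LamOp :=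
  vertexDelta (-fInfA k m i) r (lamPow (branch k m i (m * r)) (m * r)) τ

/-- The second factor of `Γ^b ⊗ Γ^{-b}`. -/
def deltaB (logQ : ℂ) (i : ℕ) (r : ℤ) (τ : Fock k m) : MvPowerSeries (Idx k m) LamOp :=
  vertexDelta (-fInfB k m logQ i) r
    (lamPow (branch k m i (-(k * r)) * Complex.exp (r * logQ)) (-(k * r))) τ

theorem hirotaForm_eq (logQ : ℂ) (τ : Fock k m) (r : ℤ) (d' d'' : Idx k m →₀ ℕ) :
    hirotaForm logQ τ r d' d'' =
      (∑ i ∈ Finset.range k, prefA k m i * (MvPowerSeries.coeff d' (vertexSharp (fInfA k m i) τ) *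
        MvPowerSeries.coeff d'' (deltaA i r τ))) -
      ∑ i ∈ Finset.range m, prefB k m logQ i *
        (MvPowerSeries.coeff d' (vertexSharp (fInfB k m logQ i) τ) *
          MvPowerSeries.coeff d'' (deltaB logQ i r τ)) := rfl

theorem SatisfiesHQE.sum_eq {logQ : ℂ} {τ : Fock k m} (h : SatisfiesHQE k m logQ τ) (r : ℤ)
    {J : ℤ} (hJ : 0 < J) :
    ∑ i ∈ Finset.range k, coeffLam J (MvPowerSeries.C (prefA k m i) *
        (vertexSharp (fInfA k m i) τ * deltaA i r τ)) =
      ∑ i ∈ Finset.range m, coeffLam J (MvPowerSeries.C (prefB k m logQ i) *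
        (vertexSharp (fInfB k m logQ i) τ * deltaB logQ i r τ)) := by
  refine MvPowerSeries.ext fun d => ?_
  rw [coeffLam_sum_mul, coeffLam_sum_mul]
  refine Finset.sum_congr rfl fun x _ => ?_
  have h1 := h r x.1 x.2 J hJ
  rw [hirotaForm_eq, HahnSeries.coeff_sub] at h1
  exact sub_eq_zero.1 h1

theorem coeff_sum_mul_nsmul {ι R : Type} [Ring R] (n : ℕ) (s : Finset ι)
    (a b c : ι → HahnSeries ℤ R) (J : ℤ) :
    (∑ i ∈ s, a i * ((n • b i) * c i)).coeff J = n • (∑ i ∈ s, a i * (b i * c i)).coeff J := by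
  simp only [smul_mul_assoc, mul_smul_comm, ← Finset.smul_sum]
  rw [HahnSeries.coeff_smul]

/-- The HQE holds for each pair of monomials separately, so it may be differentiated in one variable
of `q'` before `q'` and `q''` are identified. -/
theorem SatisfiesHQE.sum_pd_eq {logQ : ℂ} {τ : Fock k m} (h : SatisfiesHQE k m logQ τ)
    (p : Idx k m) (r : ℤ) {J : ℤ} (hJ : 0 < J) :
    ∑ i ∈ Finset.range k, coeffLam J (MvPowerSeries.C (prefA k m i) *
        (pd p (vertexSharp (fInfA k m i) τ) * deltaA i r τ)) =
      ∑ i ∈ Finset.range m, coeffLam J (MvPowerSeries.C (prefB k m logQ i) *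
        (pd p (vertexSharp (fInfB k m logQ i) τ) * deltaB logQ i r τ)) := by
  refine MvPowerSeries.ext fun d => ?_
  rw [coeffLam_sum_mul, coeffLam_sum_mul]
  refine Finset.sum_congr rfl fun x _ => ?_
  have h1 := h r (x.1 + Finsupp.single p 1) x.2 J hJ
  rw [hirotaForm_eq, HahnSeries.coeff_sub] at h1
  exact (coeff_sum_mul_nsmul (R := Module.End ℂ FunXLog) (x.1 p + 1) _ _ _ _ J).trans
    ((congrArg ((x.1 p + 1) • ·) (sub_eq_zero.1 h1)).trans
    (coeff_sum_mul_nsmul (R := Module.End ℂ FunXLog) (x.1 p + 1) _ _ _ _ J).symm)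

/-! ## The bilinear identities -/

/-- The coefficient of λ^{-M-1} in the term of branch `i`. All fractional exponents add up to a
multiple of `k * m`, so the branch factors cancel and the result does not depend on `i`: the average
over the branches is the term itself. -/
theorem represents_termA (hk : 1 ≤ k) (hm : 1 ≤ m) (i e : ℕ) (r : ℤ) (M : ℤ)
    (a : ℕ → Fock k m) (τ : Fock k m) {T : Module.End ℂ FunXLog}
    {T₀ : Module.End ℂ FunX} (h : ∀ f, T (toLog f) = toLog (T₀ f)) :
    Represents
      (coeffLam (k * m * (M + 1)) (MvPowerSeries.C (prefA k m i) *
        (seriesOf (spreadFun m (branchNeg k m i) a) *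
          MvPowerSeries.C (HahnSeries.single (-((m * e : ℕ) : ℤ))
            (branch k m i ((m * e : ℕ) : ℤ) • T) * lamPow (branch k m i (m * r)) (m * r)) *
          seriesOf (plusPart (-fInfA k m i) r τ))))
      ((k : ℂ)⁻¹ • pairing a (fun j => shift (r : ℂ) (aFunNeg τ j)) (liftX T₀)
        (r + 1 + e + k * M)) := by
  have h1 : plusPart (-fInfA k m i) r τ =
      spreadFun m (branchNeg k m i) (fun j => shift (r : ℂ) (aFunNeg τ j)) := by
    funext j
    rw [plusPart, expPlus_neg_fInfA hk hm, map_spreadFun]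
  have h2 := represents_lamPow_term ((k : ℂ)⁻¹ * branch k m i (m * (1 - k))) (branch k m i (m * r))
    (m * (1 - k)) (m * r) (-((m * e : ℕ) : ℤ)) (k * m * (M + 1))
    (T := branch k m i ((m * e : ℕ) : ℤ) • T) (T₀ := branch k m i ((m * e : ℕ) : ℤ) • T₀)
    (fun f => by rw [LinearMap.smul_apply, LinearMap.smul_apply, toLog_smul, h])
    (spreadFun m (branchNeg k m i) a)
    (spreadFun m (branchNeg k m i) (fun j => shift (r : ℂ) (aFunNeg τ j)))
  have h3 : (k * m * (M + 1) - (-((m * e : ℕ) : ℤ) - (m * (1 - k) + m * r)) : ℤ) =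
      m * (r + 1 + e + k * M) := by
    push_cast
    ring
  have h4 : branch k m i (-(m * (r + 1 + e + k * M))) *
      ((k : ℂ)⁻¹ * branch k m i (m * (1 - k)) * branch k m i (m * r) *
        branch k m i ((m * e : ℕ) : ℤ)) = (k : ℂ)⁻¹ := by
    have h5 : branch k m i (-(m * (r + 1 + e + k * M))) * branch k m i (m * (1 - k)) *
        branch k m i (m * r) * branch k m i ((m * e : ℕ) : ℤ) = 1 := by
      rw [← branch_add, ← branch_add, ← branch_add, ← branch_mul hk hm i (-(M + 1))]
      congr 1
      push_cast
      ring
    linear_combination (k : ℂ)⁻¹ * h5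
  rw [h3, liftX_smul, smul_smul, pairing_spreadFun hm, h4] at h2
  rw [h1]
  exact h2

/-- The same cancellation for the other family; the factor Q of the prefactor and Q^r from the
displacement by εr combine into Q^{r+1}. -/
theorem represents_termB (hk : 1 ≤ k) (hm : 1 ≤ m) (logQ : ℂ) (i e : ℕ) (r : ℤ) (M : ℤ)
    (a : ℕ → Fock k m) (τ : Fock k m) {T : Module.End ℂ FunXLog}
    {T₀ : Module.End ℂ FunX} (h : ∀ f, T (toLog f) = toLog (T₀ f)) :
    Represents
      (coeffLam (k * m * (M + 1)) (MvPowerSeries.C (prefB k m logQ i) *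
        (seriesOf (spreadFun k (branchNeg k m i) a) *
          MvPowerSeries.C (HahnSeries.single (-((k * e : ℕ) : ℤ))
            (branch k m i ((k * e : ℕ) : ℤ) • T) *
              lamPow (branch k m i (-(k * r)) * Complex.exp (r * logQ)) (-(k * r))) *
          seriesOf (plusPart (-fInfB k m logQ i) r τ))))
      (((m : ℂ)⁻¹ * Complex.exp ((r + 1) * logQ)) •
        pairing a (fun j => shift (r : ℂ) (bFunNeg τ j)) (liftX T₀)
          (e - (r + 1) + m * M)) := by
  have h1 : plusPart (-fInfB k m logQ i) r τ =
      spreadFun k (branchNeg k m i) (fun j => shift (r : ℂ) (bFunNeg τ j)) := by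
    funext j
    rw [plusPart, expPlus_neg_fInfB hk hm, map_spreadFun]
  have h2 := represents_lamPow_term
    (Complex.exp logQ * (m : ℂ)⁻¹ * branch k m i (-(k * (1 + m))))
    (branch k m i (-(k * r)) * Complex.exp (r * logQ))
    (-(k * (1 + m))) (-(k * r)) (-((k * e : ℕ) : ℤ)) (k * m * (M + 1))
    (T := branch k m i ((k * e : ℕ) : ℤ) • T) (T₀ := branch k m i ((k * e : ℕ) : ℤ) • T₀)
    (fun f => by rw [LinearMap.smul_apply, LinearMap.smul_apply, toLog_smul, h])
    (spreadFun k (branchNeg k m i) a)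
    (spreadFun k (branchNeg k m i) (fun j => shift (r : ℂ) (bFunNeg τ j)))
  have h3 : (k * m * (M + 1) - (-((k * e : ℕ) : ℤ) - (-(k * (1 + m)) + -(k * r))) : ℤ) =
      k * (e - (r + 1) + m * M) := by
    push_cast
    ring
  have h4 : branch k m i (-(k * (e - (r + 1) + m * M))) *
      (Complex.exp logQ * (m : ℂ)⁻¹ * branch k m i (-(k * (1 + m))) *
        (branch k m i (-(k * r)) * Complex.exp (r * logQ)) *
        branch k m i ((k * e : ℕ) : ℤ)) = (m : ℂ)⁻¹ * Complex.exp ((r + 1) * logQ) := by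
    have h5 : branch k m i (-(k * (e - (r + 1) + m * M))) * branch k m i (-(k * (1 + m))) *
        branch k m i (-(k * r)) * branch k m i ((k * e : ℕ) : ℤ) = 1 := by
      rw [← branch_add, ← branch_add, ← branch_add, ← branch_mul hk hm i (-(M + 1))]
      congr 1
      push_cast
      ring
    have h6 : Complex.exp ((r + 1) * logQ) = Complex.exp (r * logQ) * Complex.exp logQ := by
      rw [← Complex.exp_add]; ring_nf
    rw [h6]
    linear_combination ((m : ℂ)⁻¹ * Complex.exp (r * logQ) * Complex.exp logQ) * h5
  rw [h3, liftX_smul, smul_smul, pairing_spreadFun hk, h4] at h2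
  rw [h1]
  exact h2

theorem sum_inv_smul {R : Type} [Ring R] [Algebra ℂ R] {k : ℕ} (hk : 1 ≤ k) (c : ℂ) (x : R) :
    ∑ _i ∈ Finset.range k, ((k : ℂ)⁻¹ * c) • x = c • x := by
  have hk0 : (k : ℂ) ≠ 0 := Nat.cast_ne_zero.2 (by omega)
  rw [Finset.sum_const, Finset.card_range, ← Nat.cast_smul_eq_nsmul ℂ, smul_smul, ← mul_assoc,
    mul_inv_cancel₀ hk0, one_mul]

theorem sum_inv_smul_one {R : Type} [Ring R] [Algebra ℂ R] {k : ℕ} (hk : 1 ≤ k) (x : R) :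
    ∑ _i ∈ Finset.range k, (k : ℂ)⁻¹ • x = x := by
  have h := sum_inv_smul hk 1 x
  simpa using h

theorem single_branch_one (c i : ℕ) :
    (HahnSeries.single (-((c * 0 : ℕ) : ℤ)) (branch k m i ((c * 0 : ℕ) : ℤ) •
      (1 : Module.End ℂ FunXLog)) : LamOp) = 1 := by
  rw [mul_zero, Nat.cast_zero, branch_zero, neg_zero, one_smul]
  rfl

theorem plusPart_fInfA (hk : 1 ≤ k) (hm : 1 ≤ m) (i : ℕ) (τ : Fock k m) :
    plusPart (fInfA k m i) 0 τ = spreadFun m (branchNeg k m i) (aFun τ) := by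
  funext j
  rw [plusPart, Int.cast_zero, shift_zero, expPlus_fInfA hk hm]
  rfl

theorem plusPart_fInfB (hk : 1 ≤ k) (hm : 1 ≤ m) (logQ : ℂ) (i : ℕ) (τ : Fock k m) :
    plusPart (fInfB k m logQ i) 0 τ = spreadFun k (branchNeg k m i) (bFun τ) := by
  funext j
  rw [plusPart, Int.cast_zero, shift_zero, expPlus_fInfB hk hm]
  rfl

theorem vertexSharp_mul_deltaA (hk : 1 ≤ k) (hm : 1 ≤ m) (i : ℕ) (r : ℤ) (τ : Fock k m) :
    vertexSharp (fInfA k m i) τ * deltaA i r τ =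
      seriesOf (spreadFun m (branchNeg k m i) (aFun τ)) *
        MvPowerSeries.C (HahnSeries.single (-((m * 0 : ℕ) : ℤ))
          (branch k m i ((m * 0 : ℕ) : ℤ) • 1) * lamPow (branch k m i (m * r)) (m * r)) *
        seriesOf (plusPart (-fInfA k m i) r τ) := by
  rw [single_branch_one, deltaA, vertexSharp_mul_vertexDelta, plusPart_fInfA hk hm]
  exact congrArg (fun x => _ * MvPowerSeries.C x * _) (one_mul (_ : LamOp)).symm

theorem vertexSharp_mul_deltaB (hk : 1 ≤ k) (hm : 1 ≤ m) (logQ : ℂ) (i : ℕ) (r : ℤ)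
    (τ : Fock k m) :
    vertexSharp (fInfB k m logQ i) τ * deltaB logQ i r τ =
      seriesOf (spreadFun k (branchNeg k m i) (bFun τ)) *
        MvPowerSeries.C (HahnSeries.single (-((k * 0 : ℕ) : ℤ))
          (branch k m i ((k * 0 : ℕ) : ℤ) • 1) *
            lamPow (branch k m i (-(k * r)) * Complex.exp (r * logQ)) (-(k * r))) *
        seriesOf (plusPart (-fInfB k m logQ i) r τ) := by
  rw [single_branch_one, deltaB, vertexSharp_mul_vertexDelta, plusPart_fInfB hk hm]
  exact congrArg (fun x => _ * MvPowerSeries.C x * _) (one_mul (_ : LamOp)).symm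

theorem pd_vertexSharp_mul_deltaA (hk : 1 ≤ k) (hm : 1 ≤ m) (i : ℕ) (r : ℤ) (τ : Fock k m)
    (p : Idx k m) :
    pd p (vertexSharp (fInfA k m i) τ) * deltaA i r τ =
      seriesOf (spreadFun m (branchNeg k m i) (fun j => dq p.1.1 p.1.2 (aFun τ j))) *
        MvPowerSeries.C (HahnSeries.single (-((m * 0 : ℕ) : ℤ))
          (branch k m i ((m * 0 : ℕ) : ℤ) • 1) * lamPow (branch k m i (m * r)) (m * r)) *
        seriesOf (plusPart (-fInfA k m i) r τ) +
      seriesOf (spreadFun m (branchNeg k m i) (aFun τ)) *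
        MvPowerSeries.C (HahnSeries.single (-((m * (p.1.1 * k + k - p.1.2) : ℕ) : ℤ))
          (branch k m i ((m * (p.1.1 * k + k - p.1.2) : ℕ) : ℤ) •
            flowLog (flowA k p.1.1 p.1.2) (flowB₁ k p.1.1 p.1.2)) *
              lamPow (branch k m i (m * r)) (m * r)) *
        seriesOf (plusPart (-fInfA k m i) r τ) := by
  have h : (fun j => dq p.1.1 p.1.2 (plusPart (fInfA k m i) 0 τ j)) =
      spreadFun m (branchNeg k m i) (fun j => dq p.1.1 p.1.2 (aFun τ j)) := by
    funext j
    rw [plusPart_fInfA hk hm, map_spreadFun]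
  rw [single_branch_one, deltaA, pd_vertexSharp_mul_vertexDelta, h, plusPart_fInfA hk hm,
    flowCoeff_fInfA hk hm]
  exact congrArg (fun x => _ * MvPowerSeries.C x * _ + _) (one_mul (_ : LamOp)).symm

theorem pd_vertexSharp_mul_deltaB (hk : 1 ≤ k) (hm : 1 ≤ m) (logQ : ℂ) (i : ℕ) (r : ℤ)
    (τ : Fock k m) (p : Idx k m) :
    pd p (vertexSharp (fInfB k m logQ i) τ) * deltaB logQ i r τ =
      seriesOf (spreadFun k (branchNeg k m i) (fun j => dq p.1.1 p.1.2 (bFun τ j))) *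
        MvPowerSeries.C (HahnSeries.single (-((k * 0 : ℕ) : ℤ))
          (branch k m i ((k * 0 : ℕ) : ℤ) • 1) *
            lamPow (branch k m i (-(k * r)) * Complex.exp (r * logQ)) (-(k * r))) *
        seriesOf (plusPart (-fInfB k m logQ i) r τ) +
      seriesOf (spreadFun k (branchNeg k m i) (bFun τ)) *
        MvPowerSeries.C (HahnSeries.single (-((k * (p.1.2 - k + p.1.1 * m) : ℕ) : ℤ))
          (branch k m i ((k * (p.1.2 - k + p.1.1 * m) : ℕ) : ℤ) •
            flowLog (flowA k p.1.1 p.1.2) (flowB₂ k m p.1.1 p.1.2)) *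
              lamPow (branch k m i (-(k * r)) * Complex.exp (r * logQ)) (-(k * r))) *
        seriesOf (plusPart (-fInfB k m logQ i) r τ) := by
  have h : (fun j => dq p.1.1 p.1.2 (plusPart (fInfB k m logQ i) 0 τ j)) =
      spreadFun k (branchNeg k m i) (fun j => dq p.1.1 p.1.2 (bFun τ j)) := by
    funext j
    rw [plusPart_fInfB hk hm, map_spreadFun]
  rw [single_branch_one, deltaB, pd_vertexSharp_mul_vertexDelta, h, plusPart_fInfB hk hm,
    flowCoeff_fInfB hk hm]
  exact congrArg (fun x => _ * MvPowerSeries.C x * _ + _) (one_mul (_ : LamOp)).symm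

/-- The operator `a ∂_x + b ε⁻¹` in one variable. -/
def flowX (a b : ℂ) : Module.End ℂ FunX := a • derivX + b • LinearMap.mulLeft ℂ Eps.epsInv

/-- The operator `a ∂_x + b ε⁻¹` on formal functions. -/
def flowOp (a b : ℂ) : FockOp k m := liftX (flowX a b)

theorem flowLog_toLog (a b : ℂ) (f : FunX) : flowLog a b (toLog f) = toLog (flowX a b f) := by
  have h1 : flowLog a b (toLog f) = a • derivXLog (toLog f) + b • (Eps.epsInv * toLog f) := rfl
  have h2 : flowX a b f = a • derivX f + b • (Eps.epsInv * f) := rfl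
  have h3 : toLog (a • derivX f + b • (Eps.epsInv * f)) =
      toLog (a • derivX f) + toLog (b • (Eps.epsInv * f)) := map_add toLogHom _ _
  have h4 : toLog (Eps.epsInv * f) = Eps.epsInv * toLog f := by
    rw [← toLog_epsInv]; exact map_mul toLogHom _ _
  rw [h1, h2, h3, derivXLog_toLog, toLog_smul, toLog_smul, h4]

theorem SatisfiesHQE.bilinear (hk : 1 ≤ k) (hm : 1 ≤ m) {logQ : ℂ} {τ : Fock k m}
    (h : SatisfiesHQE k m logQ τ) (r : ℤ) (M : ℕ) :
    pairing (aFun τ) (fun j => shift (r : ℂ) (aFunNeg τ j)) 1 (r + 1 + k * M) =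
      Complex.exp ((r + 1) * logQ) •
        pairing (bFun τ) (fun j => shift (r : ℂ) (bFunNeg τ j)) 1 (-(r + 1) + m * M) := by
  have hJ : (0 : ℤ) < k * m * (M + 1) := by positivity
  have h0 := h.sum_eq r hJ
  have hA := Represents.sum (Finset.range k) fun i _ =>
    represents_termA hk hm i 0 r M (aFun τ) τ (T := 1) (T₀ := 1) fun f => rfl
  have hB := Represents.sum (Finset.range m) fun i _ =>
    represents_termB hk hm logQ i 0 r M (bFun τ) τ (T := 1) (T₀ := 1) fun f => rfl
  simp only [← vertexSharp_mul_deltaA hk hm, ← vertexSharp_mul_deltaB hk hm] at hA hB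
  rw [h0] at hA
  have h1 := hA.unique hB
  rw [sum_inv_smul_one (R := FockOp k m) hk, sum_inv_smul (R := FockOp k m) hm, liftX_one,
    Nat.cast_zero, add_zero, zero_sub] at h1
  exact h1

/-- For the flows the coefficient of λ⁻¹ suffices; the power of λ multiplying the flow operator is
absorbed in the degree of the second pairing on each side. -/
theorem SatisfiesHQE.bilinear_pd (hk : 1 ≤ k) (hm : 1 ≤ m) {logQ : ℂ} {τ : Fock k m}
    (h : SatisfiesHQE k m logQ τ) (r : ℤ) (p : Idx k m) :
    pairing (fun j => dq p.1.1 p.1.2 (aFun τ j)) (fun j => shift (r : ℂ) (aFunNeg τ j)) 1 (r + 1) +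
      pairing (aFun τ) (fun j => shift (r : ℂ) (aFunNeg τ j))
        (flowOp (flowA k p.1.1 p.1.2) (flowB₁ k p.1.1 p.1.2))
        (r + 1 + (p.1.1 * k + k - p.1.2 : ℕ)) =
    Complex.exp ((r + 1) * logQ) •
      pairing (fun j => dq p.1.1 p.1.2 (bFun τ j)) (fun j => shift (r : ℂ) (bFunNeg τ j)) 1
        (-(r + 1)) +
    Complex.exp ((r + 1) * logQ) •
      pairing (bFun τ) (fun j => shift (r : ℂ) (bFunNeg τ j))
        (flowOp (flowA k p.1.1 p.1.2) (flowB₂ k m p.1.1 p.1.2))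
        ((p.1.2 - k + p.1.1 * m : ℕ) - (r + 1)) := by
  have hJ : (0 : ℤ) < k * m * (0 + 1) := by positivity
  have h0 := h.sum_pd_eq p r hJ
  have hA := (Represents.sum (Finset.range k) fun i _ =>
    represents_termA hk hm i 0 r 0 (fun j => dq p.1.1 p.1.2 (aFun τ j)) τ (T := 1) (T₀ := 1)
      fun f => rfl).add (Represents.sum (Finset.range k) fun i _ =>
    represents_termA hk hm i (p.1.1 * k + k - p.1.2) r 0 (aFun τ) τ
      (flowLog_toLog (flowA k p.1.1 p.1.2) (flowB₁ k p.1.1 p.1.2)))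
  have hB := (Represents.sum (Finset.range m) fun i _ =>
    represents_termB hk hm logQ i 0 r 0 (fun j => dq p.1.1 p.1.2 (bFun τ j)) τ (T := 1) (T₀ := 1)
      fun f => rfl).add (Represents.sum (Finset.range m) fun i _ =>
    represents_termB hk hm logQ i (p.1.2 - k + p.1.1 * m) r 0 (bFun τ) τ
      (flowLog_toLog (flowA k p.1.1 p.1.2) (flowB₂ k m p.1.1 p.1.2)))
  rw [← Finset.sum_add_distrib] at hA hB
  simp only [← map_add, ← mul_add, ← pd_vertexSharp_mul_deltaA hk hm,
    ← pd_vertexSharp_mul_deltaB hk hm] at hA hB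
  rw [h0] at hA
  have h1 := hA.unique hB
  rw [sum_inv_smul_one (R := FockOp k m) hk, sum_inv_smul_one (R := FockOp k m) hk,
    sum_inv_smul (R := FockOp k m) hm, sum_inv_smul (R := FockOp k m) hm, liftX_one,
    Nat.cast_zero, add_zero, zero_sub, mul_zero, mul_zero, add_zero, add_zero, add_zero,
    add_zero] at h1
  exact h1

end

/-! ### Algebra of one-sided series, conjugation, and operators on the Fock space. -/

section

/-! ## One-sided series over an arbitrary ring -/

section Hahn

variable {R : Type} [Ring R]

theorem coeff_C_mul_mul_C (a b : R) (X : HahnSeries ℤ R) (s : ℤ) :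
    (HahnSeries.C a * X * HahnSeries.C b).coeff s = a * X.coeff s * b := by
  rw [HahnSeries.C_apply, HahnSeries.C_apply, HahnSeries.coeff_mul_single_zero,
    HahnSeries.coeff_single_zero_mul]

theorem coeff_hahn_mul_eq_zero {X Y : HahnSeries ℤ R} {a b s : ℤ} (hX : ∀ i < a, X.coeff i = 0)
    (hY : ∀ i < b, Y.coeff i = 0) (hs : s < a + b) : (X * Y).coeff s = 0 := by
  rw [HahnSeries.coeff_mul]
  refine Finset.sum_eq_zero fun x hx => ?_
  obtain ⟨-, -, h⟩ := Finset.mem_antidiagonal.1 hx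
  rcases lt_or_ge x.1 a with h1 | h1
  · rw [hX _ h1, zero_mul]
  · rw [hY _ (by omega), mul_zero]

/-- A summand vanishes unless `i` and `j - i` lie in the two supports, which leaves the finite
antidiagonal of the product of Hahn series. -/
theorem finsum_coeff_mul_coeff (X Y : HahnSeries ℤ R) (j : ℤ) :
    ∑ᶠ i : ℤ, X.coeff i * Y.coeff (j - i) = (X * Y).coeff j := by
  classical
  rw [HahnSeries.coeff_mul]
  rw [finsum_eq_sum_of_support_subset
    (s := (Finset.antidiagonal X.isPWO_support Y.isPWO_support j).image Prod.fst)]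
  · rw [Finset.sum_image]
    · refine Finset.sum_congr rfl fun x hx => ?_
      obtain ⟨-, -, h⟩ := Finset.mem_antidiagonal.1 hx
      congr 2
      omega
    · intro x hx y hy h
      obtain ⟨-, -, h1⟩ := Finset.mem_antidiagonal.1 hx
      obtain ⟨-, -, h2⟩ := Finset.mem_antidiagonal.1 hy
      exact Prod.ext h (by omega)
  · intro i hi
    rw [Function.mem_support] at hi
    rw [Finset.coe_image]
    refine ⟨(i, j - i), ?_, rfl⟩
    rw [Finset.mem_coe, Finset.mem_antidiagonal]
    refine ⟨?_, ?_, by simp⟩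
    · rw [HahnSeries.mem_support]
      intro h
      exact hi (by rw [h, zero_mul])
    · rw [HahnSeries.mem_support]
      intro h
      exact hi (by dsimp only at h; rw [h, mul_zero])

theorem finsum_coeff_neg_mul_coeff_neg (X Y : HahnSeries ℤ R) (j : ℤ) :
    ∑ᶠ i : ℤ, X.coeff (-i) * Y.coeff (-(j - i)) = (X * Y).coeff (-j) := by
  rw [← finsum_coeff_mul_coeff, ← finsum_comp_equiv (Equiv.neg ℤ)]
  refine finsum_congr fun i => ?_
  rw [Equiv.neg_apply, neg_neg]
  congr 2
  ring

theorem isUnit_ofPowerSeries {x : PowerSeries R} (h : IsUnit (PowerSeries.coeff 0 x)) :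
    ∃ y : PowerSeries R, HahnSeries.ofPowerSeries ℤ R x * HahnSeries.ofPowerSeries ℤ R y = 1 ∧
      HahnSeries.ofPowerSeries ℤ R y * HahnSeries.ofPowerSeries ℤ R x = 1 := by
  obtain ⟨u, hu⟩ := h
  rw [PowerSeries.coeff_zero_eq_constantCoeff_apply] at hu
  refine ⟨PowerSeries.invOfUnit x u, ?_, ?_⟩
  · rw [← map_mul, PowerSeries.mul_invOfUnit x u hu.symm, map_one]
  · rw [← map_mul, PowerSeries.invOfUnit_mul x u hu.symm, map_one]

end Hahn

/-! ## Conjugation -/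

section Conj

variable {S : Type} [Ring S]

/-- `P X P⁻¹`. -/
def conjBy (P X : S) : S := P * X * Ring.inverse P

theorem conjBy_mul {P : S} (hP : IsUnit P) (X Y : S) :
    conjBy P X * conjBy P Y = conjBy P (X * Y) := by
  have h := Ring.inverse_mul_cancel P hP
  unfold conjBy
  calc P * X * Ring.inverse P * (P * Y * Ring.inverse P)
      = P * X * (Ring.inverse P * P) * Y * Ring.inverse P := by noncomm_ring
    _ = P * (X * Y) * Ring.inverse P := by rw [h]; noncomm_ring

theorem conjBy_one {P : S} (hP : IsUnit P) : conjBy P 1 = 1 := by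
  rw [conjBy, mul_one, Ring.mul_inverse_cancel P hP]

theorem conjBy_pow {P : S} (hP : IsUnit P) (X : S) (n : ℕ) :
    conjBy P X ^ n = conjBy P (X ^ n) := by
  induction n with
  | zero => rw [pow_zero, pow_zero, conjBy_one hP]
  | succ n ih => rw [pow_succ, pow_succ, ih, conjBy_mul hP]

theorem conjBy_add (P X Y : S) : conjBy P (X + Y) = conjBy P X + conjBy P Y := by
  unfold conjBy; noncomm_ring

theorem conjBy_mul_right {P X : S} {c : S} (h : Commute c P) :
    conjBy P (c * X) = c * conjBy P X := by
  unfold conjBy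
  rw [← mul_assoc, ← h.eq]
  noncomm_ring

theorem conjBy_smul [Algebra ℂ S] (P X : S) (c : ℂ) : conjBy P (c • X) = c • conjBy P X := by
  unfold conjBy
  rw [mul_smul_comm, smul_mul_assoc]

/-- `[D, P] P⁻¹`. -/
def logDeriv (D P : S) : S := (D * P - P * D) * Ring.inverse P

theorem logDeriv_add_conjBy {P : S} (hP : IsUnit P) (D : S) :
    logDeriv D P + conjBy P D = D := by
  have h := Ring.mul_inverse_cancel P hP
  unfold logDeriv conjBy
  calc (D * P - P * D) * Ring.inverse P + P * D * Ring.inverse P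
      = D * (P * Ring.inverse P) := by noncomm_ring
    _ = D := by rw [h, mul_one]

/-- Write D = [D, P]P⁻¹ + PDP⁻¹; the second summand commutes with PXP⁻¹. This is the passage from
the flow of a dressing operator to the Lax equation. -/
theorem commutator_conjBy {P : S} (hP : IsUnit P) {D X : S} (h : Commute D X) :
    D * conjBy P X - conjBy P X * D =
      logDeriv D P * conjBy P X - conjBy P X * logDeriv D P := by
  have h1 := logDeriv_add_conjBy hP D
  have h2 : conjBy P D * conjBy P X = conjBy P X * conjBy P D := by
    rw [conjBy_mul hP, conjBy_mul hP, h.eq]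
  calc D * conjBy P X - conjBy P X * D
      = (logDeriv D P + conjBy P D) * conjBy P X - conjBy P X * (logDeriv D P + conjBy P D) := by
        rw [h1]
    _ = logDeriv D P * conjBy P X - conjBy P X * logDeriv D P +
        (conjBy P D * conjBy P X - conjBy P X * conjBy P D) := by noncomm_ring
    _ = _ := by rw [h2, sub_self, add_zero]

/-- If `A = t P` and `P B = d` then `A X B = t (P X P⁻¹) d`. -/
theorem mul_mul_eq_conjBy {P A B t d : S} (hP : IsUnit P) (hA : A = t * P) (hB : P * B = d)
    (X : S) : A * X * B = t * conjBy P X * d := by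
  have h := Ring.inverse_mul_cancel P hP
  unfold conjBy
  calc A * X * B = t * P * X * (1 * B) := by rw [hA, one_mul]
    _ = t * P * X * ((Ring.inverse P * P) * B) := by rw [h]
    _ = t * (P * X * Ring.inverse P) * (P * B) := by noncomm_ring
    _ = _ := by rw [hB]

/-- The first summand depends on `t` and `d` alone. It is therefore the same for both dressing
operators and drops out on comparison. -/
theorem commutator_mul_eq {P A B t d D : S} (hP : IsUnit P) (hA : A = t * P) (hB : P * B = d) :
    (D * A - A * D) * B = (D * t - t * D) * d + t * logDeriv D P * d := by
  have h := Ring.inverse_mul_cancel P hP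
  unfold logDeriv
  calc (D * A - A * D) * B = (D * t - t * D) * (P * B) + t * (D * P - P * D) * (1 * B) := by
        rw [hA]; noncomm_ring
    _ = (D * t - t * D) * (P * B) + t * (D * P - P * D) * ((Ring.inverse P * P) * B) := by rw [h]
    _ = (D * t - t * D) * (P * B) + t * ((D * P - P * D) * Ring.inverse P) * (P * B) := by
        noncomm_ring
    _ = _ := by rw [hB]

end Conj

/-! ## Operators on the Fock space -/

variable {k m : ℕ}

theorem mulOp_mul (f g : Fock k m) : mulOp f * mulOp g = mulOp (f * g) :=
  LinearMap.ext fun h => (mul_assoc f g h).symm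

theorem mulOp_one : (mulOp 1 : FockOp k m) = 1 := LinearMap.ext fun h => one_mul h

theorem mulOp_add (f g : Fock k m) : mulOp (f + g) = mulOp f + mulOp g :=
  LinearMap.ext fun h => add_mul f g h

theorem isUnit_mulOp {f : Fock k m} (h : IsUnit f) : IsUnit (mulOp f) := by
  obtain ⟨u, rfl⟩ := h
  refine ⟨⟨mulOp u, mulOp ↑u⁻¹, ?_, ?_⟩, rfl⟩
  · rw [mulOp_mul, Units.mul_inv, mulOp_one]
  · rw [mulOp_mul, Units.inv_mul, mulOp_one]

/-- The translations are ring homomorphisms. -/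
def shiftXHom (c : ℂ) : FunX →+* FunX where
  toFun := shiftX c
  map_one' := HahnSeries.map_one (Polynomial.taylorAlgHom c).toRingHom.toMonoidWithZeroHom
  map_mul' _ _ := HahnSeries.map_mul (Polynomial.taylorAlgHom c).toRingHom.toNonUnitalRingHom
  map_zero' := map_zero _
  map_add' := map_add _

theorem shift_apply_mul (c : ℂ) (f g : Fock k m) : shift c (f * g) = shift c f * shift c g :=
  map_mul (MvPowerSeries.map (shiftXHom c)) f g

theorem shift_apply_one (c : ℂ) : shift c (1 : Fock k m) = 1 :=
  map_one (MvPowerSeries.map (shiftXHom c))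

theorem shift_mul_mulOp (c : ℂ) (f : Fock k m) :
    shift c * mulOp f = mulOp (shift c f) * shift c :=
  LinearMap.ext fun h => shift_apply_mul c f h

theorem shift_shift (a b : ℂ) (f : Fock k m) : shift a (shift b f) = shift (a + b) f := by
  rw [← shift_mul_shift]; rfl

theorem isUnit_shift_apply (c : ℂ) {f : Fock k m} (h : IsUnit f) : IsUnit (shift c f) :=
  h.map (MvPowerSeries.map (shiftXHom c))

theorem mulOp_C (e : FunX) : (mulOp (MvPowerSeries.C e) : FockOp k m) =
    liftX (LinearMap.mulLeft ℂ e) :=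
  LinearMap.ext fun _ => MvPowerSeries.ext fun _ => MvPowerSeries.coeff_C_mul _ _ _

theorem commute_liftX {φ ψ : Module.End ℂ FunX} (h : Commute φ ψ) :
    Commute (liftX φ : FockOp k m) (liftX ψ) := congrArg liftX h

theorem commute_mulOp (f g : Fock k m) : Commute (mulOp f) (mulOp g) := by
  rw [Commute, SemiconjBy, mulOp_mul, mulOp_mul, mul_comm]

theorem taylor_derivative (c : ℂ) (f : ℂ[X]) :
    Polynomial.taylor c (derivative f) = derivative (Polynomial.taylor c f) := by
  rw [Polynomial.taylor_apply, Polynomial.taylor_apply, Polynomial.derivative_comp]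
  simp

theorem coeff_derivX (f : FunX) (n : ℤ) : (derivX f).coeff n = derivative (f.coeff (n + 1)) :=
  Eps.coeff_epsInv_mul _ n

theorem commute_derivX_shiftX (c : ℂ) : Commute derivX (shiftX c) := by
  refine LinearMap.ext fun f => Eps.ext fun n => ?_
  rw [Module.End.mul_apply, Module.End.mul_apply, coeff_derivX, coeff_shiftX, coeff_shiftX,
    coeff_derivX, taylor_derivative]

theorem commute_epsInv_shiftX (c : ℂ) : Commute (LinearMap.mulLeft ℂ Eps.epsInv) (shiftX c) := by
  refine LinearMap.ext fun f => Eps.ext fun n => ?_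
  rw [Module.End.mul_apply, Module.End.mul_apply, coeff_shiftX, LinearMap.mulLeft_apply,
    LinearMap.mulLeft_apply, Eps.coeff_epsInv_mul, Eps.coeff_epsInv_mul, coeff_shiftX]

theorem commute_flowX_shiftX (a b c : ℂ) : Commute (flowX a b) (shiftX c) :=
  ((commute_derivX_shiftX c).smul_left a).add_left ((commute_epsInv_shiftX c).smul_left b)

theorem commute_flowOp_shift (a b c : ℂ) : Commute (flowOp a b : FockOp k m) (shift c) :=
  commute_liftX (commute_flowX_shiftX a b c)

theorem flowOp_eq (a b : ℂ) : (flowOp a b : FockOp k m) = a • dx + b • epsInvOp := by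
  rw [epsInvOp, mulOp_C]; rfl

theorem commute_epsInvOp_shift (c : ℂ) : Commute (epsInvOp : FockOp k m) (shift c) := by
  rw [epsInvOp, mulOp_C]
  exact commute_liftX (commute_epsInv_shiftX c)

theorem epsInvOp_mul_epsOp : (epsInvOp * epsOp : FockOp k m) = 1 := by
  rw [epsInvOp, epsOp, mulOp_mul, ← map_mul, mul_comm, Eps.eps_mul_epsInv, map_one, mulOp_one]

theorem coeff_dq (p : Idx k m) (f : Fock k m) (d : Idx k m →₀ ℕ) :
    MvPowerSeries.coeff d (dq p.1.1 p.1.2 f) =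
      (d p + 1) • MvPowerSeries.coeff (d + Finsupp.single p 1) f := by
  rw [dq_idx]
  refine (MvPowerSeries.coeff_pderiv (R := FunX) (i := p) f d).trans ?_
  rw [mul_comm, nsmul_eq_mul]
  push_cast
  rfl

theorem commute_dq_liftX (p : Idx k m) (φ : Module.End ℂ FunX) :
    Commute (dq p.1.1 p.1.2) (liftX φ : FockOp k m) := by
  refine LinearMap.ext fun f => MvPowerSeries.ext fun d => ?_
  rw [Module.End.mul_apply, Module.End.mul_apply, coeff_dq]
  change _ = φ (MvPowerSeries.coeff d (dq p.1.1 p.1.2 f))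
  rw [coeff_dq, map_nsmul]
  rfl

theorem dq_mul (p : Idx k m) (f g : Fock k m) :
    dq p.1.1 p.1.2 (f * g) = dq p.1.1 p.1.2 f * g + f * dq p.1.1 p.1.2 g := by
  rw [dq_idx]
  refine ((MvPowerSeries.pderiv FunX p).leibniz f g).trans ?_
  rw [add_comm, smul_eq_mul, smul_eq_mul, mul_comm g]
  rfl

theorem dq_mul_mulOp_sub (p : Idx k m) (f : Fock k m) :
    dq p.1.1 p.1.2 * mulOp f - mulOp f * dq p.1.1 p.1.2 = mulOp (dq p.1.1 p.1.2 f) := by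
  refine LinearMap.ext fun h => ?_
  change dq p.1.1 p.1.2 (f * h) - f * dq p.1.1 p.1.2 h = dq p.1.1 p.1.2 f * h
  rw [dq_mul, add_sub_cancel_right]

theorem dq_zero : (dq 0 k : FockOp k m) = dx :=
  (dif_neg fun h => h.2.2 rfl).trans (if_pos rfl)

theorem commute_dq_shift {n β : ℕ} (h1 : 1 ≤ β) (h2 : β ≤ k + m) (c : ℂ) :
    Commute (dq n β : FockOp k m) (shift c) := by
  by_cases h : (n, β) = (0, k)
  · rw [Prod.mk.injEq] at h
    obtain ⟨rfl, rfl⟩ := h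
    rw [dq_zero]
    exact commute_liftX (commute_derivX_shiftX c)
  · exact commute_dq_liftX ⟨(n, β), h1, h2, h⟩ _

end

/-! ### Bilinear identities as products of difference operators. -/

section

variable {k m : ℕ}

/-! ## The wave operators -/

/-- The series `∑ (a j) Λ ^ j`. -/
def upSeries (a : ℕ → Fock k m) : OneSided k m :=
  HahnSeries.ofPowerSeries ℤ _ (PowerSeries.mk fun j => mulOp (a j) * shift (j : ℂ))

/-- The series `∑ (b j) (Q Λ) ^ (-j)`. -/
def downSeries (logQ : ℂ) (b : ℕ → Fock k m) : OneSided k m :=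
  HahnSeries.ofPowerSeries ℤ _ (PowerSeries.mk fun j =>
    Complex.exp (-(j * logQ)) • (mulOp (b j) * shift (-(j : ℂ))))

/-- `O Λ ^ (-e)`, as a series in powers of `Λ`. -/
def upTerm (O : FockOp k m) (e : ℕ) : OneSided k m :=
  HahnSeries.single (-(e : ℤ)) (O * shift (-(e : ℂ)))

/-- `O (Q Λ) ^ e`, as a series in powers of `Λ⁻¹`. -/
def downTerm (logQ : ℂ) (O : FockOp k m) (e : ℕ) : OneSided k m :=
  HahnSeries.single (-(e : ℤ)) (O * (Complex.exp (e * logQ) • shift (e : ℂ)))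

theorem lamNeg_eq (e : ℕ) : (lamNeg e : OneSided k m) = upTerm 1 e :=
  congrArg (HahnSeries.single (-(e : ℤ))) (one_mul (shift (-(e : ℂ)) : FockOp k m)).symm

theorem lamQ_eq (logQ : ℂ) (e : ℕ) : (lamQ logQ e : OneSided k m) = downTerm logQ 1 e :=
  congrArg (HahnSeries.single (-(e : ℤ)))
    (one_mul (Complex.exp (e * logQ) • shift (e : ℂ) : FockOp k m)).symm

theorem normal_order {R : Type} [Ring R] {x s₁ O s₂ g s₃ s g' s₄ : R} (h1 : s₁ * (O * s₂) = O * s)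
    (h2 : s * g = g' * s) (h3 : s * s₃ = s₄) :
    x * s₁ * (O * s₂) * (g * s₃) = x * O * g' * s₄ := by
  calc x * s₁ * (O * s₂) * (g * s₃) = x * (s₁ * (O * s₂)) * (g * s₃) := by noncomm_ring
    _ = x * O * (s * g) * s₃ := by rw [h1]; noncomm_ring
    _ = x * O * g' * (s * s₃) := by rw [h2]; noncomm_ring
    _ = _ := by rw [h3]

theorem shift_mul_mul_shift {O : FockOp k m} (hO : ∀ c, Commute O (shift c)) (a b : ℂ) :
    shift a * (O * shift b) = O * shift (a + b) := by
  rw [← mul_assoc, ← (hO a).eq, mul_assoc, shift_mul_shift]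

/-- The translation by `j - 1` in the last series is chosen so that, after Λ^{i-e} has been moved
past `c j`, the total translation i - e + j - 1 equals `r` in every term of degree r + 1. So one
product collects the pairings for all `r`. -/
theorem coeff_upSeries_mul (a c : ℕ → Fock k m) {O : FockOp k m}
    (hO : ∀ c, Commute O (shift c)) (e : ℕ) (r : ℤ) :
    (upSeries a * upTerm O e * upSeries fun j => shift ((j : ℂ) - 1) (c j)).coeff (r + 1) =
      pairing a (fun j => shift (r : ℂ) (c j)) O (r + 1 + e) * shift ((r + 1 : ℤ) : ℂ) := by
  refine (coeff_ofPowerSeries_mul (R := FockOp k m) _ _ _ _ _).trans ?_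
  rw [sub_neg_eq_add]
  refine Eq.trans (conv_congr fun i j hij => ?_)
    (map_conv (AddMonoidHom.mulRight (shift ((r + 1 : ℤ) : ℂ) : FockOp k m)) _ _).symm
  have hij' : (i : ℂ) + j = r + 1 + e := by exact_mod_cast hij
  refine normal_order (R := FockOp k m) (shift_mul_mul_shift hO _ _) ?_ ?_
  · rw [shift_mul_mulOp, shift_shift]
    exact congrArg (fun x => mulOp (shift x (c j)) * shift _) (by linear_combination hij')
  · rw [shift_mul_shift]
    congr 1
    push_cast
    linear_combination hij'

theorem smul_normal_order {R : Type} [Ring R] [Algebra ℂ R] (c₁ c₂ c₃ : ℂ) (X O s₂ Y : R) :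
    (c₁ • X) * (O * (c₂ • s₂)) * (c₃ • Y) = (c₁ * c₂ * c₃) • (X * (O * s₂) * Y) := by
  simp only [mul_smul_comm, smul_mul_assoc, smul_smul]
  congr 1
  ring

/-- Now degree r + 1 means i + j = e - (r + 1): the total translation e - i - j - 1 is again `r`,
and the powers of Q combine into Q^{r+1}, as the bilinear identity requires. -/
theorem coeff_downSeries_mul (logQ : ℂ) (b c : ℕ → Fock k m) {O : FockOp k m}
    (hO : ∀ c, Commute O (shift c)) (e : ℕ) (r : ℤ) :
    (downSeries logQ b * downTerm logQ O e *
      downSeries logQ fun j => shift (-(j : ℂ) - 1) (c j)).coeff (-(r + 1)) =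
      (Complex.exp ((r + 1) * logQ) • pairing b (fun j => shift (r : ℂ) (c j)) O (e - (r + 1))) *
        shift ((r + 1 : ℤ) : ℂ) := by
  refine (coeff_ofPowerSeries_mul (R := FockOp k m) _ _ _ _ _).trans ?_
  rw [sub_neg_eq_add, neg_add_eq_sub, smul_mul_assoc]
  refine Eq.trans (conv_congr fun i j hij => ?_)
    (map_conv ((DistribSMul.toAddMonoidHom (FockOp k m) (Complex.exp ((r + 1) * logQ))).comp
      (AddMonoidHom.mulRight (shift ((r + 1 : ℤ) : ℂ) : FockOp k m))) _ _).symm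
  have hij' : (i : ℂ) + j = e - (r + 1) := by exact_mod_cast hij
  refine (smul_normal_order (R := FockOp k m) _ _ _ _ _ _ _).trans ?_
  have h1 : Complex.exp (-(i * logQ)) * Complex.exp (e * logQ) * Complex.exp (-(j * logQ)) =
      Complex.exp ((r + 1) * logQ) := by
    rw [← Complex.exp_add, ← Complex.exp_add]
    congr 1
    linear_combination (-logQ) * hij'
  rw [h1]
  refine congrArg (Complex.exp ((r + 1) * logQ) • ·)
    (normal_order (R := FockOp k m) (shift_mul_mul_shift hO _ _) ?_ ?_)
  · rw [shift_mul_mulOp, shift_shift]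
    exact congrArg (fun x => mulOp (shift x (c j)) * shift _) (by linear_combination -hij')
  · rw [shift_mul_shift]
    congr 1
    push_cast
    linear_combination -hij'

theorem commute_one_shift (c : ℂ) : Commute (1 : FockOp k m) (shift c) := Commute.one_left _

/-- The series `Ã`, with `A Ã` a function. -/
def upDual (τ : Fock k m) : OneSided k m := upSeries fun j => shift ((j : ℂ) - 1) (aFunNeg τ j)

/-- The series `B̃`, with `B B̃` a function. -/
def downDual (logQ : ℂ) (τ : Fock k m) : OneSided k m :=
  downSeries logQ fun j => shift (-(j : ℂ) - 1) (bFunNeg τ j)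

section HQE

variable {logQ : ℂ} {τ : Fock k m}

theorem SatisfiesHQE.coeff_eq (hk : 1 ≤ k) (hm : 1 ≤ m) (h : SatisfiesHQE k m logQ τ) (M : ℕ)
    (s : ℤ) :
    (upSeries (aFun τ) * lamNeg (k * M) * upDual τ).coeff s =
      (downSeries logQ (bFun τ) * lamQ logQ (m * M) * downDual logQ τ).coeff (-s) := by
  -- Degree s in Λ corresponds to the displacement by r = s - 1 in the HQE.
  obtain ⟨r, rfl⟩ : ∃ r, s = r + 1 := ⟨s - 1, by ring⟩
  rw [lamNeg_eq, lamQ_eq, upDual, downDual, coeff_upSeries_mul _ _ commute_one_shift,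
    coeff_downSeries_mul _ _ _ commute_one_shift, Nat.cast_mul, Nat.cast_mul,
    h.bilinear hk hm r M, neg_add_eq_sub]

theorem SatisfiesHQE.coeff_flow_eq (hk : 1 ≤ k) (hm : 1 ≤ m) (h : SatisfiesHQE k m logQ τ)
    (p : Idx k m) (s : ℤ) :
    (upSeries (fun j => dq p.1.1 p.1.2 (aFun τ j)) * upTerm 1 0 * upDual τ).coeff s +
      (upSeries (aFun τ) * upTerm (flowOp (flowA k p.1.1 p.1.2) (flowB₁ k p.1.1 p.1.2))
        (p.1.1 * k + k - p.1.2) * upDual τ).coeff s =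
    (downSeries logQ (fun j => dq p.1.1 p.1.2 (bFun τ j)) * downTerm logQ 1 0 *
        downDual logQ τ).coeff (-s) +
      (downSeries logQ (bFun τ) *
        downTerm logQ (flowOp (flowA k p.1.1 p.1.2) (flowB₂ k m p.1.1 p.1.2))
          (p.1.2 - k + p.1.1 * m) * downDual logQ τ).coeff (-s) := by
  obtain ⟨r, rfl⟩ : ∃ r, s = r + 1 := ⟨s - 1, by ring⟩
  rw [upDual, downDual, coeff_upSeries_mul _ _ commute_one_shift,
    coeff_downSeries_mul _ _ _ commute_one_shift,
    coeff_upSeries_mul _ _ (commute_flowOp_shift _ _),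
    coeff_downSeries_mul _ _ _ (commute_flowOp_shift _ _), Nat.cast_zero, add_zero, zero_sub]
  have h1 := congrArg (· * (shift ((r + 1 : ℤ) : ℂ) : FockOp k m)) (h.bilinear_pd hk hm r p)
  exact (add_mul (R := FockOp k m) _ _ _).symm.trans
    (h1.trans (add_mul (R := FockOp k m) _ _ _))

end HQE

theorem upTerm_one_zero : (upTerm 1 0 : OneSided k m) = 1 := by
  rw [upTerm, Nat.cast_zero, Nat.cast_zero, neg_zero, neg_zero, shift_zero]
  exact congrArg (HahnSeries.single 0) (one_mul (1 : FockOp k m))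

theorem downTerm_one_zero (logQ : ℂ) : (downTerm logQ 1 0 : OneSided k m) = 1 := by
  rw [downTerm, Nat.cast_zero, Nat.cast_zero, neg_zero, shift_zero, zero_mul, Complex.exp_zero,
    one_smul]
  exact congrArg (HahnSeries.single 0) (one_mul (1 : FockOp k m))

/-! ## The dressing operators -/

theorem aFun_eq {τ : Fock k m} (hτ : IsUnit τ) (j : ℕ) : aFun τ j = τ * symbol₁ τ j :=
  (Ring.mul_inverse_cancel_left _ _ hτ).symm

theorem bFun_eq {τ : Fock k m} (hτ : IsUnit τ) (j : ℕ) : bFun τ j = τ * symbol₂ τ j :=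
  (Ring.mul_inverse_cancel_left _ _ hτ).symm

theorem C_mul_ofPowerSeries_mk {R : Type} [Ring R] (t : R) (a : ℕ → R) :
    HahnSeries.C t * HahnSeries.ofPowerSeries ℤ R (PowerSeries.mk a) =
      HahnSeries.ofPowerSeries ℤ R (PowerSeries.mk fun j => t * a j) := by
  rw [← HahnSeries.ofPowerSeries_C, ← map_mul]
  congr 1
  ext1 n
  rw [PowerSeries.coeff_C_mul, PowerSeries.coeff_mk, PowerSeries.coeff_mk]

theorem upSeries_aFun {τ : Fock k m} (hτ : IsUnit τ) :
    upSeries (aFun τ) = HahnSeries.C (mulOp τ) * P₁ τ := by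
  refine Eq.trans ?_ (C_mul_ofPowerSeries_mk (R := FockOp k m) _ _).symm
  refine congrArg (fun a => HahnSeries.ofPowerSeries ℤ (FockOp k m) (PowerSeries.mk a))
    (funext fun j => ?_)
  rw [aFun_eq hτ, ← mulOp_mul, mul_assoc]

theorem downSeries_bFun (logQ : ℂ) {τ : Fock k m} (hτ : IsUnit τ) :
    downSeries logQ (bFun τ) = HahnSeries.C (mulOp τ) * P₂ logQ τ := by
  refine Eq.trans ?_ (C_mul_ofPowerSeries_mk (R := FockOp k m) _ _).symm
  refine congrArg (fun a => HahnSeries.ofPowerSeries ℤ (FockOp k m) (PowerSeries.mk a))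
    (funext fun j => ?_)
  rw [bFun_eq hτ, ← mulOp_mul, mul_assoc]
  exact (mul_smul_comm (β := FockOp k m) _ _ _).symm

theorem aFun_zero (τ : Fock k m) : aFun τ 0 = τ := by
  rw [aFun, coeff_zero_expPS]; rfl

theorem aFunNeg_zero (τ : Fock k m) : aFunNeg τ 0 = τ := by
  rw [aFunNeg, coeff_zero_expPS]; rfl

theorem bFun_zero (τ : Fock k m) : bFun τ 0 = shift (-1) τ := by
  rw [bFun, coeff_zero_expPS]; rfl

theorem symbol₁_zero {τ : Fock k m} (hτ : IsUnit τ) : symbol₁ τ 0 = 1 := by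
  have h := aFun_eq hτ 0
  rw [aFun_zero] at h
  exact hτ.mul_left_cancel (h.symm.trans (mul_one τ).symm)

/-- The leading coefficient of `P₂` is the quotient of Λ⁻¹(τ) by τ; unlike that of `P₁` it need not
be 1. -/
theorem isUnit_symbol₂_zero {τ : Fock k m} (hτ : IsUnit τ) : IsUnit (symbol₂ τ 0) := by
  have h := bFun_eq hτ 0
  rw [bFun_zero] at h
  exact isUnit_of_mul_isUnit_right (h ▸ isUnit_shift_apply (-1) hτ)

/-- The inverse is produced as a power series, not merely as a Hahn series, so that its coefficients
of negative index are known to vanish. -/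
theorem exists_inverse_P₁ {τ : Fock k m} (hτ : IsUnit τ) : ∃ y : PowerSeries (FockOp k m),
    P₁ τ * HahnSeries.ofPowerSeries ℤ _ y = 1 ∧ HahnSeries.ofPowerSeries ℤ _ y * P₁ τ = 1 := by
  refine isUnit_ofPowerSeries (R := FockOp k m) ?_
  rw [PowerSeries.coeff_mk, symbol₁_zero hτ, Nat.cast_zero, shift_zero, mulOp_one, mul_one]
  exact isUnit_one

theorem exists_inverse_P₂ (logQ : ℂ) {τ : Fock k m} (hτ : IsUnit τ) :
    ∃ y : PowerSeries (FockOp k m), P₂ logQ τ * HahnSeries.ofPowerSeries ℤ _ y = 1 ∧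
      HahnSeries.ofPowerSeries ℤ _ y * P₂ logQ τ = 1 := by
  refine isUnit_ofPowerSeries (R := FockOp k m) ?_
  rw [PowerSeries.coeff_mk, Nat.cast_zero, neg_zero, shift_zero, zero_mul, neg_zero,
    Complex.exp_zero, one_smul, mul_one]
  exact isUnit_mulOp (isUnit_symbol₂_zero hτ)

theorem isUnit_P₁ {τ : Fock k m} (hτ : IsUnit τ) : IsUnit (P₁ τ) := by
  obtain ⟨y, h1, h2⟩ := exists_inverse_P₁ hτ
  exact ⟨⟨P₁ τ, _, h1, h2⟩, rfl⟩

theorem isUnit_P₂ (logQ : ℂ) {τ : Fock k m} (hτ : IsUnit τ) : IsUnit (P₂ logQ τ) := by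
  obtain ⟨y, h1, h2⟩ := exists_inverse_P₂ logQ hτ
  exact ⟨⟨P₂ logQ τ, _, h1, h2⟩, rfl⟩

theorem coeff_ofPowerSeries_of_neg {R : Type} [Ring R] (x : PowerSeries R) {z : ℤ} (hz : z < 0) :
    (HahnSeries.ofPowerSeries ℤ R x).coeff z = 0 := by
  rw [coeff_ofPowerSeries, if_neg (by omega)]

theorem inverse_eq_of_mul_eq_one {S : Type} [Ring S] {x y : S} (h1 : x * y = 1) (h2 : y * x = 1) :
    Ring.inverse x = y := Ring.inverse_unit ⟨x, y, h1, h2⟩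

theorem coeff_inverse_P₁ {τ : Fock k m} (hτ : IsUnit τ) {s : ℤ} (hs : s < 0) :
    (Ring.inverse (P₁ τ)).coeff s = 0 := by
  obtain ⟨y, h1, h2⟩ := exists_inverse_P₁ hτ
  rw [inverse_eq_of_mul_eq_one (S := OneSided k m) h1 h2]
  exact coeff_ofPowerSeries_of_neg (R := FockOp k m) y hs

theorem coeff_inverse_P₂ (logQ : ℂ) {τ : Fock k m} (hτ : IsUnit τ) {s : ℤ} (hs : s < 0) :
    (Ring.inverse (P₂ logQ τ)).coeff s = 0 := by
  obtain ⟨y, h1, h2⟩ := exists_inverse_P₂ logQ hτ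
  rw [inverse_eq_of_mul_eq_one (S := OneSided k m) h1 h2]
  exact coeff_ofPowerSeries_of_neg (R := FockOp k m) y hs

end

section

variable {k m : ℕ}

/-! ## The bilinear identities in terms of the dressing operators -/

section Generic

variable {R : Type} [Ring R]

theorem eq_C_of_coeff_eq_zero {X : HahnSeries ℤ R} (h : ∀ s, s ≠ 0 → X.coeff s = 0) :
    X = HahnSeries.C (X.coeff 0) := by
  ext1
  funext s
  rw [HahnSeries.C_apply, HahnSeries.coeff_single]
  split_ifs with hs
  · rw [hs]
  · exact h s hs

theorem coeff_C_neg (x : R) (s : ℤ) :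
    (HahnSeries.C x : HahnSeries ℤ R).coeff s = (HahnSeries.C x : HahnSeries ℤ R).coeff (-s) := by
  rw [HahnSeries.C_apply, HahnSeries.coeff_single, HahnSeries.coeff_single]
  split_ifs <;> first | rfl | omega

theorem coeff_ofPowerSeries_mul_eq_zero {x y : PowerSeries R} {s : ℤ} (hs : s < 0) :
    (HahnSeries.ofPowerSeries ℤ R x * HahnSeries.ofPowerSeries ℤ R y).coeff s = 0 := by
  rw [← map_mul]
  exact coeff_ofPowerSeries_of_neg _ hs

theorem commutator_C_ofPowerSeries_mk (d : R) (a : ℕ → R) :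
    HahnSeries.C d * HahnSeries.ofPowerSeries ℤ R (PowerSeries.mk a) -
        HahnSeries.ofPowerSeries ℤ R (PowerSeries.mk a) * HahnSeries.C d =
      HahnSeries.ofPowerSeries ℤ R (PowerSeries.mk fun j => d * a j - a j * d) := by
  rw [← HahnSeries.ofPowerSeries_C, ← map_mul, ← map_mul, ← map_sub]
  congr 1
  ext1 n
  rw [map_sub, PowerSeries.coeff_C_mul, PowerSeries.coeff_mul_C, PowerSeries.coeff_mk,
    PowerSeries.coeff_mk]

theorem commutator_mul_of_commute {d x s : R} (h : Commute d s) :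
    d * (x * s) - x * s * d = (d * x - x * d) * s := by
  rw [sub_mul, mul_assoc x s d, ← h.eq]
  noncomm_ring

theorem smul_commutator [Algebra ℂ R] (c : ℂ) (d x : R) :
    d * (c • x) - (c • x) * d = c • (d * x - x * d) := by
  rw [mul_smul_comm, smul_mul_assoc, smul_sub]

theorem coeff_conj_cancel {X Y : HahnSeries ℤ R} {t d : R} (ht : IsUnit t) (hd : IsUnit d)
    {s s' : ℤ} (h : (HahnSeries.C t * X * HahnSeries.C d).coeff s =
      (HahnSeries.C t * Y * HahnSeries.C d).coeff s') : X.coeff s = Y.coeff s' := by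
  rw [coeff_C_mul_mul_C, coeff_C_mul_mul_C] at h
  exact ht.mul_left_cancel (hd.mul_right_cancel h)

end Generic

theorem commutator_dq_upSeries (p : Idx k m) (a : ℕ → Fock k m) :
    HahnSeries.C (dq p.1.1 p.1.2) * upSeries a - upSeries a * HahnSeries.C (dq p.1.1 p.1.2) =
      upSeries fun j => dq p.1.1 p.1.2 (a j) := by
  refine (commutator_C_ofPowerSeries_mk (R := FockOp k m) _ _).trans ?_
  refine congrArg (fun a => HahnSeries.ofPowerSeries ℤ (FockOp k m) (PowerSeries.mk a))
    (funext fun j => ?_)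
  refine (commutator_mul_of_commute (R := FockOp k m) (commute_dq_liftX p _)).trans ?_
  rw [dq_mul_mulOp_sub]
  rfl

theorem commutator_dq_downSeries (logQ : ℂ) (p : Idx k m) (a : ℕ → Fock k m) :
    HahnSeries.C (dq p.1.1 p.1.2) * downSeries logQ a -
        downSeries logQ a * HahnSeries.C (dq p.1.1 p.1.2) =
      downSeries logQ fun j => dq p.1.1 p.1.2 (a j) := by
  refine (commutator_C_ofPowerSeries_mk (R := FockOp k m) _ _).trans ?_
  refine congrArg (fun a => HahnSeries.ofPowerSeries ℤ (FockOp k m) (PowerSeries.mk a))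
    (funext fun j => ?_)
  refine (smul_commutator (R := FockOp k m) _ _ _).trans ?_
  refine congrArg _ ((commutator_mul_of_commute (R := FockOp k m) (commute_dq_liftX p _)).trans ?_)
  rw [dq_mul_mulOp_sub]
  rfl

section HQE

variable {logQ : ℂ} {τ : Fock k m}

theorem lamNeg_zero : (lamNeg 0 : OneSided k m) = 1 := by rw [lamNeg_eq, upTerm_one_zero]

theorem lamQ_zero : (lamQ logQ 0 : OneSided k m) = 1 := by rw [lamQ_eq, downTerm_one_zero]

theorem coeff_zero_upSeries_mul_upDual :
    (upSeries (aFun τ) * upDual τ).coeff 0 = mulOp τ * mulOp (shift (-1) τ) := by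
  -- Degree 0 is the case r = -1, where the pairing consists of the single term i = j = 0.
  have h := coeff_upSeries_mul (aFun τ) (aFunNeg τ) commute_one_shift 0 (-1)
  rw [upTerm_one_zero] at h
  have h1 : (upSeries (aFun τ) * 1 : OneSided k m) = upSeries (aFun τ) := mul_one _
  have h2 : (-1 : ℤ) + 1 = 0 := by norm_num
  have h3 : (-1 : ℤ) + 1 + (0 : ℕ) = 0 := by norm_num
  rw [h1, h3, h2, pairing, conv_zero, aFun_zero, aFunNeg_zero, Int.cast_zero, shift_zero, mul_one,
    mul_one] at h
  refine h.trans ?_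
  norm_num

/-- A series in Λ coincides with a series in Λ⁻¹, so both reduce to the term of degree 0. This
consequence of the HQE with M = 0 replaces the dual series by the inverse dressing operators. -/
theorem SatisfiesHQE.upSeries_mul_upDual (hk : 1 ≤ k) (hm : 1 ≤ m)
    (h : SatisfiesHQE k m logQ τ) :
    upSeries (aFun τ) * upDual τ = HahnSeries.C (mulOp τ * mulOp (shift (-1) τ)) ∧
      downSeries logQ (bFun τ) * downDual logQ τ =
        HahnSeries.C (mulOp τ * mulOp (shift (-1) τ)) := by
  have h0 : ∀ s, (upSeries (aFun τ) * upDual τ).coeff s =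
      (downSeries logQ (bFun τ) * downDual logQ τ).coeff (-s) := by
    intro s
    have h1 := h.coeff_eq hk hm 0 s
    rw [mul_zero, mul_zero, lamNeg_zero, lamQ_zero] at h1
    have h2 : (upSeries (aFun τ) * 1 : OneSided k m) = upSeries (aFun τ) := mul_one _
    have h3 : (downSeries logQ (bFun τ) * 1 : OneSided k m) = downSeries logQ (bFun τ) := mul_one _
    rwa [h2, h3] at h1
  have hup : ∀ s : ℤ, s < 0 → (upSeries (aFun τ) * upDual τ).coeff s = 0 :=
    fun s hs => coeff_ofPowerSeries_mul_eq_zero (R := FockOp k m) hs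
  have hdown : ∀ s : ℤ, s < 0 → (downSeries logQ (bFun τ) * downDual logQ τ).coeff s = 0 :=
    fun s hs => coeff_ofPowerSeries_mul_eq_zero (R := FockOp k m) hs
  have h00 := coeff_zero_upSeries_mul_upDual (τ := τ)
  constructor
  · rw [← h00]
    refine eq_C_of_coeff_eq_zero (R := FockOp k m) fun s hs => ?_
    rcases lt_or_gt_of_ne hs with hs | hs
    · exact hup s hs
    · rw [h0]; exact hdown _ (by omega)
  · rw [← h00, h0, neg_zero]
    refine eq_C_of_coeff_eq_zero (R := FockOp k m) fun s hs => ?_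
    rcases lt_or_gt_of_ne hs with hs | hs
    · exact hdown s hs
    · have h5 := h0 (-s)
      rw [neg_neg] at h5
      rw [← h5]; exact hup _ (by omega)

theorem isUnit_C_mulOp {f : Fock k m} (hf : IsUnit f) :
    IsUnit (HahnSeries.C (mulOp f) : OneSided k m) := by
  obtain ⟨u, hu⟩ := isUnit_mulOp hf
  rw [← hu]
  exact (Units.map (HahnSeries.C : FockOp k m →+* OneSided k m).toMonoidHom u).isUnit

theorem cancel_left_aux {S : Type} [Ring S] {t P B d : S} (ht : IsUnit t)
    (h : t * P * B = t * d) : P * B = d := ht.mul_left_cancel ((mul_assoc t P B).symm.trans h)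

theorem SatisfiesHQE.P₁_mul_upDual (hk : 1 ≤ k) (hm : 1 ≤ m) (hτ : IsUnit τ)
    (h : SatisfiesHQE k m logQ τ) :
    P₁ τ * upDual τ = HahnSeries.C (mulOp (shift (-1) τ)) := by
  have h1 := (h.upSeries_mul_upDual hk hm).1
  rw [upSeries_aFun hτ, map_mul] at h1
  exact cancel_left_aux (S := OneSided k m) (isUnit_C_mulOp hτ) h1

theorem SatisfiesHQE.P₂_mul_downDual (hk : 1 ≤ k) (hm : 1 ≤ m) (hτ : IsUnit τ)
    (h : SatisfiesHQE k m logQ τ) :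
    P₂ logQ τ * downDual logQ τ = HahnSeries.C (mulOp (shift (-1) τ)) := by
  have h1 := (h.upSeries_mul_upDual hk hm).2
  rw [downSeries_bFun logQ hτ, map_mul] at h1
  exact cancel_left_aux (S := OneSided k m) (isUnit_C_mulOp hτ) h1

theorem SatisfiesHQE.upSeries_mul_mul (hk : 1 ≤ k) (hm : 1 ≤ m) (hτ : IsUnit τ)
    (h : SatisfiesHQE k m logQ τ) (X : OneSided k m) :
    upSeries (aFun τ) * X * upDual τ =
      HahnSeries.C (mulOp τ) * conj₁ τ X * HahnSeries.C (mulOp (shift (-1) τ)) :=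
  mul_mul_eq_conjBy (S := OneSided k m) (isUnit_P₁ hτ) (upSeries_aFun hτ)
    (h.P₁_mul_upDual hk hm hτ) X

theorem SatisfiesHQE.downSeries_mul_mul (hk : 1 ≤ k) (hm : 1 ≤ m) (hτ : IsUnit τ)
    (h : SatisfiesHQE k m logQ τ) (X : OneSided k m) :
    downSeries logQ (bFun τ) * X * downDual logQ τ =
      HahnSeries.C (mulOp τ) * conj₂ logQ τ X * HahnSeries.C (mulOp (shift (-1) τ)) :=
  mul_mul_eq_conjBy (S := OneSided k m) (isUnit_P₂ logQ hτ) (downSeries_bFun logQ hτ)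
    (h.P₂_mul_downDual hk hm hτ) X

theorem isUnit_mulOp_shift (hτ : IsUnit τ) : IsUnit (mulOp (shift (-1) τ)) :=
  isUnit_mulOp (isUnit_shift_apply _ hτ)

/-- `P₁ Λ^{-kM} P₁⁻¹ = P₂ (QΛ)^{mM} P₂⁻¹`. -/
theorem SatisfiesHQE.coeff_conj_eq (hk : 1 ≤ k) (hm : 1 ≤ m) (hτ : IsUnit τ)
    (h : SatisfiesHQE k m logQ τ) (M : ℕ) (s : ℤ) :
    (conj₁ τ (lamNeg (k * M))).coeff s = (conj₂ logQ τ (lamQ logQ (m * M))).coeff (-s) := by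
  have h1 := h.coeff_eq hk hm M s
  rw [h.upSeries_mul_mul hk hm hτ, h.downSeries_mul_mul hk hm hτ] at h1
  exact coeff_conj_cancel (R := FockOp k m) (isUnit_mulOp hτ) (isUnit_mulOp_shift hτ) h1

/-- The conjugates of a term without derivatives have functions as coefficients. -/
theorem SatisfiesHQE.coeff_conj₁_lamNeg (hk : 1 ≤ k) (hm : 1 ≤ m) (hτ : IsUnit τ)
    (h : SatisfiesHQE k m logQ τ) (e : ℕ) (s : ℤ) :
    mulOp τ * (conj₁ τ (lamNeg e)).coeff s * mulOp (shift (-1) τ) =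
      pairing (aFun τ) (fun j => shift ((s : ℂ) - 1) (aFunNeg τ j)) 1 (s + e) * shift (s : ℂ) := by
  obtain ⟨r, rfl⟩ : ∃ r, s = r + 1 := ⟨s - 1, by ring⟩
  have h1 := coeff_upSeries_mul (aFun τ) (aFunNeg τ) commute_one_shift e r
  have h2 := h.upSeries_mul_mul hk hm hτ (upTerm 1 e)
  rw [upDual] at h2
  have h3 : ((r + 1 : ℤ) : ℂ) - 1 = r := by push_cast; ring
  rw [h2, coeff_C_mul_mul_C (R := FockOp k m), ← lamNeg_eq] at h1
  rw [h1, h3]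

theorem conv_mulOp (F : ℕ → ℕ → Fock k m) (z : ℤ) :
    conv (fun i j => mulOp (F i j)) z = mulOp (conv F z) :=
  (map_conv (AddMonoidHom.mk' (fun f : Fock k m => mulOp f) mulOp_add) F z).symm

theorem pairing_one (a a' : ℕ → Fock k m) (z : ℤ) :
    pairing a a' 1 z = mulOp (conv (fun i j => a i * a' j) z) := by
  rw [← conv_mulOp]
  refine conv_congr fun i j _ => ?_
  rw [mul_one, mulOp_mul]

theorem SatisfiesHQE.exists_lax_eq (hk : 1 ≤ k) (hm : 1 ≤ m) (hτ : IsUnit τ)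
    (h : SatisfiesHQE k m logQ τ) (s : ℤ) :
    ∃ f : Fock k m, lax τ s = mulOp f * shift (s : ℂ) := by
  have h1 := h.coeff_conj₁_lamNeg hk hm hτ k s
  rw [pairing_one] at h1
  obtain ⟨u, hu⟩ := isUnit_shift_apply (-1) hτ
  obtain ⟨v, rfl⟩ := hτ
  refine ⟨↑v⁻¹ * conv (fun i j => aFun (v : Fock k m) i *
    shift ((s : ℂ) - 1) (aFunNeg (v : Fock k m) j)) (s + k) * shift (s : ℂ) (↑u⁻¹ : Fock k m), ?_⟩
  have h2 : (mulOp (↑v⁻¹ : Fock k m) * mulOp (v : Fock k m) : FockOp k m) = 1 := by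
    rw [mulOp_mul, Units.inv_mul, mulOp_one]
  have h3 : (mulOp (shift (-1) (v : Fock k m)) * mulOp (↑u⁻¹ : Fock k m) : FockOp k m) = 1 := by
    rw [mulOp_mul, ← hu, Units.mul_inv, mulOp_one]
  have h4 : ∀ {R : Type} [Ring R] (a b x c d y : R), a * b = 1 → c * d = 1 → b * x * c = y →
      x = a * y * d := by
    intro R _ a b x c d y hab hcd hy
    calc x = (a * b) * x * (c * d) := by rw [hab, hcd, one_mul, mul_one]
      _ = a * (b * x * c) * d := by noncomm_ring
      _ = _ := by rw [hy]
  refine (h4 (R := FockOp k m) _ _ _ _ _ _ h2 h3 h1).trans ?_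
  -- The inverse of Λ⁻¹(τ) stands to the right of Λ^s; moving it to the left translates it by `s`,
  -- as in the witness.
  rw [mul_assoc, mul_assoc, shift_mul_mulOp, ← mulOp_mul, ← mulOp_mul]
  simp only [mul_assoc]

end HQE

end

/-! ### The Lax operator and the flows of the dressing operators. -/

section

variable {k m : ℕ}

/-! ## Two-sided difference operators -/

theorem coeff_conjBy_eq_zero {R : Type} [Ring R] {P X : HahnSeries ℤ R} {a s : ℤ}
    (hP : ∀ i < 0, P.coeff i = 0) (hP' : ∀ i < 0, (Ring.inverse P).coeff i = 0)
    (hX : ∀ i < a, X.coeff i = 0) (hs : s < a) : (conjBy P X).coeff s = 0 :=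
  coeff_hahn_mul_eq_zero (a := a) (b := 0)
    (fun _ hi => coeff_hahn_mul_eq_zero hP hX (by omega)) hP' (by omega)

theorem coeff_P₁_of_neg (τ : Fock k m) {s : ℤ} (hs : s < 0) : (P₁ τ).coeff s = 0 :=
  coeff_ofPowerSeries_of_neg (R := FockOp k m) _ hs

theorem coeff_P₂_of_neg (logQ : ℂ) (τ : Fock k m) {s : ℤ} (hs : s < 0) :
    (P₂ logQ τ).coeff s = 0 :=
  coeff_ofPowerSeries_of_neg (R := FockOp k m) _ hs

theorem coeff_single_of_lt {R : Type} [Ring R] {a i : ℤ} (x : R) (h : i < a) :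
    (HahnSeries.single a x).coeff i = 0 := by
  rw [HahnSeries.coeff_single, if_neg h.ne]

theorem mulT_ofUp (X Y : OneSided k m) : mulT (ofUp X) (ofUp Y) = ofUp (X * Y) :=
  funext fun j => finsum_coeff_mul_coeff (R := FockOp k m) X Y j

theorem mulT_ofDown (X Y : OneSided k m) : mulT (ofDown X) (ofDown Y) = ofDown (X * Y) :=
  funext fun j => finsum_coeff_neg_mul_coeff_neg (R := FockOp k m) X Y j

theorem finsum_mul_add {R : Type} [Ring R] {f : ℤ → R} (hf : (Function.support f).Finite)
    (g h : ℤ → R) : ∑ᶠ i, f i * (g i + h i) = ∑ᶠ i, f i * g i + ∑ᶠ i, f i * h i := by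
  have hs : ∀ g : ℤ → R, (Function.support fun i => f i * g i).Finite := fun g =>
    hf.subset fun i hi hi' => hi (by dsimp only; rw [hi', zero_mul])
  rw [← finsum_add_distrib (hs g) (hs h)]
  exact finsum_congr fun i => mul_add _ _ _

/-- Finiteness of `A` makes all the sums finite, hence additive. It will be applied to powers of L,
multiplied by the logarithm, which is infinite in both directions. -/
theorem mulT_add {A : TwoSided k m} (hA : (Function.support A).Finite) (B D : TwoSided k m) :
    mulT A (B + D) = mulT A B + mulT A D :=
  funext fun j => finsum_mul_add (R := FockOp k m) hA (fun i => B (j - i)) (fun i => D (j - i))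

theorem ofUp_sub (X Y : OneSided k m) : ofUp (X - Y) = ofUp X - ofUp Y := rfl

theorem ofDown_sub (X Y : OneSided k m) : ofDown (X - Y) = ofDown X - ofDown Y := rfl

theorem ofDown_neg (X : OneSided k m) : ofDown (-X) = -ofDown X := rfl

theorem bracket_ofUp (X Y : OneSided k m) :
    bracket (ofUp X) (ofUp Y) = ofUp (X * Y - Y * X) := by
  rw [bracket, mulT_ofUp, mulT_ofUp, ofUp_sub]

theorem bracket_ofDown (X Y : OneSided k m) :
    bracket (ofDown X) (ofDown Y) = ofDown (X * Y - Y * X) := by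
  rw [bracket, mulT_ofDown, mulT_ofDown, ofDown_sub]

theorem coeff_commutator_C {R : Type} [Ring R] (d : R) (X : HahnSeries ℤ R) (s : ℤ) :
    (HahnSeries.C d * X - X * HahnSeries.C d).coeff s = d * X.coeff s - X.coeff s * d := by
  rw [HahnSeries.coeff_sub, HahnSeries.C_apply, HahnSeries.coeff_mul_single_zero,
    HahnSeries.coeff_single_zero_mul]

theorem dqT_ofUp (n β : ℕ) (X : OneSided k m) :
    dqT n β (ofUp X) = ofUp (HahnSeries.C (dq n β) * X - X * HahnSeries.C (dq n β)) :=
  funext fun s => (coeff_commutator_C (R := FockOp k m) _ X s).symm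

theorem dqT_ofDown (n β : ℕ) (X : OneSided k m) :
    dqT n β (ofDown X) = ofDown (HahnSeries.C (dq n β) * X - X * HahnSeries.C (dq n β)) :=
  funext fun s => (coeff_commutator_C (R := FockOp k m) _ X (-s)).symm

/-! ## The Lax operator -/

section HQE

variable {logQ : ℂ} {τ : Fock k m}

theorem coeff_conj₁_of_lt (hτ : IsUnit τ) {e : ℕ} {s : ℤ} (hs : s < -(e : ℤ)) :
    (conj₁ τ (lamNeg e)).coeff s = 0 :=
  coeff_conjBy_eq_zero (R := FockOp k m) (fun _ => coeff_P₁_of_neg τ)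
    (fun _ => coeff_inverse_P₁ hτ) (fun _ => coeff_single_of_lt (R := FockOp k m) _) hs

theorem coeff_conj₂_of_lt (hτ : IsUnit τ) {e : ℕ} {s : ℤ} (hs : s < -(e : ℤ)) :
    (conj₂ logQ τ (lamQ logQ e)).coeff s = 0 :=
  coeff_conjBy_eq_zero (R := FockOp k m) (fun _ => coeff_P₂_of_neg logQ τ)
    (fun _ => coeff_inverse_P₂ logQ hτ) (fun _ => coeff_single_of_lt (R := FockOp k m) _) hs

theorem SatisfiesHQE.ofUp_conj_eq (hk : 1 ≤ k) (hm : 1 ≤ m) (hτ : IsUnit τ)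
    (h : SatisfiesHQE k m logQ τ) (M : ℕ) :
    ofUp (conj₁ τ (lamNeg (k * M))) = ofDown (conj₂ logQ τ (lamQ logQ (m * M))) :=
  funext fun s => h.coeff_conj_eq hk hm hτ M s

theorem SatisfiesHQE.lax_eq (hk : 1 ≤ k) (hm : 1 ≤ m) (hτ : IsUnit τ)
    (h : SatisfiesHQE k m logQ τ) : lax τ = lax' logQ τ := by
  have h1 := h.ofUp_conj_eq hk hm hτ 1
  rwa [mul_one, mul_one] at h1

theorem SatisfiesHQE.lax_apply_of_lt (hτ : IsUnit τ) {s : ℤ} (hs : s < -(k : ℤ)) :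
    lax τ s = 0 := coeff_conj₁_of_lt hτ hs

theorem SatisfiesHQE.lax_apply_of_gt (hk : 1 ≤ k) (hm : 1 ≤ m) (hτ : IsUnit τ)
    (h : SatisfiesHQE k m logQ τ) {s : ℤ} (hs : (m : ℤ) < s) : lax τ s = 0 := by
  rw [h.lax_eq hk hm hτ]
  exact coeff_conj₂_of_lt hτ (by omega)

/-- In the lowest degree the pairing has the single term τ·Λ^{-k-1}(τ). Since Λ^{-k-1}(τ)Λ^{-k} =
Λ^{-k}∘Λ⁻¹(τ) as operators, the two outer functions cancel. -/
theorem SatisfiesHQE.lax_apply_neg (hk : 1 ≤ k) (hm : 1 ≤ m) (hτ : IsUnit τ)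
    (h : SatisfiesHQE k m logQ τ) : lax τ (-(k : ℤ)) = shift (-(k : ℂ)) := by
  have h1 := h.coeff_conj₁_lamNeg hk hm hτ k (-(k : ℤ))
  rw [neg_add_cancel, pairing, conv_zero, aFun_zero, aFunNeg_zero, mul_one] at h1
  have h2 : mulOp (shift (((-(k : ℤ) : ℤ) : ℂ) - 1) τ) * shift ((-(k : ℤ) : ℤ) : ℂ) =
      (shift (-(k : ℂ)) * mulOp (shift (-1) τ) : FockOp k m) := by
    rw [shift_mul_mulOp, shift_shift, Int.cast_neg, Int.cast_natCast, sub_eq_add_neg]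
  rw [mul_assoc (mulOp τ) (mulOp _) (shift _), h2, ← mul_assoc] at h1
  exact (isUnit_mulOp hτ).mul_left_cancel ((isUnit_mulOp_shift hτ).mul_right_cancel h1)

theorem SatisfiesHQE.exists_coeff (hk : 1 ≤ k) (hm : 1 ≤ m) (hτ : IsUnit τ)
    (h : SatisfiesHQE k m logQ τ) :
    ∃ u : ℤ → Fock k m, (∀ j : ℤ, lax τ j = mulOp (u j) * shift (j : ℂ)) ∧
      u (-(k : ℤ)) = 1 ∧ ∀ j : ℤ, j < -(k : ℤ) ∨ (m : ℤ) < j → u j = 0 := by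
  -- Translations fix the constant 1, so the coefficient of a term u Λ^j is its value at 1.
  refine ⟨fun j => lax τ j 1, fun j => ?_, ?_, ?_⟩
  · obtain ⟨f, hf⟩ := h.exists_lax_eq hk hm hτ j
    have h1 : lax τ j 1 = f := by
      rw [hf, Module.End.mul_apply, shift_apply_one]
      exact mul_one f
    dsimp only
    rw [h1, hf]
  · dsimp only
    rw [h.lax_apply_neg hk hm hτ, shift_apply_one]
  · rintro j (hj | hj)
    · dsimp only
      rw [SatisfiesHQE.lax_apply_of_lt hτ hj]; rfl
    · dsimp only
      rw [h.lax_apply_of_gt hk hm hτ hj]; rfl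

/-! ## The flows of the dressing operators -/

/-- The operator which describes the flow of `q_n^β` of `P₁`. -/
def flow₁ (k m n β : ℕ) : OneSided k m :=
  upTerm (flowOp (flowA k n β) (flowB₁ k n β)) (n * k + k - β)

/-- The operator which describes the flow of `q_n^β` of `P₂`. -/
def flow₂ (k m : ℕ) (logQ : ℂ) (n β : ℕ) : OneSided k m :=
  downTerm logQ (flowOp (flowA k n β) (flowB₂ k m n β)) (β - k + n * m)

theorem coeff_commutator_C_mul_C {R : Type} [Ring R] (d t c : R) (s : ℤ) :
    ((HahnSeries.C d * HahnSeries.C t - HahnSeries.C t * HahnSeries.C d) *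
      HahnSeries.C c : HahnSeries ℤ R).coeff s =
    ((HahnSeries.C d * HahnSeries.C t - HahnSeries.C t * HahnSeries.C d) *
      HahnSeries.C c : HahnSeries ℤ R).coeff (-s) := by
  rw [← map_mul, ← map_mul, ← map_sub, ← map_mul]
  exact coeff_C_neg _ s

/-- Here `c` is the common contribution of the derivative of τ; after it is subtracted, the
invertible outer factors `t` and `d` cancel. -/
theorem coeff_add_eq_of_mul {R : Type} [Ring R] {A₁ A₂ B₁ B₂ C₁ C₂ c : HahnSeries ℤ R} {t d : R}
    {s s' : ℤ} (ht : IsUnit t) (hd : IsUnit d)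
    (hc : c.coeff s = c.coeff s')
    (h1 : A₁ = c + HahnSeries.C t * B₁ * HahnSeries.C d)
    (h2 : A₂ = c + HahnSeries.C t * B₂ * HahnSeries.C d)
    (h : A₁.coeff s + (HahnSeries.C t * C₁ * HahnSeries.C d).coeff s =
      A₂.coeff s' + (HahnSeries.C t * C₂ * HahnSeries.C d).coeff s') :
    (B₁ + C₁).coeff s = (B₂ + C₂).coeff s' := by
  refine coeff_conj_cancel ht hd ?_
  rw [mul_add, mul_add, add_mul, add_mul, HahnSeries.coeff_add, HahnSeries.coeff_add]
  rw [h1, h2, HahnSeries.coeff_add, HahnSeries.coeff_add, hc, add_assoc, add_assoc] at h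
  exact add_left_cancel h

theorem SatisfiesHQE.coeff_flow (hk : 1 ≤ k) (hm : 1 ≤ m) (hτ : IsUnit τ)
    (h : SatisfiesHQE k m logQ τ) (p : Idx k m) (s : ℤ) :
    (logDeriv (HahnSeries.C (dq p.1.1 p.1.2)) (P₁ τ) +
        conj₁ τ (flow₁ k m p.1.1 p.1.2)).coeff s =
      (logDeriv (HahnSeries.C (dq p.1.1 p.1.2)) (P₂ logQ τ) +
        conj₂ logQ τ (flow₂ k m logQ p.1.1 p.1.2)).coeff (-s) := by
  have h1 := h.coeff_flow_eq hk hm p s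
  rw [upTerm_one_zero, downTerm_one_zero, h.upSeries_mul_mul hk hm hτ (upTerm (flowOp _ _) _),
    h.downSeries_mul_mul hk hm hτ (downTerm _ (flowOp _ _) _), ← commutator_dq_upSeries,
    ← commutator_dq_downSeries] at h1
  have h2 := commutator_mul_eq (S := OneSided k m) (D := HahnSeries.C (dq p.1.1 p.1.2))
    (isUnit_P₁ hτ) (upSeries_aFun hτ) (h.P₁_mul_upDual hk hm hτ)
  have h3 := commutator_mul_eq (S := OneSided k m) (D := HahnSeries.C (dq p.1.1 p.1.2))
    (isUnit_P₂ logQ hτ) (downSeries_bFun logQ hτ) (h.P₂_mul_downDual hk hm hτ)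
  have h4 : ∀ {S : Type} [Ring S] (x y : S), x * 1 * y = x * y := by
    intro S _ x y
    rw [mul_one]
  rw [h4 (S := OneSided k m), h4 (S := OneSided k m)] at h1
  refine coeff_add_eq_of_mul (R := FockOp k m) (isUnit_mulOp hτ) (isUnit_mulOp_shift hτ) ?_ h2 h3 h1
  exact coeff_commutator_C_mul_C (R := FockOp k m) _ _ _ s

theorem flow₁_zero : (flow₁ k m 0 k) = HahnSeries.C dx := by
  have h1 : 0 * k + k - k = 0 := by omega
  rw [flow₁, h1, flowA, if_pos rfl, flowB₁, if_neg (lt_irrefl k), if_pos rfl, harm_zero, zero_div,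
    mul_zero, flowOp_eq, upTerm, Nat.cast_zero, Nat.cast_zero, neg_zero, neg_zero, shift_zero,
    mul_one, zero_smul, Nat.factorial_zero, Nat.cast_one, inv_one, one_smul]
  exact congrArg (HahnSeries.single 0) (add_zero (dx : FockOp k m))

theorem flow₂_zero : (flow₂ k m logQ 0 k) = HahnSeries.C dx := by
  have h1 : k - k + 0 * m = 0 := by omega
  rw [flow₂, h1, flowA, if_pos rfl, flowB₂, if_neg (lt_irrefl k), if_pos rfl, harm_zero, zero_div,
    mul_zero, neg_zero, flowOp_eq, downTerm, Nat.cast_zero, Nat.cast_zero, neg_zero, shift_zero,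
    zero_mul, Complex.exp_zero, one_smul, mul_one, zero_smul, Nat.factorial_zero, Nat.cast_one,
    inv_one, one_smul]
  exact congrArg (HahnSeries.single 0) (add_zero (dx : FockOp k m))

/-- The variable q_0^k is not a formal variable of the Fock space, so (n, β) = (0, k) is not covered
by the differentiated HQE. But there both flow operators are ∂_x itself, and each side equals ∂_x
identically. -/
theorem SatisfiesHQE.coeff_flow_all (hk : 1 ≤ k) (hm : 1 ≤ m) (hτ : IsUnit τ)
    (h : SatisfiesHQE k m logQ τ) {n β : ℕ} (h1 : 1 ≤ β) (h2 : β ≤ k + m) (s : ℤ) :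
    (logDeriv (HahnSeries.C (dq n β)) (P₁ τ) + conj₁ τ (flow₁ k m n β)).coeff s =
      (logDeriv (HahnSeries.C (dq n β)) (P₂ logQ τ) +
        conj₂ logQ τ (flow₂ k m logQ n β)).coeff (-s) := by
  by_cases hn : (n, β) = (0, k)
  · rw [Prod.mk.injEq] at hn
    obtain ⟨rfl, rfl⟩ := hn
    rw [flow₁_zero, flow₂_zero, dq_zero]
    have h3 := logDeriv_add_conjBy (S := OneSided β m) (isUnit_P₁ hτ) (HahnSeries.C dx)
    have h4 := logDeriv_add_conjBy (S := OneSided β m) (isUnit_P₂ logQ hτ) (HahnSeries.C dx)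
    refine (congrArg (fun x : OneSided β m => x.coeff s) h3).trans (Eq.trans ?_
      (congrArg (fun x : OneSided β m => x.coeff (-s)) h4).symm)
    exact coeff_C_neg (R := FockOp β m) _ s
  · exact h.coeff_flow hk hm hτ ⟨(n, β), h1, h2, hn⟩ s

end HQE

end

/-! ### Identification of `B_n^β` and the Lax equations. -/

section

variable {k m : ℕ}

/-! ## The operators `B_n^β` -/

section Terms

variable {R : Type} [Ring R] [Algebra ℂ R]

theorem single_smul_eq (z : ℤ) (a : ℂ) (x : R) :
    HahnSeries.single z (a • x) = a • HahnSeries.single z x := by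
  ext1
  funext i
  rw [HahnSeries.coeff_smul, HahnSeries.coeff_single, HahnSeries.coeff_single]
  split_ifs
  · rfl
  · rw [smul_zero]

theorem coeff_smul_add_smul (a b : ℂ) (X Y : HahnSeries ℤ R) (i : ℤ) :
    (a • X + b • Y).coeff i = a • X.coeff i + b • Y.coeff i := by
  rw [HahnSeries.coeff_add, HahnSeries.coeff_smul, HahnSeries.coeff_smul]

theorem coeff_smul_sub_smul (a b : ℂ) (X Y : HahnSeries ℤ R) (i : ℤ) :
    (a • X - b • Y).coeff i = a • X.coeff i - b • Y.coeff i := by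
  rw [HahnSeries.coeff_sub, HahnSeries.coeff_smul, HahnSeries.coeff_smul]

theorem coeff_neg_smul (a : ℂ) (X : HahnSeries ℤ R) (i : ℤ) :
    (-(a • X)).coeff i = -(a • X.coeff i) := by
  rw [HahnSeries.coeff_neg, HahnSeries.coeff_smul]

theorem single_flow {s d e : R} {a b : ℂ} (z : ℤ) (h : Commute d s) :
    HahnSeries.single z ((a • d + b • e) * s) =
      a • (HahnSeries.single z s * HahnSeries.C d) +
        b • (HahnSeries.C e * HahnSeries.single z s) := by
  rw [add_mul, smul_mul_assoc, smul_mul_assoc, h.eq, HahnSeries.C_apply, HahnSeries.C_apply,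
    HahnSeries.single_mul_single, HahnSeries.single_mul_single, add_zero, zero_add,
    HahnSeries.single_add, single_smul_eq, single_smul_eq]

theorem coeff_conjBy_flow {P X Y : HahnSeries ℤ R} {e : R} (a b : ℂ)
    (hE : Commute (HahnSeries.C e) P) (s : ℤ) :
    (conjBy P (a • X + b • (HahnSeries.C e * Y))).coeff s =
      a • (conjBy P X).coeff s + b • (e * (conjBy P Y).coeff s) := by
  rw [conjBy_add, conjBy_smul, conjBy_smul, conjBy_mul_right hE, HahnSeries.coeff_add,
    HahnSeries.coeff_smul, HahnSeries.coeff_smul, HahnSeries.C_apply,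
    HahnSeries.coeff_single_zero_mul]

theorem commute_C_of_coeff {R : Type} [Ring R] {e : R} {X : HahnSeries ℤ R} (h : ∀ i, Commute e (X.coeff i)) :
    Commute (HahnSeries.C e) X := by
  refine commute_of_coeff fun i j => ?_
  rw [HahnSeries.C_apply, HahnSeries.coeff_single]
  split_ifs
  · exact h j
  · exact Commute.zero_left _

theorem commute_C_ofPowerSeries_mk {R : Type} [Ring R] {e : R} {a : ℕ → R} (h : ∀ i, Commute e (a i)) :
    Commute (HahnSeries.C e) (HahnSeries.ofPowerSeries ℤ R (PowerSeries.mk a)) := by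
  refine commute_C_of_coeff fun i => ?_
  rw [coeff_ofPowerSeries]
  split_ifs
  · rw [PowerSeries.coeff_mk]; exact h _
  · exact Commute.zero_right _

theorem coeff_conjBy_mul_C {R : Type} [Ring R] {P X : HahnSeries ℤ R} {e d' d : R} (hE : Commute (HahnSeries.C e) P)
    (hX : Commute (HahnSeries.C e) X) (hd : e * d' = d) (s : ℤ) :
    e * (conjBy P (X * HahnSeries.C d')).coeff s = (conjBy P (X * HahnSeries.C d)).coeff s := by
  have h : conjBy P (X * HahnSeries.C d) = HahnSeries.C e * conjBy P (X * HahnSeries.C d') := by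
    rw [← conjBy_mul_right hE, ← mul_assoc, hX.eq, mul_assoc, ← map_mul, hd]
  rw [h]
  exact HahnSeries.coeff_single_zero_mul.symm

/-- Bookkeeping of the constants in B_n^k: the factor 2/n! undoes the halves in log L, and the
single correction (c_n/2)(1/k + 1/m) is distributed over the two flow operators. -/
theorem log_flow_identity {e P Q p q x : R} (hp : e * P = p) (hq : e * Q = q) {K M N H : ℂ}  :
    e * ((2 / N) • (-((1 / 2 : ℂ) • P) + ((1 / 2 : ℂ) • Q - (H / 2 * (1 / K + 1 / M)) • x))) =
      (N⁻¹ • q + (-(N⁻¹ * (H / M))) • (e * x)) - (N⁻¹ • p + (N⁻¹ * (H / K)) • (e * x)) := by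
  rw [mul_smul_comm, mul_add, mul_neg, mul_sub, mul_smul_comm, mul_smul_comm, mul_smul_comm, hp, hq]
  module

end Terms

theorem commute_epsInvOp_term (f : Fock k m) (c : ℂ) :
    Commute epsInvOp (mulOp f * shift c : FockOp k m) :=
  (commute_mulOp _ f).mul_right (commute_epsInvOp_shift c)

theorem commute_epsInv_P₁ (τ : Fock k m) : Commute (HahnSeries.C epsInvOp) (P₁ τ) :=
  commute_C_ofPowerSeries_mk (R := FockOp k m) fun _ => commute_epsInvOp_term _ _

theorem commute_epsInv_P₂ (logQ : ℂ) (τ : Fock k m) :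
    Commute (HahnSeries.C epsInvOp) (P₂ logQ τ) :=
  commute_C_ofPowerSeries_mk (R := FockOp k m) fun _ =>
    (commute_epsInvOp_term _ _).smul_right _

theorem commute_dx_shift (c : ℂ) : Commute (dx : FockOp k m) (shift c) :=
  commute_liftX (commute_derivX_shiftX c)

theorem commute_epsInv_lamNeg (e : ℕ) :
    Commute (HahnSeries.C epsInvOp) (lamNeg e : OneSided k m) :=
  commute_single_single (R := FockOp k m) (commute_epsInvOp_shift _) _ _

theorem commute_epsInv_lamQ (logQ : ℂ) (e : ℕ) :
    Commute (HahnSeries.C epsInvOp) (lamQ logQ e : OneSided k m) :=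
  commute_single_single (R := FockOp k m) ((commute_epsInvOp_shift _).smul_right _) _ _

theorem lamNeg_pow (e n : ℕ) : (lamNeg e : OneSided k m) ^ n = lamNeg (e * n) := by
  induction n with
  | zero => rw [pow_zero, mul_zero, lamNeg_zero]
  | succ n ih =>
    rw [pow_succ, ih]
    refine (HahnSeries.single_mul_single (R := FockOp k m)).trans ?_
    rw [shift_mul_shift, lamNeg]
    have h1 : -((e * n : ℕ) : ℤ) + -(e : ℤ) = -((e * (n + 1) : ℕ) : ℤ) := by push_cast; ring
    have h2 : -((e * n : ℕ) : ℂ) + -(e : ℂ) = -((e * (n + 1) : ℕ) : ℂ) := by push_cast; ring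
    rw [h1, h2]

theorem lamQ_pow (logQ : ℂ) (e n : ℕ) :
    (lamQ logQ e : OneSided k m) ^ n = lamQ logQ (e * n) := by
  induction n with
  | zero => rw [pow_zero, mul_zero, lamQ_zero]
  | succ n ih =>
    rw [pow_succ, ih]
    refine (HahnSeries.single_mul_single (R := FockOp k m)).trans ?_
    rw [smul_mul_smul_comm, shift_mul_shift, ← Complex.exp_add, lamQ]
    have h1 : -((e * n : ℕ) : ℤ) + -(e : ℤ) = -((e * (n + 1) : ℕ) : ℤ) := by push_cast; ring
    have h2 : ((e * n : ℕ) : ℂ) + (e : ℂ) = ((e * (n + 1) : ℕ) : ℂ) := by push_cast; ring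
    rw [h1, ← add_mul, h2]

section HQE

variable {logQ : ℂ} {τ : Fock k m}

theorem rootK_eq (hτ : IsUnit τ) (j : ℕ) : rootK τ j = ofUp (conj₁ τ (lamNeg j)) := by
  have h := conjBy_pow (S := OneSided k m) (isUnit_P₁ hτ) (lamNeg 1) j
  rw [lamNeg_pow, one_mul] at h
  exact congrArg ofUp h

theorem rootM_eq (hτ : IsUnit τ) (j : ℕ) :
    rootM logQ τ j = ofDown (conj₂ logQ τ (lamQ logQ j)) := by
  have h := conjBy_pow (S := OneSided k m) (isUnit_P₂ logQ hτ) (lamQ logQ 1) j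
  rw [lamQ_pow, one_mul] at h
  exact congrArg ofDown h

theorem laxPow_eq (hτ : IsUnit τ) (n : ℕ) : laxPow τ n = ofUp (conj₁ τ (lamNeg (k * n))) := by
  have h := conjBy_pow (S := OneSided k m) (isUnit_P₁ hτ) (lamNeg k) n
  rw [lamNeg_pow] at h
  exact congrArg ofUp h

theorem coeff_conj₁_flow₁ (τ : Fock k m) (n β : ℕ) (s : ℤ) :
    (conj₁ τ (flow₁ k m n β)).coeff s =
      flowA k n β • (conj₁ τ (lamNeg (n * k + k - β) * HahnSeries.C dx)).coeff s +
      flowB₁ k n β • (epsInvOp * (conj₁ τ (lamNeg (n * k + k - β))).coeff s) := by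
  have h : flow₁ k m n β = flowA k n β • (lamNeg (n * k + k - β) * HahnSeries.C dx) +
      flowB₁ k n β • (HahnSeries.C epsInvOp * lamNeg (n * k + k - β)) := by
    rw [flow₁, upTerm, flowOp_eq]
    exact single_flow (R := FockOp k m) _ (commute_dx_shift _)
  rw [h]
  exact coeff_conjBy_flow (R := FockOp k m) _ _ (commute_epsInv_P₁ τ) s

theorem coeff_conj₂_flow₂ (τ : Fock k m) (n β : ℕ) (s : ℤ) :
    (conj₂ logQ τ (flow₂ k m logQ n β)).coeff s =
      flowA k n β • (conj₂ logQ τ (lamQ logQ (β - k + n * m) * HahnSeries.C dx)).coeff s +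
      flowB₂ k m n β • (epsInvOp * (conj₂ logQ τ (lamQ logQ (β - k + n * m))).coeff s) := by
  have h : flow₂ k m logQ n β =
      flowA k n β • (lamQ logQ (β - k + n * m) * HahnSeries.C dx) +
      flowB₂ k m n β • (HahnSeries.C epsInvOp * lamQ logQ (β - k + n * m)) := by
    rw [flow₂, downTerm, flowOp_eq]
    exact single_flow (R := FockOp k m) _ ((commute_dx_shift _).smul_right _)
  rw [h]
  exact coeff_conjBy_flow (R := FockOp k m) _ _ (commute_epsInv_P₂ logQ τ) s

/-- The expression through `P₁` bounds the degrees from below, the one through `P₂` from above. -/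
theorem SatisfiesHQE.finite_support_conj (hk : 1 ≤ k) (hm : 1 ≤ m) (hτ : IsUnit τ)
    (h : SatisfiesHQE k m logQ τ) (n : ℕ) :
    (Function.support (ofUp (conj₁ τ (lamNeg (k * n))))).Finite := by
  refine (Set.finite_Icc (-((k * n : ℕ) : ℤ)) ((m * n : ℕ) : ℤ)).subset fun s hs => ?_
  rw [Function.mem_support] at hs
  refine ⟨?_, ?_⟩
  · by_contra h1
    exact hs (coeff_conj₁_of_lt hτ (by omega))
  · by_contra h1
    rw [h.ofUp_conj_eq hk hm hτ] at hs
    exact hs (coeff_conj₂_of_lt hτ (by omega))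

theorem smul_combine {V : Type} [AddCommGroup V] [Module ℂ V] {k m h q : ℂ} (hk : k ≠ 0)
    (hm : m ≠ 0) (P Q x : V) :
    (1 / (2 * m)) • (m • Q + (m * q) • x) + (1 / (2 * k)) • (-(k • P)) - (h + q / 2) • x =
      -((1 / 2 : ℂ) • P) + ((1 / 2 : ℂ) • Q - h • x) := by
  have h1 : (1 / (2 * m)) * m = 1 / 2 := by field_simp
  have h2 : (1 / (2 * k)) * k = 1 / 2 := by field_simp
  have h3 : (1 / (2 * m)) * (m * q) = q / 2 := by field_simp
  rw [smul_add, smul_smul, smul_smul, smul_neg, smul_smul, h1, h2, h3]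
  module

/-- The constant (log Q)/2 cancels the contribution of m log Q in log₊ L. The scalar `c` is put with
the series in Λ⁻¹ so that each summand is one-sided. -/
theorem laxLog_sub (hk : 1 ≤ k) (hm : 1 ≤ m) (c : ℂ) :
    laxLog logQ τ - (c + logQ / 2) • oneT =
      ofUp (-((1 / 2 : ℂ) • conj₁ τ epsDx)) +
        ofDown ((1 / 2 : ℂ) • conj₂ logQ τ epsDx - c • (1 : OneSided k m)) := by
  have hk0 : (k : ℂ) ≠ 0 := Nat.cast_ne_zero.2 (by omega)
  have hm0 : (m : ℂ) ≠ 0 := Nat.cast_ne_zero.2 (by omega)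
  funext s
  have h1 : (oneT : TwoSided k m) s = (1 : OneSided k m).coeff (-s) := by
    have h2 := HahnSeries.coeff_one (Γ := ℤ) (R := FockOp k m) (a := -s)
    rw [h2, oneT]
    split_ifs <;> first | rfl | omega
  have h3 := smul_combine (V := FockOp k m) (h := c) (q := logQ) hk0 hm0
    ((conj₁ τ epsDx).coeff s) ((conj₂ logQ τ epsDx).coeff (-s)) ((1 : OneSided k m).coeff (-s))
  have h4 := coeff_smul_add_smul (R := FockOp k m) (m : ℂ) ((m : ℂ) * logQ) (conj₂ logQ τ epsDx)
    (1 : OneSided k m) (-s)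
  have h5 := coeff_neg_smul (R := FockOp k m) (k : ℂ) (conj₁ τ epsDx) s
  have h6 := coeff_smul_sub_smul (R := FockOp k m) (1 / 2 : ℂ) c (conj₂ logQ τ epsDx)
    (1 : OneSided k m) (-s)
  have h7 := coeff_neg_smul (R := FockOp k m) (1 / 2 : ℂ) (conj₁ τ epsDx) s
  rw [← h4, ← h5, ← h6, ← h7, ← h1] at h3
  exact h3

/-- For β < k only the flow operator of `P₁` is non-zero and gives the power of L^{1/k}; for β > k
only that of `P₂`, giving the power of L^{1/m}; for β = k both contribute, one for each half of the
logarithm. -/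
theorem SatisfiesHQE.laxB_eq (hk : 1 ≤ k) (hm : 1 ≤ m) (hτ : IsUnit τ)
    (h : SatisfiesHQE k m logQ τ) (n β : ℕ) (s : ℤ) :
    laxB logQ τ n β s =
      (conj₂ logQ τ (flow₂ k m logQ n β)).coeff (-s) - (conj₁ τ (flow₁ k m n β)).coeff s := by
  have g1 : ∀ {R : Type} [Ring R] [Algebra ℂ R] (e x y z w : R) (c : ℂ),
      e * (c • x) = ((0 : ℂ) • y + (0 : ℂ) • z) - ((0 : ℂ) • w + (-c) • (e * x)) := by
    intro R _ _ e x y z w c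
    rw [mul_smul_comm]
    module
  have g2 : ∀ {R : Type} [Ring R] [Algebra ℂ R] (e x y z w : R) (c : ℂ),
      e * (c • x) = ((0 : ℂ) • y + c • (e * x)) - ((0 : ℂ) • w + (0 : ℂ) • z) := by
    intro R _ _ e x y z w c
    rw [mul_smul_comm]
    module
  rw [coeff_conj₁_flow₁, coeff_conj₂_flow₂]
  rcases lt_trichotomy β k with hβ | hβ | hβ
  · rw [flowA, if_neg hβ.ne, flowB₂, if_pos hβ, flowB₁, if_pos hβ, laxB, if_pos hβ, rootK_eq hτ]
    exact g1 (R := FockOp k m) _ _ _ _ _ _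
  · subst hβ
    have he1 : n * β + β - β = β * n := by rw [Nat.add_sub_cancel, mul_comm]
    have he2 : β - β + n * m = m * n := by rw [Nat.sub_self, zero_add, mul_comm]
    -- L^n is distributed over the two halves of log L and written as P₁Λ^{-kn}P₁⁻¹ in front of log₋
    -- L, but as P₂(QΛ)^{mn}P₂⁻¹ in front of log₊ L, so that both products are products of one-sided
    -- series.
    rw [flowA, if_pos rfl, flowB₂, if_neg (lt_irrefl β), if_pos rfl, flowB₁,
      if_neg (lt_irrefl β), if_pos rfl, laxB, if_neg (lt_irrefl β), if_pos rfl, he1, he2,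
      laxPow_eq hτ, laxLog_sub hk hm, mulT_add (h.finite_support_conj hk hm hτ n), mulT_ofUp,
      h.ofUp_conj_eq hk hm hτ n, mulT_ofDown, ← h.coeff_conj_eq hk hm hτ n s]
    have hx := h.coeff_conj_eq hk hm hτ n s
    have i1 : conj₁ τ (lamNeg (β * n)) * -((1 / 2 : ℂ) • conj₁ τ epsDx) =
        -((1 / 2 : ℂ) • conj₁ τ (lamNeg (β * n) * epsDx)) := by
      have j1 := conjBy_mul (S := OneSided β m) (isUnit_P₁ hτ) (lamNeg (β * n)) epsDx
      have j2 : ∀ {S : Type} [Ring S] [Algebra ℂ S] (x y z : S) (c : ℂ), x * y = z →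
          x * -(c • y) = -(c • z) := by
        intro S _ _ x y z c hz
        rw [mul_neg, mul_smul_comm, hz]
      exact j2 (S := OneSided β m) _ _ _ _ j1
    have i2 : conj₂ logQ τ (lamQ logQ (m * n)) * ((1 / 2 : ℂ) • conj₂ logQ τ epsDx -
        (harm n / 2 * (1 / (β : ℂ) + 1 / (m : ℂ))) • (1 : OneSided β m)) =
        (1 / 2 : ℂ) • conj₂ logQ τ (lamQ logQ (m * n) * epsDx) -
          (harm n / 2 * (1 / (β : ℂ) + 1 / (m : ℂ))) • conj₂ logQ τ (lamQ logQ (m * n)) := by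
      have j1 := conjBy_mul (S := OneSided β m) (isUnit_P₂ logQ hτ) (lamQ logQ (m * n)) epsDx
      have j2 : ∀ {S : Type} [Ring S] [Algebra ℂ S] (x y z : S) (c d : ℂ), x * y = z →
          x * (c • y - d • 1) = c • z - d • x := by
        intro S _ _ x y z c d hz
        rw [mul_sub, mul_smul_comm, mul_smul_comm, hz, mul_one]
      exact j2 (S := OneSided β m) _ _ _ _ _ j1
    have hd : (epsInvOp * (epsOp * dx) : FockOp β m) = dx := by
      rw [← mul_assoc, epsInvOp_mul_epsOp, one_mul]
    have hp := coeff_conjBy_mul_C (R := FockOp β m) (commute_epsInv_P₁ τ)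
      (commute_epsInv_lamNeg (β * n)) hd s
    have hq := coeff_conjBy_mul_C (R := FockOp β m) (commute_epsInv_P₂ logQ τ)
      (commute_epsInv_lamQ logQ (m * n)) hd (-s)
    rw [i1, i2]
    refine Eq.trans ?_ (log_flow_identity (R := FockOp β m) hp hq)
    rw [hx]
    rfl
  · rw [flowA, if_neg hβ.ne', flowB₂, if_neg (by omega), if_neg hβ.ne', flowB₁,
      if_neg (by omega), if_neg hβ.ne', laxB, if_neg (by omega), if_neg hβ.ne', rootM_eq hτ]
    exact g2 (R := FockOp k m) _ _ _ _ _ _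

/-! ## The Lax equations -/

theorem coeff_commutator_eq_zero {R : Type} [Ring R] {d : R} {P : HahnSeries ℤ R}
    (hP : ∀ i < 0, P.coeff i = 0) {s : ℤ} (hs : s < 0) :
    (HahnSeries.C d * P - P * HahnSeries.C d).coeff s = 0 := by
  rw [coeff_commutator_C, hP s hs, mul_zero, zero_mul, sub_zero]

theorem coeff_zero_P₁ (hτ : IsUnit τ) : (P₁ τ).coeff 0 = 1 := by
  refine (coeff_ofPowerSeries (R := FockOp k m) _ 0).trans ?_
  rw [if_pos le_rfl, Int.toNat_zero, PowerSeries.coeff_mk, symbol₁_zero hτ, Nat.cast_zero,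
    shift_zero, mulOp_one, mul_one]

/-- The leading coefficient 1 of `P₁` commutes with `D`, so [D, P₁] starts in degree 1. For `P₂` the
leading coefficient is a function and degree 0 survives, whence the splitting into positive and
non-positive parts. -/
theorem coeff_logDeriv_P₁ (hτ : IsUnit τ) (D : FockOp k m) {s : ℤ} (hs : s ≤ 0) :
    (logDeriv (HahnSeries.C D) (P₁ τ)).coeff s = 0 := by
  refine coeff_hahn_mul_eq_zero (R := FockOp k m) (a := 1) (b := 0) (fun i hi => ?_)
    (fun _ => coeff_inverse_P₁ hτ) (by omega)
  refine (coeff_commutator_C (R := FockOp k m) D (P₁ τ) i).trans ?_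
  rcases lt_or_eq_of_le (Int.lt_add_one_iff.1 (show i < 0 + 1 by omega)) with h | h
  · rw [coeff_P₁_of_neg τ h, mul_zero, zero_mul, sub_zero]
  · rw [h, coeff_zero_P₁ hτ, mul_one, one_mul, sub_self]

theorem coeff_logDeriv_P₂ (hτ : IsUnit τ) (D : FockOp k m) {s : ℤ} (hs : s < 0) :
    (logDeriv (HahnSeries.C D) (P₂ logQ τ)).coeff s = 0 :=
  coeff_hahn_mul_eq_zero (R := FockOp k m) (a := 0) (b := 0)
    (fun _ hi => coeff_commutator_eq_zero (R := FockOp k m) (fun _ => coeff_P₂_of_neg logQ τ) hi)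
    (fun _ => coeff_inverse_P₂ logQ hτ) (by omega)

theorem eq_sub_of_add_eq_add_sub {V : Type} [AddCommGroup V] {x y c d b : V} (h : x + c = y + d)
    (hb : b = d - c) : b = x - y := by
  rw [hb, sub_eq_sub_iff_add_eq_add, add_comm x c, add_comm d y] at *
  rw [← h, add_comm]

theorem SatisfiesHQE.laxB_eq_sub (hk : 1 ≤ k) (hm : 1 ≤ m) (hτ : IsUnit τ)
    (h : SatisfiesHQE k m logQ τ) {n β : ℕ} (h1 : 1 ≤ β) (h2 : β ≤ k + m) (s : ℤ) :
    laxB logQ τ n β s = (logDeriv (HahnSeries.C (dq n β)) (P₁ τ)).coeff s -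
      (logDeriv (HahnSeries.C (dq n β)) (P₂ logQ τ)).coeff (-s) :=
  eq_sub_of_add_eq_add_sub (V := FockOp k m) (h.coeff_flow_all hk hm hτ h1 h2 s)
    (h.laxB_eq hk hm hτ n β s)

/-- In B_n^β = ∂P₁·P₁⁻¹ - ∂P₂·P₂⁻¹ the second term has no positive degrees and the first has no
others. -/
theorem SatisfiesHQE.pos_laxB (hk : 1 ≤ k) (hm : 1 ≤ m) (hτ : IsUnit τ)
    (h : SatisfiesHQE k m logQ τ) {n β : ℕ} (h1 : 1 ≤ β) (h2 : β ≤ k + m) :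
    pos (laxB logQ τ n β) = ofUp (logDeriv (HahnSeries.C (dq n β)) (P₁ τ)) := by
  funext s
  unfold pos
  split_ifs with hs
  · rw [h.laxB_eq_sub hk hm hτ h1 h2, coeff_logDeriv_P₂ hτ _ (by omega), sub_zero]
    rfl
  · exact (coeff_logDeriv_P₁ hτ _ (by omega)).symm

theorem SatisfiesHQE.nonpos_laxB (hk : 1 ≤ k) (hm : 1 ≤ m) (hτ : IsUnit τ)
    (h : SatisfiesHQE k m logQ τ) {n β : ℕ} (h1 : 1 ≤ β) (h2 : β ≤ k + m) :
    nonpos (laxB logQ τ n β) = ofDown (-logDeriv (HahnSeries.C (dq n β)) (P₂ logQ τ)) := by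
  funext s
  have h3 : ofDown (-logDeriv (HahnSeries.C (dq n β)) (P₂ logQ τ)) s =
      -((logDeriv (HahnSeries.C (dq n β)) (P₂ logQ τ)).coeff (-s)) := rfl
  rw [h3]
  unfold nonpos
  split_ifs with hs
  · rw [h.laxB_eq_sub hk hm hτ h1 h2, coeff_logDeriv_P₁ hτ _ hs]
    exact zero_sub (_ : FockOp k m)
  · rw [coeff_logDeriv_P₂ hτ _ (by omega)]
    exact (neg_zero (G := FockOp k m)).symm

theorem SatisfiesHQE.lax_equation_pos (hk : 1 ≤ k) (hm : 1 ≤ m) (hτ : IsUnit τ)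
    (h : SatisfiesHQE k m logQ τ) {n β : ℕ} (h1 : 1 ≤ β) (h2 : β ≤ k + m) :
    dqT n β (lax τ) = bracket (pos (laxB logQ τ n β)) (lax τ) := by
  rw [h.pos_laxB hk hm hτ h1 h2, lax, dqT_ofUp, bracket_ofUp]
  exact congrArg ofUp (commutator_conjBy (S := OneSided k m) (isUnit_P₁ hτ)
    (commute_single_single (R := FockOp k m) (commute_dq_shift h1 h2 _) _ _))

/-- Uses L = P₂(QΛ)^mP₂⁻¹, since the non-positive part of B_n^β is -∂P₂·P₂⁻¹; ∂/∂q_n^β commutes with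
(QΛ)^m. -/
theorem SatisfiesHQE.lax_equation_nonpos (hk : 1 ≤ k) (hm : 1 ≤ m) (hτ : IsUnit τ)
    (h : SatisfiesHQE k m logQ τ) {n β : ℕ} (h1 : 1 ≤ β) (h2 : β ≤ k + m) :
    dqT n β (lax τ) = -bracket (nonpos (laxB logQ τ n β)) (lax τ) := by
  have h3 : ∀ {S : Type} [Ring S] {x y z : S}, z = x * y - y * x → z = -(-x * y - y * -x) := by
    intro S _ x y z hz
    rw [hz]; noncomm_ring
  rw [h.nonpos_laxB hk hm hτ h1 h2, h.lax_eq hk hm hτ, lax', dqT_ofDown, bracket_ofDown,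
    ← ofDown_neg]
  exact congrArg ofDown (h3 (S := OneSided k m) (commutator_conjBy (S := OneSided k m)
    (isUnit_P₂ logQ hτ) (commute_single_single (R := FockOp k m)
      ((commute_dq_shift h1 h2 _).smul_right _) _ _)))

end HQE

end

end EBTH

end

theorem mainTheorem1 (k m : ℕ) (hk : 1 ≤ k) (hm : 1 ≤ m) (logQ : ℂ) (τ : EBTH.Fock k m)
    (hτ : IsUnit τ) (hqe : EBTH.SatisfiesHQE k m logQ τ) :
    IsUnit (EBTH.P₁ τ) ∧ IsUnit (EBTH.P₂ logQ τ) ∧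
    EBTH.lax τ = EBTH.lax' logQ τ ∧
    (∃ u : ℤ → EBTH.Fock k m,
      (∀ j : ℤ, EBTH.lax τ j = EBTH.mulOp (u j) * EBTH.shift (j : ℂ)) ∧
      u (-(k : ℤ)) = 1 ∧ ∀ j : ℤ, j < -(k : ℤ) ∨ (m : ℤ) < j → u j = 0) ∧
    ∀ n β : ℕ, 1 ≤ β → β ≤ k + m →
      EBTH.dqT n β (EBTH.lax τ) =
        -EBTH.bracket (EBTH.nonpos (EBTH.laxB logQ τ n β)) (EBTH.lax τ) ∧
      EBTH.dqT n β (EBTH.lax τ) =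
        EBTH.bracket (EBTH.pos (EBTH.laxB logQ τ n β)) (EBTH.lax τ) := by
  exact ⟨EBTH.isUnit_P₁ hτ, EBTH.isUnit_P₂ logQ hτ, hqe.lax_eq hk hm hτ,
    hqe.exists_coeff hk hm hτ, fun _ _ h1 h2 =>
      ⟨hqe.lax_equation_nonpos hk hm hτ h1 h2, hqe.lax_equation_pos hk hm hτ h1 h2⟩⟩
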